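/- **Setting.** Let $\varepsilon_0>0$, $\alpha\in(0,1)$ and let $C$ be a constant independent of $\varepsilon$. *Limit problem.* $X_0$ is a real Hilbert space of dimension $n\ge 1$, $A_0:X_0\to X_0$ is an invertible bounded linear operator whose spectrum is $\sigma(A_0)=\{\lambda_1^0<\dots<\lambda_n^0\}$ with $\lambda_1^0>0$, and $f_0:X_0\to X_0$ is continuously differentiable. *Perturbed problems.* For $\varepsilon\in(0,\varepsilon_0]$ let $X_\varepsilon$ be a real Hilbert space and $A_\varepsilon:D(A_\varepsilon)\subset X_\varepsilon\to X_\varepsilon$ an invertible, positive, self-adjoint operator with compact resolvent. Let $P_\lambda$ be the orthogonal projection onto $\ker(A_\varepsilon-\lambda)$, let $A_\varepsilon^\alpha u=\sum_{\lambda\in\sigma(A_\varepsilon)}\lambda^\alpha P_\lambda u$, and let $X_\varepsilon^\alpha=D(A_\varepsilon^\alpha)$ with norm $\|u\|_{X_\varepsilon^\alpha}=\|A_\varepsilon^\alpha u\|_{X_\varepsilon}$. Let $f_\varepsilon:X_\varepsilon^\alpha\to X_\varepsilon$ be continuously differentiable with $\|f_\varepsilon(u)\|_{X_\varepsilon}\le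 C$ and $\|f_\varepsilon(u)-f_\varepsilon(v)\|_{X_\varepsilon}\le C\|u-v\|_{X_\varepsilon^\alpha}$. Let $T_\varepsilon(t)$, $t\ge0$, be the solution operator on $X_\varepsilon^\alpha$ of $$u_t+A_\varepsilon u=f_\varepsilon(u),\qquad u(0)=u_0\in X_\varepsilon^\alpha,\tag{P}$$ that is, $t\mapsto T_\varepsilon(t)u_0$ is continuous into $X^\alpha_\varepsilon$, $T_\varepsilon(0)u_0=u_0$, and $T_\varepsilon(t)u_0=e^{-A_\varepsilon t}u_0+\int_0^te^{-A_\varepsilon(t-s)}f_\varepsilon(T_\varepsilon(s)u_0)\,ds$ for $t>0$. *Convergence.* There are bounded linear operators $E_\varepsilon:X_0\to X_\varepsilon^\alpha$ and $M_\varepsilon:X_\varepsilon\to X_0$ with $M_\varepsilon E_\varepsilon=I_{X_0}$, $\|E_\varepsilon x\|_{X_\varepsilon}\to\|x\|_{X_0}$ as $\varepsilon\to0$ for all $x\in X_0$, and with the norms of $E_\varepsilon$ in $\mathcal L(X_0,X_\varepsilon)$ and $\mathcal L(X_0,X_\varepsilon^\alpha)$ and of $M_\varepsilon$ in $\mathcal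 L(X_\varepsilon,X_0)$ and $\mathcal L(X_\varepsilon^\alpha,X_0)$ at most $C$. A family $u^\varepsilon\in X^\alpha_\varepsilon$ E-converges to $u^0\in X_0$ if $\|u^\varepsilon-E_\varepsilon u^0\|_{X_\varepsilon^\alpha}\to0$ (likewise along a sequence $\varepsilon_k\to0$). Assume that $A_\varepsilon^{-1}$ converges compactly to $A_0^{-1}$: if $u^\varepsilon$ E-converges to $u^0$, then $A_\varepsilon^{-1}u^\varepsilon$ E-converges to $A_0^{-1}u^0$; and if $\|u^\varepsilon\|_{X_\varepsilon^\alpha}=1$ for all $\varepsilon$, then every sequence $\varepsilon_k\to0$ has a subsequence along which $A_{\varepsilon}^{-1}u^{\varepsilon}$ E-converges to some element of $X_0$. Let $\tau,\rho:[0,\varepsilon_0]\to[0,\infty)$ be increasing functions, positive on $(0,\varepsilon_0]$, with $\tau(0)=\rho(0)=0$, such that $$\|A_\varepsilon^{-1}-E_\varepsilon A_0^{-1}M_\varepsilon\|_{\mathcal L(X_\varepsilon,X_\varepsilon^\alpha)}\le\tau(\varepsilon),\qquad \|f_\varepsilon(u)-E_\varepsilon f_0(x)\|_{X_\varepsilon}\le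 C\|u-E_\varepsilon x\|_{X_\varepsilon^\alpha}+\rho(\varepsilon)$$ for all $u\in X_\varepsilon^\alpha$, $x\in X_0$. *Spectral splitting.* Fix $\delta>0$. Let $Q_\varepsilon$ be the spectral projection of $A_\varepsilon$ for the interval $(\lambda_1^0-\delta,\lambda_n^0+\delta)$, i.e. the orthogonal projection of $X_\varepsilon$ onto the span of the eigenvectors of $A_\varepsilon$ with eigenvalues in this interval, and put $Y_\varepsilon=Q_\varepsilon X_\varepsilon^\alpha$, $Z_\varepsilon=(I-Q_\varepsilon)X_\varepsilon^\alpha$, both with the norm of $X_\varepsilon^\alpha$, and $A_\varepsilon^+=A_\varepsilon|_{Y_\varepsilon}$. **Theorem.** There are $\varepsilon_1>0$ and $C'>0$, with $C'$ independent of $\varepsilon$, such that for every $\varepsilon\in(0,\varepsilon_0]$ with $\varepsilon\le\varepsilon_1$ the following holds. The space $Y_\varepsilon$ has dimension $n$, and every eigenvalue of $A_\varepsilon$ outside $(\lambda_1^0-\delta,\lambda_n^0+\delta)$ is larger than $\lambda_n^0+\delta$. There is a Lipschitz continuous map $s_*^\varepsilon:Y_\varepsilon\to Z_\varepsilon$ with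 $$\sup_{v\in Y_\varepsilon}\|s_*^\varepsilon(v)\|_{X_\varepsilon^\alpha}\le C'(\tau(\varepsilon)+\rho(\varepsilon)),$$ whose graph $\mathcal M_\varepsilon=\{v+s_*^\varepsilon(v):v\in Y_\varepsilon\}$ has the following properties. 1. $\mathcal M_\varepsilon$ is an invariant manifold for (P): through every $u_0\in\mathcal M_\varepsilon$ there is a global solution, i.e. a continuous $\xi:\mathbb R\to X_\varepsilon^\alpha$ with $T_\varepsilon(t)\xi(r)=\xi(t+r)$ for $r\in\mathbb R$, $t\ge0$, such that $\xi(0)=u_0$ and $\xi(t)\in\mathcal M_\varepsilon$ for all $t\in\mathbb R$. 2. $\mathcal M_\varepsilon$ is exponentially attracting: there is $\kappa>0$ such that for every bounded $B\subset X_\varepsilon^\alpha$ there is $c>0$ with $\sup_{u\in B}\inf_{w\in\mathcal M_\varepsilon}\|T_\varepsilon(t)u-w\|_{X_\varepsilon^\alpha}\le c\,e^{-\kappa t}$ for all $t\ge0$. 3. The global attractor $\mathcal A_\varepsilon$ of $T_\varepsilon$ (the compact set with $T_\varepsilon(t)\mathcal A_\varepsilon=\mathcal A_\varepsilon$ for all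 $t\ge0$ that attracts every bounded set in the Hausdorff semidistance) is contained in $\mathcal M_\varepsilon$. Through every point of $\mathcal A_\varepsilon$ there is a global solution that stays in $\mathcal A_\varepsilon$, and every global solution $u$ with values in $\mathcal A_\varepsilon$ has the form $$u(t)=v(t)+s_*^\varepsilon(v(t)),\quad t\in\mathbb R,$$ where $v:\mathbb R\to Y_\varepsilon$ is differentiable and satisfies $\dot v+A_\varepsilon^+v=Q_\varepsilon f_\varepsilon\big(v+s_*^\varepsilon(v)\big)$ on $\mathbb R$. -/

import Mathlib

open Filter Topology Set

open scoped RealInnerProductSpace ENNReal NNReal ContDiff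

noncomputable section

/-- An invertible, positive, self-adjoint (in general unbounded) linear operator
`op : D(A) ⊂ X → X` with compact resolvent on a real Hilbert space; `inv` is the
everywhere defined inverse `A⁻¹`, that is, the resolvent at `0`. -/
structure PosOperator (X : Type*) [NormedAddCommGroup X] [InnerProductSpace ℝ X]
    [CompleteSpace X] where
  op : X →ₗ.[ℝ] X
  selfAdjoint : IsSelfAdjoint op
  nonneg : ∀ x : op.domain, 0 ≤ ⟪op x, (x : X)⟫
  inv : X →L[ℝ] X
  inv_eq_iff : ∀ y x : X, inv y = x ↔ ∃ h : x ∈ op.domain, op ⟨x, h⟩ = y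
  compact_inv : IsCompactOperator inv

namespace PosOperator

variable {X : Type*} [NormedAddCommGroup X] [InnerProductSpace ℝ X] [CompleteSpace X]
variable (A : PosOperator X)

/-- The eigenspace `{x ∈ D(A) : A x = μ x}`. -/
def eigenspace (μ : ℝ) : Submodule ℝ X where
  carrier := {x | ∃ h : x ∈ A.op.domain, A.op ⟨x, h⟩ = μ • x}
  zero_mem' := ⟨A.op.domain.zero_mem, by
    have : (⟨0, A.op.domain.zero_mem⟩ : A.op.domain) = 0 := rfl
    rw [this, LinearPMap.map_zero, smul_zero]⟩
  add_mem' := by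
    rintro x y ⟨hx, ex⟩ ⟨hy, ey⟩
    refine ⟨A.op.domain.add_mem hx hy, ?_⟩
    have : (⟨x + y, A.op.domain.add_mem hx hy⟩ : A.op.domain) = ⟨x, hx⟩ + ⟨y, hy⟩ := rfl
    rw [this, LinearPMap.map_add, ex, ey, smul_add]
  smul_mem' := by
    rintro c x ⟨hx, ex⟩
    refine ⟨A.op.domain.smul_mem c hx, ?_⟩
    have : (⟨c • x, A.op.domain.smul_mem c hx⟩ : A.op.domain) = c • ⟨x, hx⟩ := rfl
    rw [this, LinearPMap.map_smul, ex, smul_comm]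

theorem mem_eigenspace_iff (μ : ℝ) (x : X) : x ∈ A.eigenspace μ ↔ A.inv (μ • x) = x :=
  (A.inv_eq_iff (μ • x) x).symm

theorem isClosed_eigenspace (μ : ℝ) : IsClosed (A.eigenspace μ : Set X) := by
  have : (A.eigenspace μ : Set X) = {x | A.inv (μ • x) = x} := by
    ext x; exact A.mem_eigenspace_iff μ x
  rw [this]
  exact isClosed_eq (by fun_prop) continuous_id

instance (μ : ℝ) : CompleteSpace (A.eigenspace μ) :=
  (A.isClosed_eigenspace μ).completeSpace_coe

/-- The orthogonal projection of `X` onto the eigenspace of `A` at `μ`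
(it is `0` if `μ` is not an eigenvalue). -/
def proj (μ : ℝ) : X →L[ℝ] X := (A.eigenspace μ).starProjection

theorem op_symm (x y : A.op.domain) : ⟪A.op x, (y : X)⟫ = ⟪(x : X), A.op y⟫ := by
  have h := LinearPMap.adjoint_isFormalAdjoint A.selfAdjoint.dense_domain
  rw [LinearPMap.isSelfAdjoint_def.1 A.selfAdjoint] at h
  exact h x y

theorem inv_symm (x y : X) : ⟪A.inv x, y⟫ = ⟪x, A.inv y⟫ := by
  obtain ⟨hx, ex⟩ := (A.inv_eq_iff x _).1 rfl
  obtain ⟨hy, ey⟩ := (A.inv_eq_iff y _).1 rfl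
  have := A.op_symm ⟨_, hx⟩ ⟨_, hy⟩
  rw [ex, ey] at this
  exact this.symm

theorem eigenspace_eq_bot {μ : ℝ} (hμ : μ ≤ 0) : A.eigenspace μ = ⊥ := by
  rw [eq_bot_iff]
  rintro x ⟨hx, ex⟩
  have h1 := A.nonneg ⟨x, hx⟩
  rw [ex] at h1
  simp only [real_inner_smul_left, real_inner_self_eq_norm_sq] at h1
  have h2 : μ • x = 0 := by
    rcases hμ.lt_or_eq with h | h
    · have : ‖x‖ ^ 2 = 0 := by nlinarith [sq_nonneg ‖x‖]
      have : x = 0 := by simpa using this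
      simp [this]
    · simp [h]
  have h3 := (A.mem_eigenspace_iff μ x).1 ⟨hx, ex⟩
  rw [h2, map_zero] at h3
  simp [← h3]

theorem proj_eq_zero {μ : ℝ} (hμ : μ ≤ 0) (u : X) : A.proj μ u = 0 := by
  have h : A.proj μ u ∈ A.eigenspace μ := Submodule.starProjection_apply_mem _ _
  rw [A.eigenspace_eq_bot hμ] at h
  simpa using h

theorem proj_of_mem {μ : ℝ} {u : X} (hu : u ∈ A.eigenspace μ) : A.proj μ u = u :=
  Submodule.starProjection_eq_self_iff.2 hu

theorem inner_eq_zero {μ ν : ℝ} (h : μ ≠ ν) {x y : X} (hx : x ∈ A.eigenspace μ)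
    (hy : y ∈ A.eigenspace ν) : ⟪x, y⟫ = 0 := by
  obtain ⟨hx, ex⟩ := hx
  obtain ⟨hy, ey⟩ := hy
  have := A.op_symm ⟨x, hx⟩ ⟨y, hy⟩
  rw [ex, ey] at this
  simp only [real_inner_smul_left, real_inner_smul_right] at this
  have h2 : (μ - ν) * ⟪x, y⟫ = 0 := by linarith
  rcases mul_eq_zero.1 h2 with h3 | h3
  · exact absurd (sub_eq_zero.1 h3) h
  · exact h3

theorem proj_of_mem_ne {μ ν : ℝ} (h : μ ≠ ν) {u : X} (hu : u ∈ A.eigenspace μ) :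
    A.proj ν u = 0 := by
  refine (Submodule.starProjection_apply_eq_zero_iff _).2 ?_
  rw [Submodule.mem_orthogonal]
  intro y hy
  exact A.inner_eq_zero h.symm hy hu

theorem orthogonalFamily :
    OrthogonalFamily ℝ (fun μ => A.eigenspace μ) fun μ => (A.eigenspace μ).subtypeₗᵢ := by
  intro μ ν h x y
  exact A.inner_eq_zero h x.2 y.2

theorem orthogonal_iSup_eigenspace : (⨆ μ, A.eigenspace μ)ᗮ = ⊥ := by
  have hs : (A.inv : X →ₗ[ℝ] X).IsSymmetric := fun x y => A.inv_symm x y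
  have key := ContinuousLinearMap.orthogonalComplement_iSup_eigenspaces_eq_bot A.compact_inv hs
  rw [eq_bot_iff, ← key]
  refine Submodule.orthogonal_le (iSup_le fun ν => ?_)
  intro x hx
  rw [Module.End.mem_eigenspace_iff] at hx
  have hx' : A.inv x = ν • x := hx
  by_cases hν : ν = 0
  · have h0 : A.inv x = 0 := by rw [hx', hν, zero_smul]
    obtain ⟨h, e⟩ := (A.inv_eq_iff x 0).1 h0
    have : (⟨0, h⟩ : A.op.domain) = 0 := rfl
    rw [this, LinearPMap.map_zero] at e
    rw [← e]
    exact Submodule.zero_mem _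
  · refine Submodule.mem_iSup_of_mem ν⁻¹ ((A.mem_eigenspace_iff _ _).2 ?_)
    rw [map_smul, hx', smul_smul, inv_mul_cancel₀ hν, one_smul]

theorem isHilbertSum :
    IsHilbertSum ℝ (fun μ => A.eigenspace μ) fun μ => (A.eigenspace μ).subtypeₗᵢ := by
  refine IsHilbertSum.mkInternal _ A.orthogonalFamily ?_
  rw [Submodule.topologicalClosure_eq_top_iff.2 A.orthogonal_iSup_eigenspace]

theorem proj_of_hasSum {w : ℝ → X} {u : X} (hw : ∀ μ, w μ ∈ A.eigenspace μ)
    (h : HasSum w u) (ν : ℝ) : A.proj ν u = w ν := by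
  have h1 : HasSum (fun μ => A.proj ν (w μ)) (A.proj ν u) := h.mapL (A.proj ν)
  have h2 : HasSum (fun μ => A.proj ν (w μ)) (A.proj ν (w ν)) :=
    hasSum_single ν fun μ hμ => A.proj_of_mem_ne hμ (hw μ)
  rw [h1.unique h2, A.proj_of_mem (hw ν)]

theorem hasSum_proj (u : X) : HasSum (fun μ => A.proj μ u) u := by
  have h := A.isHilbertSum.hasSum_linearIsometryEquiv_symm (A.isHilbertSum.linearIsometryEquiv u)
  rw [LinearIsometryEquiv.symm_apply_apply] at h
  have h2 := A.proj_of_hasSum (w := fun μ =>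
    ((A.isHilbertSum.linearIsometryEquiv u μ : A.eigenspace μ) : X)) (fun μ => Subtype.mem _) h
  rw [show (fun μ => A.proj μ u) = _ from funext h2]
  exact h

theorem summable_smul_proj_iff (c : ℝ → ℝ) (u : X) :
    Summable (fun μ => c μ • A.proj μ u) ↔ Summable fun μ => ‖c μ • A.proj μ u‖ ^ 2 :=
  A.orthogonalFamily.summable_iff_norm_sq_summable fun μ =>
    (⟨c μ • A.proj μ u, (A.eigenspace μ).smul_mem _ (Submodule.starProjection_apply_mem _ _)⟩ :
      A.eigenspace μ)

/-- The domain `D(A^α) = {u : ∑ λ^{2α} ‖P_λ u‖² < ∞}`, where `P_λ` are the orthogonal projections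
onto the eigenspaces. The sum runs over all real `μ`; only eigenvalues contribute. -/
def fracDomain (α : ℝ) : Submodule ℝ X where
  carrier := {u | Summable fun μ : ℝ => (μ ^ α * ‖A.proj μ u‖) ^ 2}
  zero_mem' := by simp
  add_mem' := by
    intro u v hu hv
    have key : ∀ u : X, (Summable fun μ : ℝ => (μ ^ α * ‖A.proj μ u‖) ^ 2) ↔
        Summable fun μ : ℝ => μ ^ α • A.proj μ u := fun u => by
      rw [A.summable_smul_proj_iff]
      simp only [norm_smul, mul_pow, Real.norm_eq_abs, sq_abs]
    rw [Set.mem_ofPred_eq, key] at *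
    simpa [smul_add] using hu.add hv
  smul_mem' := by
    intro c u hu
    have : (fun μ : ℝ => (μ ^ α * ‖A.proj μ (c • u)‖) ^ 2) =
        fun μ : ℝ => c ^ 2 * (μ ^ α * ‖A.proj μ u‖) ^ 2 := by
      funext μ
      rw [map_smul, norm_smul, Real.norm_eq_abs]
      calc _ = |c| ^ 2 * (μ ^ α * ‖A.proj μ u‖) ^ 2 := by ring
        _ = _ := by rw [sq_abs]
    rw [Set.mem_ofPred_eq, this]
    exact Summable.mul_left _ hu

theorem mem_fracDomain_iff (α : ℝ) (u : X) :
    u ∈ A.fracDomain α ↔ Summable fun μ : ℝ => μ ^ α • A.proj μ u := by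
  rw [A.summable_smul_proj_iff]
  simp only [norm_smul, mul_pow, Real.norm_eq_abs, sq_abs]
  show Summable _ ↔ _
  simp only [mul_pow]

/-- The fractional power `A^α u = ∑ λ^α P_λ u` on `D(A^α)`. -/
def fracPow (α : ℝ) : A.fracDomain α →ₗ[ℝ] X where
  toFun u := ∑' μ : ℝ, μ ^ α • A.proj μ u
  map_add' u v := by
    rw [← ((A.mem_fracDomain_iff α u).1 u.2).tsum_add ((A.mem_fracDomain_iff α v).1 v.2)]
    simp [smul_add]
  map_smul' c u := by
    rw [RingHom.id_apply, ← ((A.mem_fracDomain_iff α u).1 u.2).tsum_const_smul c]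
    simp only [Submodule.coe_smul, map_smul]
    exact tsum_congr fun μ => smul_comm _ _ _

theorem proj_fracPow (α ν : ℝ) (u : A.fracDomain α) :
    A.proj ν (A.fracPow α u) = ν ^ α • A.proj ν u :=
  A.proj_of_hasSum (fun μ => (A.eigenspace μ).smul_mem _ (Submodule.starProjection_apply_mem _ _))
    ((A.mem_fracDomain_iff α u).1 u.2).hasSum ν

theorem fracPow_injective (α : ℝ) : Function.Injective (A.fracPow α) := by
  rw [← LinearMap.ker_eq_bot, LinearMap.ker_eq_bot']
  intro u hu
  have h : ∀ ν, A.proj ν (u : X) = 0 := fun ν => by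
    rcases le_or_gt ν 0 with hν | hν
    · exact A.proj_eq_zero hν _
    · have := A.proj_fracPow α ν u
      rw [hu, map_zero] at this
      exact (smul_eq_zero.1 this.symm).resolve_left (Real.rpow_pos_of_pos hν α).ne'
  have h2 := A.hasSum_proj (u : X)
  simp only [h] at h2
  exact Subtype.ext (h2.unique hasSum_zero)

/-- The fractional power space `X^α`: the vector space `D(A^α)`, with the inner product
`⟨A^α u, A^α v⟩` and hence the norm `‖A^α u‖`. -/
def Frac (α : ℝ) : Type _ := A.fracDomain α

variable {α : ℝ}

instance : AddCommGroup (A.Frac α) := inferInstanceAs (AddCommGroup (A.fracDomain α))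

instance : Module ℝ (A.Frac α) := inferInstanceAs (Module ℝ (A.fracDomain α))

/-- `A^α` as a linear map `X^α → X`. -/
def powMap : A.Frac α →ₗ[ℝ] X := A.fracPow α

/-- The inclusion `X^α ⊂ X`. -/
def incl : A.Frac α →ₗ[ℝ] X := (A.fracDomain α).subtype

instance : CoeOut (A.Frac α) X := ⟨fun u => A.incl u⟩

instance : NormedAddCommGroup (A.Frac α) :=
  NormedAddCommGroup.induced (A.Frac α) X A.powMap (A.fracPow_injective α)

instance : InnerProductSpace ℝ (A.Frac α) where
  inner u v := ⟪A.powMap u, A.powMap v⟫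
  norm_smul_le c u := by
    show ‖A.powMap (c • u)‖ ≤ ‖c‖ * ‖A.powMap u‖
    rw [map_smul, norm_smul]
  norm_sq_eq_re_inner u := by
    show ‖A.powMap u‖ ^ 2 = _
    rw [← real_inner_self_eq_norm_sq]
    rfl
  conj_inner_symm u v := real_inner_comm _ _
  add_left u v w := by
    show ⟪A.powMap (u + v), A.powMap w⟫ = _
    rw [map_add, inner_add_left]
  smul_left u v c := by
    show ⟪A.powMap (c • u), A.powMap v⟫ = _
    rw [map_smul, inner_smul_left]

theorem proj_inv (ν : ℝ) (u : X) : ν • A.proj ν (A.inv u) = A.proj ν u := by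
  refine ext_inner_left ℝ fun y => ?_
  have hs : ∀ a b : X, ⟪a, A.proj ν b⟫ = ⟪A.proj ν a, b⟫ := fun a b =>
    (Submodule.inner_starProjection_left_eq_right _ a b).symm
  have hm : A.proj ν y ∈ A.eigenspace ν := Submodule.starProjection_apply_mem _ _
  have h := (A.mem_eigenspace_iff ν _).1 hm
  rw [inner_smul_right, hs, hs, ← A.inv_symm]
  conv_rhs => rw [← h]
  rw [map_smul, real_inner_smul_left]

theorem inv_mem_fracDomain (hα : α ∈ Ioo (0 : ℝ) 1) (u : X) : A.inv u ∈ A.fracDomain α := by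
  have h1 : Summable fun μ : ℝ => ‖A.proj μ u‖ ^ 2 := by
    have := (A.summable_smul_proj_iff (fun _ => 1) u).1 (by simpa using (A.hasSum_proj u).summable)
    simpa using this
  have h2 : Summable fun μ : ℝ => ‖A.proj μ (A.inv u)‖ ^ 2 := by
    have := (A.summable_smul_proj_iff (fun _ => 1) (A.inv u)).1
      (by simpa using (A.hasSum_proj (A.inv u)).summable)
    simpa using this
  refine Summable.of_nonneg_of_le (fun μ => sq_nonneg _) (fun μ => ?_) (h1.add h2)
  rcases le_or_gt μ 0 with hμ | hμ
  · rw [A.proj_eq_zero hμ, norm_zero, mul_zero]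
    simp
  · have h3 : ‖A.proj μ u‖ = μ * ‖A.proj μ (A.inv u)‖ := by
      rw [← A.proj_inv, norm_smul, Real.norm_eq_abs, abs_of_pos hμ]
    rw [h3]
    set p := ‖A.proj μ (A.inv u)‖ with hp
    have hp0 : 0 ≤ p := norm_nonneg _
    have hr0 : 0 ≤ μ ^ α := Real.rpow_nonneg hμ.le α
    rcases le_total μ 1 with h | h
    · have h4 : μ ^ α ≤ 1 := Real.rpow_le_one hμ.le h hα.1.le
      have h5 : μ ^ α * p ≤ p := mul_le_of_le_one_left hp0 h4
      have h6 : (μ ^ α * p) ^ 2 ≤ p ^ 2 := pow_le_pow_left₀ (mul_nonneg hr0 hp0) h5 2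
      nlinarith [sq_nonneg (μ * p)]
    · have h4 : μ ^ α ≤ μ := by
        simpa using Real.rpow_le_rpow_of_exponent_le h hα.2.le
      have h5 : μ ^ α * p ≤ μ * p := mul_le_mul_of_nonneg_right h4 hp0
      have h6 : (μ ^ α * p) ^ 2 ≤ (μ * p) ^ 2 := pow_le_pow_left₀ (mul_nonneg hr0 hp0) h5 2
      nlinarith [sq_nonneg p]

/-- `A⁻¹` as a map `X → X^α`, for `0 < α < 1`. -/
def invFrac (hα : α ∈ Ioo (0 : ℝ) 1) : X →ₗ[ℝ] A.Frac α :=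
  A.inv.toLinearMap.codRestrict (A.fracDomain α) (A.inv_mem_fracDomain hα)

/-- The linear semigroup `e^{-At} u = ∑ e^{-λ t} P_λ u` (`t ≥ 0`). -/
def expNeg (t : ℝ) (u : X) : X := ∑' μ : ℝ, Real.exp (-(μ * t)) • A.proj μ u

/-- The spectral subspace of `X` for the set `S` of spectral values: the closed linear span of all
eigenvectors whose eigenvalue lies in `S`. -/
def specSpace (S : Set ℝ) : Submodule ℝ X := (⨆ μ ∈ S, A.eigenspace μ).topologicalClosure

/-- The spectral projection `Q` of `A` for `S`: the orthogonal projection onto the span of the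
eigenvectors with eigenvalue in `S`. For an interval `S` whose end points are not eigenvalues this
is the Riesz projection along a contour that encloses `S` and no other eigenvalue. -/
def specProj (S : Set ℝ) : X →L[ℝ] X :=
  haveI : CompleteSpace (A.specSpace S) :=
    (Submodule.isClosed_topologicalClosure _).completeSpace_coe
  (A.specSpace S).starProjection

variable (α) in
/-- `Y = Q X^α`, as a subspace of `X^α`: the elements of `X^α` that are fixed by `Q`. -/
def specY (S : Set ℝ) : Submodule ℝ (A.Frac α) :=
  LinearMap.ker (A.incl - (A.specProj S).toLinearMap ∘ₗ A.incl)

variable (α) in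
/-- `Z = (I - Q) X^α`, as a subspace of `X^α`: the elements of `X^α` that are annihilated by `Q`. -/
def specZ (S : Set ℝ) : Submodule ℝ (A.Frac α) :=
  LinearMap.ker ((A.specProj S).toLinearMap ∘ₗ A.incl)

/-- `u : [0, ∞) → X^α` solves `u' + A u = f(u)`, `u(0) = u₀`, in the sense of the variation of
constants formula. -/
def IsMildSolution (f : A.Frac α → X) (u₀ : A.Frac α) (u : ℝ → A.Frac α) : Prop :=
  u 0 = u₀ ∧ ContinuousOn u (Ici 0) ∧
    ∀ t : ℝ, 0 < t →
      (u t : X) = A.expNeg t u₀ + ∫ s in (0 : ℝ)..t, A.expNeg (t - s) (f (u s))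

/-- `T` is the solution operator of `u' + A u = f(u)` in `X^α`: `T t u₀ = u(t)`, where `u` is the
solution with `u(0) = u₀`. Only `t ≥ 0` matters. -/
def IsSolutionOperator (f : A.Frac α → X) (T : ℝ → A.Frac α → A.Frac α) : Prop :=
  ∀ u₀, A.IsMildSolution f u₀ fun t => T t u₀

/-- `v : ℝ → Y` solves the ordinary differential equation `v' + A v = Q f(v + s(v))` on all of `ℝ`;
the derivative is taken in the norm of `X^α`. -/
def IsReducedSolution (f : A.Frac α → X) (S : Set ℝ) (s : A.specY α S → A.specZ α S)
    (v : ℝ → A.specY α S) : Prop :=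
  ∀ t : ℝ, ∃ w : A.Frac α, HasDerivAt (fun r => (v r : A.Frac α)) w t ∧
    ∃ h : A.incl (v t : A.Frac α) ∈ A.op.domain,
      A.incl w + A.op ⟨A.incl (v t : A.Frac α), h⟩ =
        A.specProj S (f ((v t : A.Frac α) + (s (v t) : A.Frac α)))

end PosOperator

section Dynamics

variable {V : Type*} [NormedAddCommGroup V]

/-- The Hausdorff semidistance `sup_{a ∈ A} inf_{b ∈ B} ‖a - b‖`. -/
def semidist (A B : Set V) : ℝ≥0∞ := ⨆ a ∈ A, Metric.infEDist a B

structure IsGlobalAttractor (T : ℝ → V → V) (𝒜 : Set V) : Prop where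
  compact : IsCompact 𝒜
  invariant : ∀ t : ℝ, 0 ≤ t → T t '' 𝒜 = 𝒜
  attracts : ∀ B : Set V, Bornology.IsBounded B →
    Tendsto (fun t : ℝ => semidist (T t '' B) 𝒜) atTop (𝓝 0)

def IsGlobalSolution (T : ℝ → V → V) (ξ : ℝ → V) : Prop :=
  Continuous ξ ∧ ∀ r t : ℝ, 0 ≤ t → T t (ξ r) = ξ (t + r)

def IsInvariantManifold (T : ℝ → V → V) (ℳ : Set V) : Prop :=
  ∀ u₀ ∈ ℳ, ∃ ξ : ℝ → V, IsGlobalSolution T ξ ∧ ξ 0 = u₀ ∧ ∀ t, ξ t ∈ ℳ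

/-- `ℳ` attracts bounded sets at an exponential rate. -/
def IsExponentiallyAttracting (T : ℝ → V → V) (ℳ : Set V) : Prop :=
  ∃ κ : ℝ, 0 < κ ∧ ∀ B : Set V, Bornology.IsBounded B →
    ∃ c : ℝ, 0 < c ∧ ∀ t : ℝ, 0 ≤ t →
      semidist (T t '' B) ℳ ≤ ENNReal.ofReal (c * Real.exp (-κ * t))

/-- The graph `{v + s(v) : v ∈ Y}` of `s : Y → Z`. -/
def graphSet [Module ℝ V] {Y Z : Submodule ℝ V} (s : Y → Z) : Set V :=
  {u | ∃ v : Y, u = (v : V) + (s v : V)}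

end Dynamics

section Convergence

/-- `ε → 0` in the parameter range `(0, ε₀]`. -/
def toZero (ε₀ : ℝ) : Filter (Ioc (0 : ℝ) ε₀) := comap Subtype.val (𝓝 0)

variable {ε₀ : ℝ} {X₀ : Type*} [NormedAddCommGroup X₀] [NormedSpace ℝ X₀]
  {V : Ioc (0 : ℝ) ε₀ → Type*} [∀ ε, NormedAddCommGroup (V ε)] [∀ ε, NormedSpace ℝ (V ε)]

/-- E-convergence of a family `u ε ∈ V ε` to `u₀ ∈ X₀`. -/
def EConverges (E : ∀ ε, X₀ →L[ℝ] V ε) (u : ∀ ε, V ε) (u₀ : X₀) : Prop :=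
  Tendsto (fun ε => ‖u ε - E ε u₀‖) (toZero ε₀) (𝓝 0)

/-- Relative compactness of a family: along every sequence `ε_k → 0` some subsequence
E-converges. -/
def ERelativelyCompact (E : ∀ ε, X₀ →L[ℝ] V ε) (u : ∀ ε, V ε) : Prop :=
  ∀ e : ℕ → Ioc (0 : ℝ) ε₀, Tendsto e atTop (toZero ε₀) →
    ∃ φ : ℕ → ℕ, StrictMono φ ∧ ∃ u₀ : X₀,
      Tendsto (fun k => ‖u (e (φ k)) - E (e (φ k)) u₀‖) atTop (𝓝 0)

/-- Compact convergence of the operators `K ε : V ε → V ε` to `K₀ : X₀ → X₀`. -/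
def CompactlyConverges (E : ∀ ε, X₀ →L[ℝ] V ε) (K : ∀ ε, V ε → V ε) (K₀ : X₀ → X₀) : Prop :=
  (∀ (u : ∀ ε, V ε) (u₀ : X₀), EConverges E u u₀ →
    EConverges E (fun ε => K ε (u ε)) (K₀ u₀)) ∧
  ∀ u : ∀ ε, V ε, (∀ ε, ‖u ε‖ = 1) → ERelativelyCompact E fun ε => K ε (u ε)

end Convergence

end

/-! Since `A^α` is an isometry of `X^α` onto `X`, the unknown `x = A^α u` turns (P) into `x' + A x =
A^α F(x)` in `X`, with `F` bounded by `C` and `C`-Lipschitz. The fractional power then appears only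
in the kernel `A^α e^{-At}`, whose norm is at most `t^{-α}`.

Spectrum. The image under `E_ε` of an eigenvector of `A₀` is an approximate eigenvector of `A_ε⁻¹`,
so `A_ε` has an eigenvalue near each `λ_i⁰` (`eventually_exists_isEig`). If `n + 1` orthonormal
eigenvectors with eigenvalues at most `Λ` existed along some `ε_k → 0`, compact convergence would
produce `n + 1` nonzero orthogonal vectors in `X₀` (`eventually_not_hasLowModes`). Hence for small
`ε` there are exactly `n` simple eigenvalues below a prescribed high level, all of them in the
window. The rate enters through rank: `E_ε A₀⁻¹ M_ε` annihilates some nonzero combination of any `n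
+ 1` eigenvectors, so every further eigenvalue `μ` satisfies `μ^{α-1} ≤ τ(ε)`
(`HasLowModes.rpow_le`).

Dynamics. Let the slow eigenvalues be at most `b`, the fast ones at least `m`, and `b < γ ≤ m/2`. In
the weight `e^{γt}`, the Duhamel integral of the slow part, run backwards from time `0`, and that of
the fast part, run forwards from the past, each have Lipschitz constant at most `1/4`
(`SpectralGap`). Together they make the Lyapunov–Perron map a contraction, which gives for each slow
value at time `0` a solution on `(-∞, 0]` with bounded fast part (`exists_backward_solution`); its
fast part at time `0` defines `inertial`. The same absorption argument compares two arbitrary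
solutions on `[-L, 0]` (`norm_solution_sub_le`). This one estimate, with `L → ∞`, yields the
Lipschitz bound, exponential attraction, the characterization of the manifold by entire solutions
with bounded fast part, and backward uniqueness on it.

The fast part is at most `C` times the integral of the fast kernel, which is of order `m^{α-1}`,
hence of order `τ(ε)`. Each point of the attractor is reached from the attractor after arbitrarily
long times, so it lies at distance `0` from its shadow on the graph. -/

open MeasureTheory

open scoped BoundedContinuousFunction

/-! ### Spectral multipliers of `A` -/

namespace PosOperator

variable {X : Type*} [NormedAddCommGroup X] [InnerProductSpace ℝ X] [CompleteSpace X]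
variable (A : PosOperator X)

/-- `μ` is an eigenvalue of `A`. -/
def IsEig (μ : ℝ) : Prop := A.eigenspace μ ≠ ⊥

variable {A} in
theorem IsEig.pos {μ : ℝ} (h : A.IsEig μ) : 0 < μ := by
  by_contra hμ
  exact h (A.eigenspace_eq_bot (not_lt.1 hμ))

theorem proj_mem (μ : ℝ) (u : X) : A.proj μ u ∈ A.eigenspace μ :=
  Submodule.starProjection_apply_mem _ _

theorem proj_of_not_isEig {μ : ℝ} (h : ¬ A.IsEig μ) (u : X) : A.proj μ u = 0 := by
  have h1 : A.eigenspace μ = ⊥ := not_not.1 h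
  have := A.proj_mem μ u
  rw [h1] at this
  simpa using this

variable {A} in
theorem IsEig.one_le {μ : ℝ} (h : A.IsEig μ) : 1 ≤ ‖A.inv‖ * μ := by
  obtain ⟨x, hx, hx0⟩ := (Submodule.ne_bot_iff _).1 h
  have h1 := (A.mem_eigenspace_iff μ x).1 hx
  have h2 : ‖x‖ ≤ ‖A.inv‖ * (μ * ‖x‖) := by
    have := A.inv.le_opNorm (μ • x)
    rwa [h1, norm_smul, Real.norm_eq_abs, abs_of_pos h.pos] at this
  have h3 : 0 < ‖x‖ := norm_pos_iff.2 hx0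
  nlinarith

theorem inner_proj (u v : X) (μ : ℝ) : ⟪A.proj μ u, v⟫ = ⟪u, A.proj μ v⟫ :=
  Submodule.inner_starProjection_left_eq_right _ u v

theorem proj_proj (μ : ℝ) (u : X) : A.proj μ (A.proj μ u) = A.proj μ u :=
  A.proj_of_mem (A.proj_mem μ u)

theorem proj_proj_ne {μ ν : ℝ} (h : μ ≠ ν) (u : X) : A.proj ν (A.proj μ u) = 0 :=
  A.proj_of_mem_ne h (A.proj_mem μ u)

/-- Parseval's identity. -/
theorem hasSum_norm_sq_proj (u : X) : HasSum (fun μ => ‖A.proj μ u‖ ^ 2) (‖u‖ ^ 2) := by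
  have h := (A.hasSum_proj u).mapL (innerSL ℝ u)
  simp only [innerSL_apply_apply] at h
  rw [real_inner_self_eq_norm_sq] at h
  refine h.congr_fun ?_ |> id
  intro μ
  rw [← real_inner_self_eq_norm_sq, A.inner_proj, A.proj_proj]

/-- The eigenspaces span a dense subspace, so an identity between operators that are functions of
`A` becomes a scalar identity at each eigenvalue. Nearly all operator identities below are proved
this way. -/
theorem ext_proj {u v : X} (h : ∀ μ, A.IsEig μ → A.proj μ u = A.proj μ v) : u = v := by
  have h1 := A.hasSum_proj u
  have h2 := A.hasSum_proj v
  have : (fun μ => A.proj μ u) = fun μ => A.proj μ v := by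
    funext μ
    by_cases hμ : A.IsEig μ
    · exact h μ hμ
    · rw [A.proj_of_not_isEig hμ, A.proj_of_not_isEig hμ]
  rw [this] at h1
  exact h1.unique h2

/-- `c` is bounded on the spectrum of `A`. -/
def MBdd (c : ℝ → ℝ) : Prop := ∃ B, ∀ μ, A.IsEig μ → |c μ| ≤ B

variable {A} in
theorem norm_smul_proj_le {c : ℝ → ℝ} {B : ℝ} (hB : ∀ μ, A.IsEig μ → |c μ| ≤ B) (u : X) (μ : ℝ) :
    ‖c μ • A.proj μ u‖ ^ 2 ≤ B ^ 2 * ‖A.proj μ u‖ ^ 2 := by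
  by_cases hμ : A.IsEig μ
  · rw [norm_smul, mul_pow, Real.norm_eq_abs]
    gcongr
    exact hB μ hμ
  · simp [A.proj_of_not_isEig hμ]

variable {A} in
theorem MBdd.summable {c : ℝ → ℝ} (hc : A.MBdd c) (u : X) :
    Summable fun μ => c μ • A.proj μ u := by
  obtain ⟨B, hB⟩ := hc
  rw [A.summable_smul_proj_iff]
  exact Summable.of_nonneg_of_le (fun μ => sq_nonneg _) (norm_smul_proj_le hB u)
    ((A.hasSum_norm_sq_proj u).summable.mul_left _)

variable {A} in
theorem proj_tsum {c : ℝ → ℝ} (hc : A.MBdd c) (u : X) (ν : ℝ) :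
    A.proj ν (∑' μ, c μ • A.proj μ u) = c ν • A.proj ν u :=
  A.proj_of_hasSum (fun μ => (A.eigenspace μ).smul_mem _ (A.proj_mem μ u))
    (hc.summable u).hasSum ν

variable {A} in
theorem norm_tsum_le {c : ℝ → ℝ} {B : ℝ} (hB0 : 0 ≤ B) (hB : ∀ μ, A.IsEig μ → |c μ| ≤ B) (u : X) :
    ‖∑' μ, c μ • A.proj μ u‖ ≤ B * ‖u‖ := by
  refine le_of_sq_le_sq ?_ (by positivity)
  have h1 := A.hasSum_norm_sq_proj (∑' μ, c μ • A.proj μ u)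
  simp only [proj_tsum ⟨B, hB⟩] at h1
  rw [mul_pow]
  exact hasSum_le (norm_smul_proj_le hB u) h1 ((A.hasSum_norm_sq_proj u).mul_left _)

open Classical in
/-- The spectral multiplier `c(A) = ∑ c(μ) P_μ`, for `c` bounded on the spectrum. -/
noncomputable def mult (c : ℝ → ℝ) : X →L[ℝ] X :=
  if hc : A.MBdd c then
    LinearMap.mkContinuousOfExistsBound
      { toFun := fun u => ∑' μ, c μ • A.proj μ u
        map_add' := fun u v => by
          rw [← (hc.summable u).tsum_add (hc.summable v)]
          simp [smul_add]
        map_smul' := fun r u => by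
          rw [RingHom.id_apply, ← (hc.summable u).tsum_const_smul r]
          simp only [map_smul]
          exact tsum_congr fun μ => smul_comm _ _ _ }
      -- On a trivial space there are no eigenvalues and `B` may be negative; hence `|B|`.
      (hc.elim fun B hB => ⟨|B|, norm_tsum_le (abs_nonneg B)
        fun μ hμ => (hB μ hμ).trans (le_abs_self B)⟩)
  else 0

variable {A} {c d : ℝ → ℝ}

theorem mult_apply (hc : A.MBdd c) (u : X) : A.mult c u = ∑' μ, c μ • A.proj μ u := by
  rw [mult, dif_pos hc]; rfl

theorem proj_mult (hc : A.MBdd c) (u : X) (ν : ℝ) : A.proj ν (A.mult c u) = c ν • A.proj ν u := by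
  rw [mult_apply hc, proj_tsum hc]

theorem norm_mult_le {B : ℝ} (hB0 : 0 ≤ B) (hB : ∀ μ, A.IsEig μ → |c μ| ≤ B) : ‖A.mult c‖ ≤ B :=
  ContinuousLinearMap.opNorm_le_bound _ hB0 fun u => by
    rw [mult_apply ⟨B, hB⟩]; exact norm_tsum_le hB0 hB u

theorem MBdd.sub (hc : A.MBdd c) (hd : A.MBdd d) : A.MBdd fun μ => c μ - d μ := by
  obtain ⟨B, hB⟩ := hc
  obtain ⟨D, hD⟩ := hd
  exact ⟨B + D, fun μ hμ => (abs_sub _ _).trans (add_le_add (hB μ hμ) (hD μ hμ))⟩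

theorem mult_sub (hc : A.MBdd c) (hd : A.MBdd d) :
    A.mult (fun μ => c μ - d μ) = A.mult c - A.mult d := by
  ext u
  refine A.ext_proj fun μ _ => ?_
  rw [proj_mult (hc.sub hd), sub_apply, map_sub, proj_mult hc, proj_mult hd,
    sub_smul]

/-- Parseval, term by term. The lower bound on `c` is needed only where `u` has a component, so the
estimate applies to vectors of a spectral subspace. -/
theorem norm_mult_ge {B : ℝ} (hB0 : 0 ≤ B) (hc : A.MBdd c) (u : X)
    (hB : ∀ μ, A.proj μ u ≠ 0 → B ≤ |c μ|) : B * ‖u‖ ≤ ‖A.mult c u‖ := by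
  refine le_of_sq_le_sq ?_ (by positivity)
  have h1 := A.hasSum_norm_sq_proj (A.mult c u)
  simp only [proj_mult hc] at h1
  rw [mul_pow]
  refine hasSum_le (fun μ => ?_) ((A.hasSum_norm_sq_proj u).mul_left _) h1
  by_cases hμ : A.proj μ u = 0
  · simp [hμ]
  · rw [norm_smul, mul_pow, Real.norm_eq_abs]
    gcongr
    exact hB μ hμ

end PosOperator

/-! ### The operators `A^β e^{-At} 1_S(A)` -/

namespace PosOperator

/-- The smoothing estimate of the semigroup, mode by mode: it is `x^α ≤ e^x` at `x = μ t`. -/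
theorem rpow_mul_exp_neg_le {α μ t : ℝ} (hα0 : 0 ≤ α) (hα1 : α ≤ 1) (hμ : 0 < μ) (ht : 0 < t) :
    μ ^ α * Real.exp (-(μ * t)) ≤ t ^ (-α) := by
  have h1 : (μ * t) ^ α ≤ Real.exp (μ * t) := by
    have hx : 0 < μ * t := mul_pos hμ ht
    rcases le_total (μ * t) 1 with h | h
    · exact (Real.rpow_le_one hx.le h hα0).trans (Real.one_le_exp hx.le)
    · calc (μ * t) ^ α ≤ (μ * t) ^ (1 : ℝ) := Real.rpow_le_rpow_of_exponent_le h hα1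
        _ = μ * t := Real.rpow_one _
        _ ≤ Real.exp (μ * t) := by linarith [Real.add_one_le_exp (μ * t)]
  rw [Real.mul_rpow hμ.le ht.le] at h1
  rw [Real.exp_neg, Real.rpow_neg ht.le, ← div_eq_mul_inv, div_le_iff₀ (Real.exp_pos _),
    inv_mul_eq_div, le_div_iff₀ (Real.rpow_pos_of_pos ht α)]
  exact h1

variable {X : Type*} [NormedAddCommGroup X] [InnerProductSpace ℝ X] [CompleteSpace X]
variable (A : PosOperator X)

open Classical in
/-- The spectral function of `A^β e^{-At} 1_S(A)`. -/
noncomputable def flowSymbol (S : Set ℝ) (β t μ : ℝ) : ℝ :=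
  if μ ∈ S then μ ^ β * Real.exp (-(μ * t)) else 0

/-- The operator `A^β e^{-At} 1_S(A)`. -/
noncomputable def flow (S : Set ℝ) (β t : ℝ) : X →L[ℝ] X := A.mult (flowSymbol S β t)

/-- The operator `A^β e^{-At} 1_S(A)` is bounded. -/
def FlowBdd (S : Set ℝ) (β t : ℝ) : Prop := A.MBdd (flowSymbol S β t)

variable {A} {S S' : Set ℝ} {α β β' γ m b t t' : ℝ}

theorem flowSymbol_of_mem {μ : ℝ} (h : μ ∈ S) :
    flowSymbol S β t μ = μ ^ β * Real.exp (-(μ * t)) := if_pos h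

theorem flowSymbol_of_notMem {μ : ℝ} (h : μ ∉ S) : flowSymbol S β t μ = 0 := if_neg h

theorem abs_flowSymbol_le {μ B : ℝ} (hμ : 0 < μ) (hB : 0 ≤ B)
    (h : μ ∈ S → μ ^ β * Real.exp (-(μ * t)) ≤ B) : |flowSymbol S β t μ| ≤ B := by
  by_cases hS : μ ∈ S
  · rw [flowSymbol_of_mem hS, abs_of_nonneg (by positivity)]
    exact h hS
  · rw [flowSymbol_of_notMem hS, abs_zero]
    exact hB

theorem flowBdd_of_nonpos (hβ : β ≤ 0) (ht : 0 ≤ t) : A.FlowBdd S β t := by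
  refine ⟨‖A.inv‖ ^ (-β), fun μ hμ => abs_flowSymbol_le hμ.pos (by positivity) fun _ => ?_⟩
  have h1 : Real.exp (-(μ * t)) ≤ 1 := Real.exp_le_one_iff.2 (by nlinarith [hμ.pos])
  have h2 : μ ^ β ≤ ‖A.inv‖ ^ (-β) := by
    have h3 : μ⁻¹ ≤ ‖A.inv‖ := by
      rw [inv_le_iff_one_le_mul₀ hμ.pos]; exact hμ.one_le
    have := Real.rpow_le_rpow (inv_nonneg.2 hμ.pos.le) h3 (neg_nonneg.2 hβ)
    rwa [Real.inv_rpow hμ.pos.le, Real.rpow_neg hμ.pos.le, inv_inv] at this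
  calc _ ≤ μ ^ β * 1 := by gcongr; exact Real.rpow_nonneg hμ.pos.le _
    _ ≤ _ := by simpa using h2

theorem flowBdd_of_pos (hα0 : 0 ≤ α) (hα1 : α ≤ 1) (ht : 0 < t) : A.FlowBdd S α t :=
  ⟨t ^ (-α), fun _ hμ => abs_flowSymbol_le hμ.pos (by positivity)
    fun _ => rpow_mul_exp_neg_le hα0 hα1 hμ.pos ht⟩

theorem flowBdd_of_finite (hS : S.Finite) : A.FlowBdd S β t := by
  obtain ⟨B, hB⟩ := (hS.image fun μ => |flowSymbol S β t μ|).bddAbove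
  refine ⟨max B 0, fun μ _ => ?_⟩
  by_cases h : μ ∈ S
  · exact (hB ⟨μ, h, rfl⟩).trans (le_max_left _ _)
  · rw [flowSymbol_of_notMem h, abs_zero]
    exact le_max_right _ _

theorem norm_flow_le (hα0 : 0 ≤ α) (hα1 : α ≤ 1) (ht : 0 < t) : ‖A.flow S α t‖ ≤ t ^ (-α) :=
  norm_mult_le (by positivity) fun _ hμ => abs_flowSymbol_le hμ.pos (by positivity)
    fun _ => rpow_mul_exp_neg_le hα0 hα1 hμ.pos ht

/-- The exponential is shared out: one quarter of `μ t` absorbs the power `μ^α`, one quarter keeps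
the kernel integrable at infinity, and one half pays for the weight `e^{-γt}`, which is where `2γ ≤
m` is used. -/
theorem norm_flow_le_of_gap (hα0 : 0 ≤ α) (hα1 : α ≤ 1) (hγm : 2 * γ ≤ m)
    (hS : ∀ μ ∈ S, A.IsEig μ → m ≤ μ) (ht : 0 < t) :
    ‖A.flow S α t‖ ≤ (t / 4) ^ (-α) * Real.exp (-(m / 4 * t)) * Real.exp (-(γ * t)) := by
  refine norm_mult_le (by positivity) fun μ hμ => abs_flowSymbol_le hμ.pos (by positivity)
    fun hμS => ?_
  have h1 := rpow_mul_exp_neg_le hα0 hα1 hμ.pos (show 0 < t / 4 by positivity)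
  have hm := hS μ hμS hμ
  have h2 : Real.exp (-(μ / 4 * t)) ≤ Real.exp (-(m / 4 * t)) :=
    Real.exp_le_exp.2 (by nlinarith)
  have h3 : Real.exp (-(μ / 2 * t)) ≤ Real.exp (-(γ * t)) :=
    Real.exp_le_exp.2 (by nlinarith)
  calc μ ^ α * Real.exp (-(μ * t))
      = μ ^ α * Real.exp (-(μ * (t / 4))) * Real.exp (-(μ / 4 * t)) *
        Real.exp (-(μ / 2 * t)) := by
        rw [mul_assoc, mul_assoc, ← Real.exp_add, ← Real.exp_add]
        congr 2
        ring
    _ ≤ _ := by gcongr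

theorem norm_flow_zero_le_of_gap (hγm : γ ≤ m) (hS : ∀ μ ∈ S, A.IsEig μ → m ≤ μ) (ht : 0 ≤ t) :
    ‖A.flow S 0 t‖ ≤ Real.exp (-(γ * t)) :=
  norm_mult_le (by positivity) fun μ hμ => abs_flowSymbol_le hμ.pos (by positivity) fun hμS => by
    rw [Real.rpow_zero, one_mul]
    exact Real.exp_le_exp.2 (by nlinarith [hS μ hμS hμ])

theorem norm_flow_le_of_nonpos (hα0 : 0 ≤ α) (hb : 0 ≤ b) (hS : ∀ μ ∈ S, A.IsEig μ → μ ≤ b)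
    (ht : t ≤ 0) : ‖A.flow S α t‖ ≤ b ^ α * Real.exp (-(b * t)) :=
  norm_mult_le (by positivity) fun μ hμ => abs_flowSymbol_le hμ.pos (by positivity) fun hμS => by
    have h := hS μ hμS hμ
    gcongr ?_ * ?_
    · exact Real.rpow_le_rpow hμ.pos.le h hα0
    · exact Real.exp_le_exp.2 (by nlinarith)

theorem proj_flow (h : A.FlowBdd S β t) (u : X) (μ : ℝ) :
    A.proj μ (A.flow S β t u) = flowSymbol S β t μ • A.proj μ u := proj_mult h u μ

/-- Since `mult` is `0` for an unbounded symbol, boundedness is required of both factors and of the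
product. -/
theorem flow_flow (h : A.FlowBdd S β t) (h' : A.FlowBdd S' β' t')
    (h'' : A.FlowBdd (S ∩ S') (β + β') (t + t')) (u : X) :
    A.flow S β t (A.flow S' β' t' u) = A.flow (S ∩ S') (β + β') (t + t') u := by
  refine A.ext_proj fun μ hμ => ?_
  rw [proj_flow h, proj_flow h', proj_flow h'', smul_smul]
  congr 1
  by_cases h1 : μ ∈ S
  · by_cases h2 : μ ∈ S'
    · rw [flowSymbol_of_mem h1, flowSymbol_of_mem h2, flowSymbol_of_mem (mem_inter h1 h2),
        Real.rpow_add hμ.pos, mul_add, neg_add, Real.exp_add]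
      ring
    · rw [flowSymbol_of_notMem h2, flowSymbol_of_notMem fun h => h2 (mem_of_mem_inter_right h), mul_zero]
  · rw [flowSymbol_of_notMem h1, flowSymbol_of_notMem fun h => h1 (mem_of_mem_inter_left h), zero_mul]

theorem flow_flow_self (h : A.FlowBdd S β t) (h' : A.FlowBdd S β' t')
    (h'' : A.FlowBdd S (β + β') (t + t')) (u : X) :
    A.flow S β t (A.flow S β' t' u) = A.flow S (β + β') (t + t') u := by
  rw [flow_flow h h' (by rwa [inter_self]), inter_self]

theorem flow_univ_eq_add (h : A.FlowBdd univ β t) (hS : A.FlowBdd S β t)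
    (hS' : A.FlowBdd Sᶜ β t) (u : X) :
    A.flow univ β t u = A.flow S β t u + A.flow Sᶜ β t u := by
  refine A.ext_proj fun μ _ => ?_
  rw [map_add, proj_flow h, proj_flow hS, proj_flow hS', flowSymbol_of_mem (mem_univ μ)]
  by_cases h1 : μ ∈ S
  · rw [flowSymbol_of_mem h1, flowSymbol_of_notMem (not_not.2 h1 : μ ∉ Sᶜ), zero_smul, add_zero]
  · rw [flowSymbol_of_notMem h1, flowSymbol_of_mem (show μ ∈ Sᶜ from h1), zero_smul, zero_add]

theorem flow_univ_zero_zero (u : X) : A.flow univ 0 0 u = u := by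
  refine A.ext_proj fun μ _ => ?_
  rw [proj_flow (flowBdd_of_nonpos le_rfl le_rfl), flowSymbol_of_mem (mem_univ μ)]
  simp

/-- With finitely many modes the flow is a finite sum of exponentials, defined for all real times;
continuity and differentiability in time become elementary. -/
theorem flow_finset (W : Finset ℝ) (u : X) :
    A.flow W β t u = ∑ μ ∈ W, (μ ^ β * Real.exp (-(μ * t))) • A.proj μ u := by
  refine A.ext_proj fun ν _ => ?_
  rw [proj_flow (flowBdd_of_finite W.finite_toSet), map_sum]
  by_cases hν : ν ∈ W
  · rw [flowSymbol_of_mem (Finset.mem_coe.2 hν), Finset.sum_eq_single_of_mem ν hν, map_smul,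
      proj_proj]
    intro μ _ h
    rw [map_smul, A.proj_proj_ne h, smul_zero]
  · rw [flowSymbol_of_notMem (mt Finset.mem_coe.1 hν), zero_smul, eq_comm]
    refine Finset.sum_eq_zero fun μ hμ => ?_
    rw [map_smul, A.proj_proj_ne (ne_of_mem_of_not_mem hμ hν), smul_zero]

theorem hasDerivAt_flow (W : Finset ℝ) (β : ℝ) {u : ℝ → X} {u' : X} {t : ℝ}
    (hu : HasDerivAt u u' t) :
    HasDerivAt (fun t => A.flow W β t (u t)) (A.flow W β t u' - A.flow W (β + 1) t (u t)) t := by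
  have h1 : ∀ μ ∈ W, HasDerivAt (fun t => (μ ^ β * Real.exp (-(μ * t))) • A.proj μ (u t))
      ((μ ^ β * Real.exp (-(μ * t))) • A.proj μ u' +
        (μ ^ β * (Real.exp (-(μ * t)) * (-(μ * 1)))) • A.proj μ (u t)) t := fun μ _ =>
    (((hasDerivAt_id t).const_mul μ).neg.exp.const_mul _).smul
      ((A.proj μ).hasFDerivAt.comp_hasDerivAt t hu)
  have h2 := HasDerivAt.fun_sum h1
  have h3 : (fun t => A.flow W β t (u t)) =
      fun t => ∑ μ ∈ W, (μ ^ β * Real.exp (-(μ * t))) • A.proj μ (u t) := by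
    funext t; exact flow_finset W _
  rw [h3]
  convert h2 using 1
  rw [Finset.sum_add_distrib, flow_finset, sub_eq_add_neg]
  congr 1
  refine A.ext_proj fun ν hν => ?_
  rw [map_neg, proj_flow (flowBdd_of_finite W.finite_toSet), map_sum]
  by_cases hW : ν ∈ W
  · rw [flowSymbol_of_mem (Finset.mem_coe.2 hW), Finset.sum_eq_single_of_mem ν hW, map_smul,
      proj_proj, ← neg_smul]
    · congr 1
      rw [Real.rpow_add hν.pos, Real.rpow_one]
      ring
    · intro μ _ h
      rw [map_smul, A.proj_proj_ne h, smul_zero]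
  · rw [flowSymbol_of_notMem (mt Finset.mem_coe.1 hW), zero_smul, neg_zero, eq_comm]
    refine Finset.sum_eq_zero fun μ hμ => ?_
    rw [map_smul, A.proj_proj_ne (ne_of_mem_of_not_mem hμ hW), smul_zero]

theorem continuous_flow_finset (W : Finset ℝ) (β : ℝ) {u : ℝ → X} (hu : Continuous u) {r : ℝ → ℝ}
    (hr : Continuous r) : Continuous fun t => A.flow W β (r t) (u t) := by
  simp only [flow_finset]
  fun_prop

/-- Continuity is in operator norm. On `(t₀, ∞)` the symbol is Lipschitz in time uniformly in `μ`:
its time derivative is at most `μ^α · μ · e^{-μ t₀}`, and the two halves of the exponential absorb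
the two powers of `μ`. -/
theorem continuousOn_flow (hα0 : 0 ≤ α) (hα1 : α ≤ 1) :
    ContinuousOn (fun t => A.flow S α t) (Ioi 0) := by
  intro t₁ ht₁
  refine ContinuousAt.continuousWithinAt ?_
  have ht₁ : 0 < t₁ := ht₁
  set t₀ := t₁ / 2 with ht₀
  have h0 : 0 < t₀ := by positivity
  have key : LipschitzOnWith (Real.toNNReal ((t₀ / 2) ^ (-α) * (t₀ / 2) ^ (-(1 : ℝ))))
      (fun t => A.flow S α t) (Ioi t₀) := by
    refine LipschitzOnWith.of_dist_le_mul fun t ht t' ht' => ?_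
    rw [Real.coe_toNNReal _ (by positivity), dist_eq_norm, Real.dist_eq, flow, flow,
      ← mult_sub (flowBdd_of_pos hα0 hα1 (h0.trans ht)) (flowBdd_of_pos hα0 hα1 (h0.trans ht'))]
    refine norm_mult_le (by positivity) fun μ hμ => ?_
    by_cases hS : μ ∈ S
    · rw [flowSymbol_of_mem hS, flowSymbol_of_mem hS, ← mul_sub, abs_mul,
        abs_of_pos (Real.rpow_pos_of_pos hμ.pos α)]
      have h1 : |Real.exp (-(μ * t)) - Real.exp (-(μ * t'))| ≤
          Real.exp (-(μ * t₀)) * (μ * |t - t'|) := by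
        have hd : ∀ x ∈ Iic (-(μ * t₀)), HasDerivWithinAt Real.exp (Real.exp x)
            (Iic (-(μ * t₀))) x := fun x _ => (Real.hasDerivAt_exp x).hasDerivWithinAt
        have hb : ∀ x ∈ Iic (-(μ * t₀)), ‖Real.exp x‖ ≤ Real.exp (-(μ * t₀)) := fun x hx => by
          rw [Real.norm_eq_abs, Real.abs_exp]; exact Real.exp_le_exp.2 hx
        have := (convex_Iic (-(μ * t₀))).norm_image_sub_le_of_norm_hasDerivWithin_le hd hb
          (x := -(μ * t')) (y := -(μ * t))
          (mem_Iic.2 (by nlinarith [hμ.pos, mem_Ioi.1 ht'])) (mem_Iic.2 (by nlinarith [hμ.pos, mem_Ioi.1 ht]))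
        rw [Real.norm_eq_abs, Real.norm_eq_abs] at this
        refine this.trans_eq ?_
        rw [show -(μ * t) - -(μ * t') = μ * -(t - t') by ring, abs_mul, abs_neg, abs_of_pos hμ.pos]
      have h2 := rpow_mul_exp_neg_le hα0 hα1 hμ.pos (half_pos h0)
      have h3 := rpow_mul_exp_neg_le zero_le_one le_rfl hμ.pos (half_pos h0)
      calc _ ≤ μ ^ α * (Real.exp (-(μ * t₀)) * (μ * |t - t'|)) := by
              gcongr; exact Real.rpow_nonneg hμ.pos.le _
        _ = (μ ^ α * Real.exp (-(μ * (t₀ / 2)))) * (μ ^ (1 : ℝ) * Real.exp (-(μ * (t₀ / 2)))) *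
            |t - t'| := by
              rw [Real.rpow_one, show -(μ * t₀) = -(μ * (t₀ / 2)) + -(μ * (t₀ / 2)) by ring,
                Real.exp_add]
              ring
        _ ≤ _ := by
              have := hμ.pos
              gcongr
    · rw [flowSymbol_of_notMem hS, flowSymbol_of_notMem hS, sub_zero, abs_zero]
      positivity
  exact key.continuousOn.continuousAt (Ioi_mem_nhds (half_lt_self ht₁))

end PosOperator

/-! ### Gamma integrals and singular convolutions -/

theorem integrableOn_rpow_neg_mul_exp {α σ : ℝ} (hα : α < 1) (hσ : 0 < σ) :
    IntegrableOn (fun q : ℝ => q ^ (-α) * Real.exp (-(σ * q))) (Ioi 0) := by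
  have := integrableOn_rpow_mul_exp_neg_mul_rpow (p := 1) (s := -α) (b := σ) (by linarith)
    zero_lt_one hσ
  simpa [neg_mul] using this

theorem integral_rpow_neg_mul_exp {α σ : ℝ} (hα : α < 1) (hσ : 0 < σ) :
    ∫ q in Ioi (0 : ℝ), q ^ (-α) * Real.exp (-(σ * q)) = Real.Gamma (1 - α) * σ ^ (α - 1) := by
  have := Real.integral_rpow_mul_exp_neg_mul_Ioi (a := 1 - α) (r := σ) (by linarith) hσ
  rw [show 1 - α - 1 = -α by ring] at this
  rw [this, one_div, Real.inv_rpow hσ.le, ← Real.rpow_neg hσ.le, neg_sub, mul_comm]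

theorem gap_kernel_eq {α m q : ℝ} (hq : 0 < q) :
    (q / 4) ^ (-α) * Real.exp (-(m / 4 * q)) =
      4 ^ α * (q ^ (-α) * Real.exp (-(m / 4 * q))) := by
  rw [Real.div_rpow hq.le (by norm_num), Real.rpow_neg (by norm_num : (0 : ℝ) ≤ 4), div_inv_eq_mul]
  ring

theorem integrableOn_gap_kernel {α m : ℝ} (hα : α < 1) (hm : 0 < m) :
    IntegrableOn (fun q : ℝ => (q / 4) ^ (-α) * Real.exp (-(m / 4 * q))) (Ioi 0) := by
  refine IntegrableOn.congr_fun ?_ (fun q hq => (gap_kernel_eq hq).symm) measurableSet_Ioi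
  exact (integrableOn_rpow_neg_mul_exp hα (by positivity)).const_mul _

theorem integral_gap_kernel {α m : ℝ} (hα : α < 1) (hm : 0 < m) :
    ∫ q in Ioi (0 : ℝ), (q / 4) ^ (-α) * Real.exp (-(m / 4 * q)) =
      4 * Real.Gamma (1 - α) * m ^ (α - 1) := by
  rw [setIntegral_congr_fun measurableSet_Ioi fun q hq => gap_kernel_eq hq, integral_const_mul,
    integral_rpow_neg_mul_exp hα (by positivity), Real.div_rpow hm.le (by norm_num),
    Real.rpow_sub_one (by norm_num : (4 : ℝ) ≠ 0)]
  field_simp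

/-- The kernel is integrated over the whole half line, so the bound does not depend on the length of
`[a, t]`. The pointwise hypothesis omits the end points, where kernels like `q^{-α}` are singular.
-/
theorem norm_integral_conv_le {X : Type*} [NormedAddCommGroup X] [NormedSpace ℝ X] {Φ : ℝ → X}
    {κ : ℝ → ℝ} {a t c : ℝ} (hat : a ≤ t) (hc : 0 ≤ c) (hκ : IntegrableOn κ (Ioi 0))
    (hκ0 : ∀ q, 0 < q → 0 ≤ κ q) (h : ∀ s, a < s → s < t → ‖Φ s‖ ≤ c * κ (t - s)) :
    ‖∫ s in a..t, Φ s‖ ≤ c * ∫ q in Ioi (0 : ℝ), κ q := by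
  have h0 : 0 ≤ t - a := sub_nonneg.2 hat
  have hi : IntervalIntegrable κ volume (t - t) (t - a) := by
    rw [sub_self, intervalIntegrable_iff_integrableOn_Ioc_of_le h0]
    exact hκ.mono_set Ioc_subset_Ioi_self
  have hi2 : IntervalIntegrable (fun s => c * κ (t - s)) volume a t := by
    have := hi.comp_sub_left t
    simp only [sub_sub_cancel] at this
    exact this.symm.const_mul c
  have h1 : ∀ᵐ s, s ∈ Ioc a t → ‖Φ s‖ ≤ c * κ (t - s) := by
    filter_upwards [Measure.ae_ne volume t] with s hs hst
    exact h s hst.1 (lt_of_le_of_ne hst.2 hs)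
  refine (intervalIntegral.norm_integral_le_of_norm_le hat h1 hi2).trans ?_
  rw [intervalIntegral.integral_const_mul]
  gcongr
  rw [intervalIntegral.integral_comp_sub_left, sub_self, intervalIntegral.integral_of_le h0]
  exact setIntegral_mono_set hκ ((ae_restrict_mem measurableSet_Ioi).mono fun q hq => hκ0 q hq)
    Ioc_subset_Ioi_self.eventuallyLE

/-! ### Mild solutions of `x' + A x = A^α F(x)` -/

namespace PosOperator

variable {X : Type*} [NormedAddCommGroup X] [InnerProductSpace ℝ X] [CompleteSpace X]
variable {A : PosOperator X} {α : ℝ} {S : Set ℝ}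

theorem intervalIntegrable_flow (hα : α ∈ Ioo (0 : ℝ) 1) {g : ℝ → X} {a t : ℝ} (hat : a ≤ t)
    (hg : ContinuousOn g (Icc a t)) :
    IntervalIntegrable (fun s => A.flow S α (t - s) (g s)) volume a t := by
  obtain ⟨G, hG⟩ := isCompact_Icc.exists_bound_of_continuousOn hg
  have h0 : 0 ≤ t - a := sub_nonneg.2 hat
  have hi : IntervalIntegrable (fun s => (t - s) ^ (-α) * G) volume a t := by
    have h1 : IntervalIntegrable (fun q : ℝ => q ^ (-α)) volume (t - t) (t - a) :=
      intervalIntegral.intervalIntegrable_rpow' (by linarith [hα.2])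
    have := h1.comp_sub_left t
    simp only [sub_sub_cancel] at this
    exact this.symm.mul_const G
  -- The end point `s = t` is dropped because the flow is continuous only at positive times.
  rw [intervalIntegrable_iff_integrableOn_Ioc_of_le hat, integrableOn_Ioc_iff_integrableOn_Ioo]
    at hi ⊢
  refine Integrable.mono' hi ?_ ?_
  · refine ContinuousOn.aestronglyMeasurable ?_ measurableSet_Ioo
    refine ContinuousOn.clm_apply ?_ (hg.mono Ioo_subset_Icc_self)
    exact (continuousOn_flow hα.1.le hα.2.le).comp (by fun_prop) fun s hs => sub_pos.2 hs.2
  · refine (ae_restrict_mem measurableSet_Ioo).mono fun s hs => ?_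
    refine (ContinuousLinearMap.le_opNorm _ _).trans ?_
    have h1 : 0 < t - s := sub_pos.2 hs.2
    gcongr
    · exact norm_flow_le hα.1.le hα.2.le h1
    · exact hG s (Ioo_subset_Icc_self hs)

theorem flow_integral (hα : α ∈ Ioo (0 : ℝ) 1) {g : ℝ → X} {a r t : ℝ} (har : a ≤ r) (hrt : r ≤ t)
    (hg : ContinuousOn g (Icc a r)) :
    A.flow S 0 (t - r) (∫ s in a..r, A.flow S α (r - s) (g s)) =
      ∫ s in a..r, A.flow S α (t - s) (g s) := by
  rw [← ContinuousLinearMap.intervalIntegral_comp_comm _ (intervalIntegrable_flow hα har hg)]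
  refine intervalIntegral.integral_congr_ae ?_
  filter_upwards [Measure.ae_ne volume r] with s hs hsr
  rw [uIoc_of_le har] at hsr
  have h1 : 0 < r - s := sub_pos.2 (lt_of_le_of_ne hsr.2 hs)
  rw [flow_flow_self (flowBdd_of_nonpos le_rfl (sub_nonneg.2 hrt))
    (flowBdd_of_pos hα.1.le hα.2.le h1), zero_add, sub_add_sub_cancel]
  rw [zero_add, sub_add_sub_cancel]
  exact flowBdd_of_pos hα.1.le hα.2.le (by linarith)

variable (A) in
/-- The variation of constants formula between the times `a` and `t` for `x' + A x = A^α F(x)`,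
which is `u' + A u = F(A^α u)` for `x = A^α u`. -/
def IsMild (α : ℝ) (F : X → X) (x : ℝ → X) (a t : ℝ) : Prop :=
  x t = A.flow univ 0 (t - a) (x a) + ∫ s in a..t, A.flow univ α (t - s) (F (x s))

variable {F : X → X} {x : ℝ → X} {a r t : ℝ}

theorem integral_flow_split (hα : α ∈ Ioo (0 : ℝ) 1) {g : ℝ → X} (har : a ≤ r) (hrt : r ≤ t)
    (hg : ContinuousOn g (Icc a t)) :
    ∫ s in a..t, A.flow S α (t - s) (g s) =
      A.flow S 0 (t - r) (∫ s in a..r, A.flow S α (r - s) (g s)) +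
        ∫ s in r..t, A.flow S α (t - s) (g s) := by
  have hi := intervalIntegrable_flow (A := A) (S := S) hα (har.trans hrt) hg
  rw [flow_integral hα har hrt (hg.mono (Icc_subset_Icc_right hrt)),
    intervalIntegral.integral_add_adjacent_intervals
      (hi.mono_set (by rw [uIcc_of_le har, uIcc_of_le (har.trans hrt)]
                       exact Icc_subset_Icc_right hrt))
      (hi.mono_set (by rw [uIcc_of_le hrt, uIcc_of_le (har.trans hrt)]
                       exact Icc_subset_Icc_left har))]

/-- By the semigroup law a mild solution may be restarted at an intermediate time `r`. -/
theorem isMild_iff_of_le (hα : α ∈ Ioo (0 : ℝ) 1) (hF : Continuous F) (har : a ≤ r) (hrt : r ≤ t)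
    (hx : ContinuousOn x (Icc a t)) (h : A.IsMild α F x a r) :
    A.IsMild α F x a t ↔ A.IsMild α F x r t := by
  have hg : ContinuousOn (fun s => F (x s)) (Icc a t) := hF.comp_continuousOn hx
  unfold IsMild at *
  rw [integral_flow_split hα har hrt hg, h, map_add,
    flow_flow_self (flowBdd_of_nonpos le_rfl (sub_nonneg.2 hrt))
      (flowBdd_of_nonpos le_rfl (sub_nonneg.2 har)), zero_add, sub_add_sub_cancel, add_assoc]
  exact flowBdd_of_nonpos (by simp) (by linarith)

theorem IsMild.congr {y : ℝ → X} (hat : a ≤ t) (h : A.IsMild α F x a t)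
    (hxy : ∀ s ∈ Icc a t, x s = y s) : A.IsMild α F y a t := by
  unfold IsMild at *
  rw [← hxy t ⟨hat, le_rfl⟩, ← hxy a ⟨le_rfl, hat⟩, h]
  congr 1
  refine intervalIntegral.integral_congr fun s hs => ?_
  rw [uIcc_of_le hat] at hs
  simp only [hxy s hs]

theorem IsMild.comp_add (c : ℝ) (h : A.IsMild α F x (a + c) (t + c)) :
    A.IsMild α F (fun s => x (s + c)) a t := by
  unfold IsMild at *
  simp only
  rw [h, add_sub_add_right_eq_sub]
  congr 1
  have := intervalIntegral.integral_comp_add_right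
    (fun s => A.flow univ α (t + c - s) (F (x s))) (a := a) (b := t) c
  rw [← this]
  simp only [add_sub_add_right_eq_sub]

/-- Uniqueness of mild solutions. -/
theorem IsMild.unique (hα : α ∈ Ioo (0 : ℝ) 1) {C : ℝ} (hF : Continuous F)
    (hFC : ∀ u v, ‖F u - F v‖ ≤ C * ‖u - v‖) {y : ℝ → X}
    (hx : ContinuousOn x (Icc a t)) (hy : ContinuousOn y (Icc a t))
    (hmx : ∀ r ∈ Icc a t, A.IsMild α F x a r) (hmy : ∀ r ∈ Icc a t, A.IsMild α F y a r)
    (ha : x a = y a) : ∀ r ∈ Icc a t, x r = y r := by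
  intro r₀ hr₀
  have hC : 0 ≤ |C| * Real.Gamma (1 - α) :=
    mul_nonneg (abs_nonneg C) (Real.Gamma_pos_of_pos (by linarith [hα.2])).le
  -- In the norm weighted by `e^{-σs}` the Duhamel integral has Lipschitz constant `|C| Γ(1-α)
  -- σ^{α-1}`, which is below `1` for large `σ`. This covers an interval of any length at once and
  -- replaces a singular Gronwall inequality.
  obtain ⟨σ, hσ, hσ0⟩ : ∃ σ : ℝ, |C| * Real.Gamma (1 - α) * σ ^ (α - 1) < 1 ∧ 0 < σ := by
    have h1 : Tendsto (fun σ : ℝ => |C| * Real.Gamma (1 - α) * σ ^ (-(1 - α))) atTop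
        (𝓝 (|C| * Real.Gamma (1 - α) * 0)) :=
      (tendsto_rpow_neg_atTop (by linarith [hα.2])).const_mul _
    rw [mul_zero] at h1
    obtain ⟨σ, h2, h3⟩ := ((h1.eventually_lt_const zero_lt_one).and (eventually_gt_atTop 0)).exists
    rw [neg_sub] at h2
    exact ⟨σ, h2, h3⟩
  have hcont : ContinuousOn (fun s => Real.exp (-(σ * s)) * ‖x s - y s‖) (Icc a t) := by
    fun_prop
  -- Evaluating at the point where the weighted difference is largest bounds the maximum by a proper
  -- fraction of itself.
  obtain ⟨s₀, hs₀, hmax⟩ := isCompact_Icc.exists_isMaxOn ⟨r₀, hr₀⟩ hcont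
  set D := Real.exp (-(σ * s₀)) * ‖x s₀ - y s₀‖ with hD
  have hD0 : 0 ≤ D := by positivity
  have hle : ∀ s ∈ Icc a t, ‖x s - y s‖ ≤ D * Real.exp (σ * s) := fun s hs => by
    have := hmax hs
    simp only [mem_ofPred_eq] at this
    rw [Real.exp_neg, inv_mul_le_iff₀ (Real.exp_pos _)] at this
    linarith
  have hIcc : Icc a s₀ ⊆ Icc a t := Icc_subset_Icc_right hs₀.2
  have hd : x s₀ - y s₀ = ∫ s in a..s₀, A.flow univ α (s₀ - s) (F (x s) - F (y s)) := by
    have hgx : ContinuousOn (fun s => F (x s)) (Icc a s₀) := hF.comp_continuousOn (hx.mono hIcc)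
    have hgy : ContinuousOn (fun s => F (y s)) (Icc a s₀) := hF.comp_continuousOn (hy.mono hIcc)
    rw [hmx s₀ hs₀, hmy s₀ hs₀, ha, add_sub_add_left_eq_sub, ← intervalIntegral.integral_sub
      (intervalIntegrable_flow hα hs₀.1 hgx) (intervalIntegrable_flow hα hs₀.1 hgy)]
    simp only [map_sub]
  have hest : ‖x s₀ - y s₀‖ ≤ |C| * D * Real.exp (σ * s₀) *
      ∫ q in Ioi (0 : ℝ), q ^ (-α) * Real.exp (-(σ * q)) := by
    rw [hd]
    refine norm_integral_conv_le hs₀.1 (by positivity)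
      (integrableOn_rpow_neg_mul_exp hα.2 hσ0) (fun q hq => by positivity) fun s hs hs' => ?_
    have h1 : 0 < s₀ - s := sub_pos.2 hs'
    refine (ContinuousLinearMap.le_opNorm _ _).trans ?_
    calc _ ≤ (s₀ - s) ^ (-α) * (|C| * (D * Real.exp (σ * s))) := by
          gcongr
          · exact norm_flow_le hα.1.le hα.2.le h1
          · refine (hFC _ _).trans ?_
            gcongr
            · exact le_abs_self C
            · exact hle s ⟨hs.le, hs'.le.trans hs₀.2⟩
      _ = _ := by
          rw [show σ * s = σ * s₀ + -(σ * (s₀ - s)) by ring, Real.exp_add]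
          ring
  rw [integral_rpow_neg_mul_exp hα.2 hσ0] at hest
  have h1 : D ≤ (|C| * Real.Gamma (1 - α) * σ ^ (α - 1)) * D := by
    calc D = (Real.exp (σ * s₀))⁻¹ * ‖x s₀ - y s₀‖ := by rw [hD, Real.exp_neg]
      _ ≤ _ := (inv_mul_le_iff₀ (Real.exp_pos _)).2 (hest.trans_eq (by ring))
  have h2 : D = 0 := by nlinarith
  have h3 := hle r₀ hr₀
  rw [h2, zero_mul] at h3
  exact sub_eq_zero.1 (norm_le_zero_iff.1 h3)

end PosOperator

/-! ### The spectral gap and the comparison of two solutions -/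

namespace PosOperator

variable {X : Type*} [NormedAddCommGroup X] [InnerProductSpace ℝ X] [CompleteSpace X]

/-- `∫ ‖A^α e^{-At} (I - Q)‖ dt` is at most this number if the spectrum of `A (I - Q)` lies
above `m`. -/
noncomputable def gapConst (α m : ℝ) : ℝ := 4 * Real.Gamma (1 - α) * m ^ (α - 1)

/-- The spectral gap condition for `x' + A x = A^α F(x)`: the eigenvalues in `W` are at most `b`,
the other ones at least `m`, and `F` is bounded and Lipschitz with a constant that is small
compared to the gap between `b` and `m`. -/
structure SpectralGap (A : PosOperator X) (α : ℝ) (F : X → X) (W : Finset ℝ)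
    (C b γ m : ℝ) : Prop where
  hα : α ∈ Ioo (0 : ℝ) 1
  b_pos : 0 < b
  le_b : ∀ μ ∈ W, A.IsEig μ → μ ≤ b
  m_le : ∀ μ, A.IsEig μ → μ ∉ W → m ≤ μ
  b_lt : b < γ
  two_mul_le : 2 * γ ≤ m
  bdd : ∀ u, ‖F u‖ ≤ C
  lip : ∀ u v, ‖F u - F v‖ ≤ C * ‖u - v‖
  small_fast : C * gapConst α m ≤ 1 / 4
  small_slow : C * b ^ α ≤ (γ - b) / 4

variable {A : PosOperator X} {α : ℝ} {F : X → X} {W : Finset ℝ} {C b γ m : ℝ}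

theorem flowBdd_finset {β t : ℝ} : A.FlowBdd W β t := flowBdd_of_finite W.finite_toSet

/-- All symbols on a finite set are bounded, so the law holds for times of either sign: on `QX` the
flow is a group. -/
theorem flow_finset_flow {β β' t t' : ℝ} (u : X) :
    A.flow W β t (A.flow W β' t' u) = A.flow W (β + β') (t + t') u :=
  flow_flow_self flowBdd_finset flowBdd_finset flowBdd_finset u

theorem flow_finset_compl {β β' t t' : ℝ} (h : A.FlowBdd (W : Set ℝ)ᶜ β' t') (u : X) :
    A.flow W β t (A.flow (W : Set ℝ)ᶜ β' t' u) = 0 := by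
  refine A.ext_proj fun μ _ => ?_
  rw [proj_flow flowBdd_finset, proj_flow h, map_zero]
  by_cases hμ : μ ∈ (W : Set ℝ)
  · rw [flowSymbol_of_notMem (fun h0 : μ ∈ (W : Set ℝ)ᶜ => h0 hμ), zero_smul, smul_zero]
  · rw [flowSymbol_of_notMem hμ, zero_smul]

theorem flow_zero_flow_univ {S : Set ℝ} {β t : ℝ} (h : A.FlowBdd univ β t)
    (h' : A.FlowBdd S β t) (u : X) : A.flow S 0 0 (A.flow univ β t u) = A.flow S β t u := by
  rw [flow_flow (flowBdd_of_nonpos le_rfl le_rfl) h, inter_univ, zero_add, zero_add]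
  rwa [inter_univ, zero_add, zero_add]

theorem add_flow_compl (W : Finset ℝ) (u : X) :
    A.flow W 0 0 u + A.flow (W : Set ℝ)ᶜ 0 0 u = u := by
  have h : ∀ S : Set ℝ, A.FlowBdd S 0 0 := fun S => flowBdd_of_nonpos le_rfl le_rfl
  rw [← flow_univ_eq_add (h _) (h _) (h _), flow_univ_zero_zero]

theorem IsMild.flow_eq (hα : α ∈ Ioo (0 : ℝ) 1) {x : ℝ → X} {a t : ℝ} (hat : a ≤ t)
    (hx : ContinuousOn (fun s => F (x s)) (Icc a t)) (h : A.IsMild α F x a t) (S : Set ℝ) :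
    A.flow S 0 0 (x t) =
      A.flow S 0 (t - a) (A.flow S 0 0 (x a)) + ∫ s in a..t, A.flow S α (t - s) (F (x s)) := by
  have h0 : ∀ S : Set ℝ, A.FlowBdd S 0 (t - a) := fun S =>
    flowBdd_of_nonpos le_rfl (sub_nonneg.2 hat)
  rw [h, map_add, flow_zero_flow_univ (h0 _) (h0 _), flow_flow_self (h0 S)
    (flowBdd_of_nonpos le_rfl le_rfl), add_zero, add_zero]
  · congr 1
    rw [← ContinuousLinearMap.intervalIntegral_comp_comm _ (intervalIntegrable_flow hα hat hx)]
    refine intervalIntegral.integral_congr_ae ?_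
    filter_upwards [Measure.ae_ne volume t] with s hs hst
    rw [uIoc_of_le hat] at hst
    have h1 : 0 < t - s := sub_pos.2 (lt_of_le_of_ne hst.2 hs)
    exact flow_zero_flow_univ (flowBdd_of_pos hα.1.le hα.2.le h1)
      (flowBdd_of_pos hα.1.le hα.2.le h1) _
  · rw [add_zero, add_zero]; exact h0 S

theorem intervalIntegrable_flow_finset {g : ℝ → X} {a t r : ℝ} (hat : a ≤ t)
    (hg : ContinuousOn g (Icc a t)) :
    IntervalIntegrable (fun s => A.flow W α (r - s) (g s)) volume a t := by
  rw [← uIcc_of_le hat] at hg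
  simp only [flow_finset]
  exact ContinuousOn.intervalIntegrable (by fun_prop)

/-- The flow on `QX` extends to negative times. -/
theorem IsMild.flow_finset_eq (hα : α ∈ Ioo (0 : ℝ) 1) {x : ℝ → X} {a t : ℝ} (hat : a ≤ t)
    (hx : ContinuousOn (fun s => F (x s)) (Icc a t)) (h : A.IsMild α F x a t) :
    A.flow W 0 0 (x a) = A.flow W 0 (a - t) (A.flow W 0 0 (x t)) -
      ∫ s in a..t, A.flow W α (a - s) (F (x s)) := by
  rw [h.flow_eq hα hat hx, map_add, flow_finset_flow, flow_finset_flow,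
    ← ContinuousLinearMap.intervalIntegral_comp_comm _ (intervalIntegrable_flow hα hat hx)]
  simp only [flow_finset_flow, zero_add, sub_add_sub_cancel, add_zero, sub_self,
    add_sub_cancel_right]

namespace SpectralGap

variable (h : SpectralGap A α F W C b γ m)
include h

theorem γ_pos : 0 < γ := h.b_pos.trans h.b_lt

theorem m_pos : 0 < m := by linarith [h.γ_pos, h.two_mul_le]

theorem C_nonneg : 0 ≤ C := (norm_nonneg _).trans (h.bdd 0)

theorem gapConst_pos : 0 < gapConst α m :=
  mul_pos (mul_pos (by norm_num) (Real.Gamma_pos_of_pos (by linarith [h.hα.2])))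
    (Real.rpow_pos_of_pos h.m_pos _)

theorem continuous_F : Continuous F := by
  have : LipschitzWith (Real.toNNReal C) F := LipschitzWith.of_dist_le_mul fun u v => by
    rw [dist_eq_norm, dist_eq_norm, Real.coe_toNNReal _ h.C_nonneg]; exact h.lip u v
  exact this.continuous

/-- The weight factors out at time `t` and leaves a fixed integrable kernel. It is used with `η = γ`
for differences of solutions and with `η = 0` for bounded forcing. -/
theorem norm_flow_apply_le {η G q t : ℝ} (hη : 2 * η ≤ m) (hq : 0 < q) {u : X}
    (hu : ‖u‖ ≤ G * Real.exp (-(η * (t - q)))) :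
    ‖A.flow (W : Set ℝ)ᶜ α q u‖ ≤
      G * Real.exp (-(η * t)) * ((q / 4) ^ (-α) * Real.exp (-(m / 4 * q))) := by
  refine (ContinuousLinearMap.le_opNorm _ _).trans ?_
  have h1 := norm_flow_le_of_gap (A := A) (S := (W : Set ℝ)ᶜ) h.hα.1.le h.hα.2.le hη
    (fun μ hμ he => h.m_le μ he (mt Finset.mem_coe.2 hμ)) hq
  calc _ ≤ ((q / 4) ^ (-α) * Real.exp (-(m / 4 * q)) * Real.exp (-(η * q))) *
        (G * Real.exp (-(η * (t - q)))) := by gcongr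
    _ = _ := by
      rw [show -(η * t) = -(η * q) + -(η * (t - q)) by ring, Real.exp_add]
      ring

theorem norm_integral_fast_le {η G a t : ℝ} (hη : 2 * η ≤ m) (hG : 0 ≤ G) (hat : a ≤ t)
    {g : ℝ → X} (hg : ∀ s, a < s → s < t → ‖g s‖ ≤ G * Real.exp (-(η * s))) :
    ‖∫ s in a..t, A.flow (W : Set ℝ)ᶜ α (t - s) (g s)‖ ≤
      G * gapConst α m * Real.exp (-(η * t)) := by
  have := norm_integral_conv_le (Φ := fun s => A.flow (W : Set ℝ)ᶜ α (t - s) (g s)) hat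
    (show 0 ≤ G * Real.exp (-(η * t)) by positivity)
    (integrableOn_gap_kernel h.hα.2 h.m_pos) (fun q hq => by positivity) fun s hs hs' =>
      h.norm_flow_apply_le hη (sub_pos.2 hs') (by rw [sub_sub_cancel]; exact hg s hs hs')
  rw [integral_gap_kernel h.hα.2 h.m_pos] at this
  exact this.trans_eq (by unfold gapConst; ring)

theorem norm_integral_fast_Ioi_le {η G t : ℝ} (hη : 2 * η ≤ m)
    {g : ℝ → X} (hg : ∀ s, s < t → ‖g s‖ ≤ G * Real.exp (-(η * s))) :
    ‖∫ q in Ioi (0 : ℝ), A.flow (W : Set ℝ)ᶜ α q (g (t - q))‖ ≤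
      G * gapConst α m * Real.exp (-(η * t)) := by
  refine (norm_integral_le_of_norm_le
    ((integrableOn_gap_kernel h.hα.2 h.m_pos).const_mul (G * Real.exp (-(η * t))))
    ((ae_restrict_mem measurableSet_Ioi).mono fun q hq => h.norm_flow_apply_le hη hq
      (hg (t - q) (sub_lt_self t hq)))).trans_eq ?_
  rw [integral_const_mul, integral_gap_kernel h.hα.2 h.m_pos]
  unfold gapConst
  ring

/-- Backwards in time the slow flow grows at rate at most `b`, less than the rate `γ` of the weight.
What remains is `C b^α` times the integral of `e^{-(γ-b)q}`, that is `C b^α / (γ - b) ≤ 1/4`. -/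
theorem norm_integral_slow_le {N t : ℝ} (hN : 0 ≤ N) (ht : t ≤ 0)
    {g : ℝ → X} (hg : ∀ s, t < s → s < 0 → ‖g s‖ ≤ C * (N * Real.exp (-(γ * s)))) :
    ‖∫ s in t..0, A.flow W α (t - s) (g s)‖ ≤ N * Real.exp (-(γ * t)) / 4 := by
  have hC := h.C_nonneg
  have hb := h.b_pos.le
  have hγb : 0 < γ - b := sub_pos.2 h.b_lt
  -- Reflecting time turns the backward integral into a convolution over `[0, -t]`.
  have h1 := intervalIntegral.integral_comp_neg (fun s => A.flow W α (t - s) (g s)) (a := 0) (b := -t)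
  rw [neg_neg, neg_zero] at h1
  rw [← h1]
  refine (norm_integral_conv_le (neg_nonneg.2 ht)
    (show 0 ≤ C * b ^ α * (N * Real.exp (-(γ * t))) by positivity)
    (integrableOn_rpow_neg_mul_exp (α := 0) zero_lt_one hγb) (fun q hq => by positivity)
    fun s hs hs' => ?_).trans ?_
  · refine (ContinuousLinearMap.le_opNorm _ _).trans ?_
    calc _ ≤ (b ^ α * Real.exp (-(b * (t - -s)))) * (C * (N * Real.exp (-(γ * -s)))) := by
          gcongr
          · exact norm_flow_le_of_nonpos h.hα.1.le hb
              (fun μ hμ he => h.le_b μ (Finset.mem_coe.1 hμ) he) (by linarith)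
          · exact hg _ (by linarith) (by linarith)
      _ = _ := by
          have h2 : Real.exp (-(b * (t - -s))) * Real.exp (-(γ * -s)) =
              Real.exp (-(γ * t)) * Real.exp (-((γ - b) * (-t - s))) := by
            rw [← Real.exp_add, ← Real.exp_add]
            congr 1
            ring
          rw [neg_zero, Real.rpow_zero, one_mul]
          linear_combination (b ^ α * C * N) * h2
  · rw [integral_rpow_neg_mul_exp zero_lt_one hγb, sub_zero, Real.Gamma_one, one_mul, zero_sub,
      Real.rpow_neg_one, mul_inv_le_iff₀ hγb]
    have h3 : 0 ≤ N * Real.exp (-(γ * t)) := by positivity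
    nlinarith [h.small_slow]

/-- Two mild solutions on `[-L, 0]` are close to each other at time `0` up to an exponentially small
error if they agree in the slow direction at time `0`. -/
theorem norm_solution_sub_le {L : ℝ} {x y : ℝ → X} (hx : ContinuousOn x (Icc (-L) 0))
    (hy : ContinuousOn y (Icc (-L) 0))
    (hmx : ∀ a t, -L ≤ a → a ≤ t → t ≤ 0 → A.IsMild α F x a t)
    (hmy : ∀ a t, -L ≤ a → a ≤ t → t ≤ 0 → A.IsMild α F y a t) :
    ∀ t ∈ Icc (-L) 0, ‖x t - y t‖ ≤ 2 * Real.exp (-(γ * t)) * (‖A.flow W 0 0 (x 0 - y 0)‖ +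
      Real.exp (-(γ * L)) * ‖A.flow (W : Set ℝ)ᶜ 0 0 (x (-L) - y (-L))‖) := by
  intro r₀ hr₀
  have hC := h.C_nonneg
  have hcont : ContinuousOn (fun s => Real.exp (γ * s) * ‖x s - y s‖) (Icc (-L) 0) := by
    fun_prop
  -- `N` is the norm of `x - y` in the weight `e^{γs}`; it is estimated at the time where it is
  -- attained.
  obtain ⟨t, ht, hmax⟩ := isCompact_Icc.exists_isMaxOn ⟨r₀, hr₀⟩ hcont
  set N := Real.exp (γ * t) * ‖x t - y t‖ with hN
  have hN0 : 0 ≤ N := by positivity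
  have hle : ∀ s ∈ Icc (-L) 0, ‖x s - y s‖ ≤ N * Real.exp (-(γ * s)) := fun s hs => by
    have := hmax hs
    simp only [mem_ofPred_eq] at this
    rw [Real.exp_neg, ← div_eq_mul_inv, le_div_iff₀ (Real.exp_pos _)]
    linarith
  have hgx : ContinuousOn (fun s => F (x s)) (Icc (-L) 0) := h.continuous_F.comp_continuousOn hx
  have hgy : ContinuousOn (fun s => F (y s)) (Icc (-L) 0) := h.continuous_F.comp_continuousOn hy
  have hg : ∀ s ∈ Icc (-L) 0, ‖F (x s) - F (y s)‖ ≤ C * (N * Real.exp (-(γ * s))) := fun s hs =>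
    (h.lip _ _).trans (mul_le_mul_of_nonneg_left (hle s hs) hC)
  have hs1 : Icc t 0 ⊆ Icc (-L) 0 := Icc_subset_Icc_left ht.1
  have hs2 : Icc (-L) t ⊆ Icc (-L) 0 := Icc_subset_Icc_right ht.2
  -- The slow part is expressed by its value at the final time `0`, the fast part by its value at
  -- the initial time `-L`: each is propagated in its favourable direction.
  have hslow : A.flow W 0 0 (x t - y t) = A.flow W 0 t (A.flow W 0 0 (x 0 - y 0)) -
      ∫ s in t..0, A.flow W α (t - s) (F (x s) - F (y s)) := by
    simp only [map_sub]
    rw [intervalIntegral.integral_sub (intervalIntegrable_flow_finset ht.2 (hgx.mono hs1))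
      (intervalIntegrable_flow_finset ht.2 (hgy.mono hs1)),
      (hmx t 0 ht.1 ht.2 le_rfl).flow_finset_eq h.hα ht.2 (hgx.mono hs1),
      (hmy t 0 ht.1 ht.2 le_rfl).flow_finset_eq h.hα ht.2 (hgy.mono hs1), sub_zero]
    abel
  have hfast : A.flow (W : Set ℝ)ᶜ 0 0 (x t - y t) =
      A.flow (W : Set ℝ)ᶜ 0 (t + L) (A.flow (W : Set ℝ)ᶜ 0 0 (x (-L) - y (-L))) +
      ∫ s in (-L)..t, A.flow (W : Set ℝ)ᶜ α (t - s) (F (x s) - F (y s)) := by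
    simp only [map_sub]
    rw [intervalIntegral.integral_sub (intervalIntegrable_flow h.hα ht.1 (hgx.mono hs2))
      (intervalIntegrable_flow h.hα ht.1 (hgy.mono hs2)),
      (hmx (-L) t le_rfl ht.1 ht.2).flow_eq h.hα ht.1 (hgx.mono hs2),
      (hmy (-L) t le_rfl ht.1 ht.2).flow_eq h.hα ht.1 (hgy.mono hs2), sub_neg_eq_add]
    abel
  have e1 : ‖A.flow W 0 0 (x t - y t)‖ ≤
      Real.exp (-(γ * t)) * ‖A.flow W 0 0 (x 0 - y 0)‖ + N * Real.exp (-(γ * t)) / 4 := by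
    rw [hslow]
    refine (norm_sub_le _ _).trans (add_le_add ?_ (h.norm_integral_slow_le hN0 ht.2
      fun s hs hs' => hg s ⟨ht.1.trans hs.le, hs'.le⟩))
    refine (ContinuousLinearMap.le_opNorm _ _).trans ?_
    gcongr
    refine (norm_flow_le_of_nonpos le_rfl h.b_pos.le
      (fun μ hμ he => h.le_b μ (Finset.mem_coe.1 hμ) he) ht.2).trans ?_
    rw [Real.rpow_zero, one_mul]
    exact Real.exp_le_exp.2 (by nlinarith [h.b_lt, ht.2])
  have e2 : ‖A.flow (W : Set ℝ)ᶜ 0 0 (x t - y t)‖ ≤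
      Real.exp (-(γ * (t + L))) * ‖A.flow (W : Set ℝ)ᶜ 0 0 (x (-L) - y (-L))‖ +
        N * Real.exp (-(γ * t)) / 4 := by
    rw [hfast]
    refine (norm_add_le _ _).trans (add_le_add ?_ ?_)
    · refine (ContinuousLinearMap.le_opNorm _ _).trans ?_
      gcongr
      exact norm_flow_zero_le_of_gap (by linarith [h.two_mul_le, h.γ_pos])
        (fun μ hμ he => h.m_le μ he (mt Finset.mem_coe.2 hμ)) (by linarith [ht.1])
    · refine (h.norm_integral_fast_le h.two_mul_le (show 0 ≤ C * N by positivity) ht.1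
        fun s hs hs' => ?_).trans ?_
      · rw [mul_assoc]; exact hg s ⟨hs.le, hs'.le.trans ht.2⟩
      · have h3 : 0 ≤ N * Real.exp (-(γ * t)) := by positivity
        nlinarith [h.small_fast]
  have e3 : ‖x t - y t‖ ≤ ‖A.flow W 0 0 (x t - y t)‖ + ‖A.flow (W : Set ℝ)ᶜ 0 0 (x t - y t)‖ := by
    conv_lhs => rw [← add_flow_compl (A := A) W (x t - y t)]
    exact norm_add_le _ _
  -- The two integrals contribute `N/4` each; absorbing `N/2` on the left costs the factor `2`.
  have e4 : N ≤ 2 * (‖A.flow W 0 0 (x 0 - y 0)‖ +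
      Real.exp (-(γ * L)) * ‖A.flow (W : Set ℝ)ᶜ 0 0 (x (-L) - y (-L))‖) := by
    have h5 : Real.exp (-(γ * (t + L))) = Real.exp (-(γ * t)) * Real.exp (-(γ * L)) := by
      rw [← Real.exp_add]
      congr 1
      ring
    have h6 : ‖x t - y t‖ = N * Real.exp (-(γ * t)) := by
      rw [hN, Real.exp_neg, mul_right_comm, mul_inv_cancel₀ (Real.exp_pos _).ne', one_mul]
    rw [h5] at e2
    have h7 := Real.exp_pos (-(γ * t))
    have h8 : N * Real.exp (-(γ * t)) ≤ 2 * (‖A.flow W 0 0 (x 0 - y 0)‖ +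
      Real.exp (-(γ * L)) * ‖A.flow (W : Set ℝ)ᶜ 0 0 (x (-L) - y (-L))‖) * Real.exp (-(γ * t)) := by
      linarith
    exact le_of_mul_le_mul_right h8 h7
  refine (hle r₀ hr₀).trans ?_
  have := Real.exp_pos (-(γ * r₀))
  nlinarith

end SpectralGap

end PosOperator

/-! ### The Lyapunov–Perron fixed point -/

namespace PosOperator

variable {X : Type*} [NormedAddCommGroup X] [InnerProductSpace ℝ X] [CompleteSpace X]

/-- The right hand side of the Lyapunov–Perron equation. -/
noncomputable def lyapunovPerron (A : PosOperator X) (α : ℝ) (W : Finset ℝ) (v : X) (g : ℝ → X)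
    (t : ℝ) : X :=
  A.flow W 0 t v - (∫ s in t..0, A.flow W α (t - s) (g s)) +
    ∫ q in Ioi (0 : ℝ), A.flow (W : Set ℝ)ᶜ α q (g (t - q))

variable {A : PosOperator X} {α : ℝ} {F : X → X} {W : Finset ℝ} {C b γ m : ℝ}

theorem intervalIntegrable_flow_finset' {g : ℝ → X} (hg : Continuous g) (a t r : ℝ) :
    IntervalIntegrable (fun s => A.flow W α (r - s) (g s)) volume a t :=
  (continuous_flow_finset W α hg (by fun_prop)).intervalIntegrable a t

theorem flow_finset_integral {g : ℝ → X} (hg : Continuous g) (a t r r' : ℝ) :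
    A.flow W 0 r' (∫ s in a..t, A.flow W α (r - s) (g s)) =
      ∫ s in a..t, A.flow W α (r' + r - s) (g s) := by
  rw [← ContinuousLinearMap.intervalIntegral_comp_comm _ (intervalIntegrable_flow_finset' hg a t r)]
  simp only [flow_finset_flow, zero_add, add_sub_assoc]

namespace SpectralGap

variable (h : SpectralGap A α F W C b γ m)
include h

theorem aestronglyMeasurable_flow {g : ℝ → X} (hg : Continuous g) (t : ℝ) :
    AEStronglyMeasurable (fun q => A.flow (W : Set ℝ)ᶜ α q (g (t - q)))
      (volume.restrict (Ioi 0)) := by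
  refine ContinuousOn.aestronglyMeasurable ?_ measurableSet_Ioi
  exact (continuousOn_flow h.hα.1.le h.hα.2.le).clm_apply (by fun_prop)

theorem norm_flow_apply_le_of_bdd {g : ℝ → X} {G : ℝ} (hG : ∀ s, ‖g s‖ ≤ G) (t q : ℝ) (hq : 0 < q) :
    ‖A.flow (W : Set ℝ)ᶜ α q (g (t - q))‖ ≤
      G * ((q / 4) ^ (-α) * Real.exp (-(m / 4 * q))) := by
  have := h.norm_flow_apply_le (η := 0) (G := G) (t := t) (by linarith [h.m_pos]) hq
    (u := g (t - q)) (by simpa using hG _)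
  simpa using this

theorem integrableOn_flow {g : ℝ → X} (hg : Continuous g) {G : ℝ} (hG : ∀ s, ‖g s‖ ≤ G) (t : ℝ) :
    IntegrableOn (fun q => A.flow (W : Set ℝ)ᶜ α q (g (t - q))) (Ioi 0) :=
  Integrable.mono' ((integrableOn_gap_kernel h.hα.2 h.m_pos).const_mul G)
    (h.aestronglyMeasurable_flow hg t)
    ((ae_restrict_mem measurableSet_Ioi).mono fun q hq => h.norm_flow_apply_le_of_bdd hG t q hq)

/-- In the variable `q = t - s` the singularity stays at `q = 0` and only the bounded continuous `g`
moves with `t`, so dominated convergence applies. -/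
theorem continuous_fast {g : ℝ → X} (hg : Continuous g) {G : ℝ} (hG : ∀ s, ‖g s‖ ≤ G) :
    Continuous fun t => ∫ q in Ioi (0 : ℝ), A.flow (W : Set ℝ)ᶜ α q (g (t - q)) := by
  refine continuous_of_dominated (h.aestronglyMeasurable_flow hg)
    (fun t => (ae_restrict_mem measurableSet_Ioi).mono fun q hq =>
      h.norm_flow_apply_le_of_bdd hG t q hq)
    ((integrableOn_gap_kernel h.hα.2 h.m_pos).const_mul G) (Eventually.of_forall fun q => ?_)
  fun_prop

theorem continuous_lyapunovPerron (v : X) {g : ℝ → X} (hg : Continuous g) {G : ℝ}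
    (hG : ∀ s, ‖g s‖ ≤ G) : Continuous (A.lyapunovPerron α W v g) := by
  -- The group law on `QX` pulls `t` out of the integrand, leaving a primitive.
  have h1 : ∀ t, ∫ s in t..0, A.flow W α (t - s) (g s) =
      A.flow W 0 t (-∫ s in (0 : ℝ)..t, A.flow W α (0 - s) (g s)) := fun t => by
    rw [← intervalIntegral.integral_symm, flow_finset_integral hg, add_zero]
  unfold lyapunovPerron
  simp only [h1]
  have h2 : Continuous fun s => A.flow W α (0 - s) (g s) :=
    continuous_flow_finset W α hg (by fun_prop)
  have h3 : Continuous fun t => ∫ s in (0 : ℝ)..t, A.flow W α (0 - s) (g s) :=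
    intervalIntegral.continuous_primitive (fun a b => h2.intervalIntegrable a b) 0
  exact ((continuous_flow_finset W 0 continuous_const continuous_id).sub
    (continuous_flow_finset W 0 h3.neg continuous_id)).add (h.continuous_fast hg hG)

theorem flow_zero_lyapunovPerron {v : X} {g : ℝ → X} (hg : Continuous g)
    {G : ℝ} (hG : ∀ s, ‖g s‖ ≤ G) (t : ℝ) :
    A.flow W 0 0 (A.lyapunovPerron α W v g t) =
      A.flow W 0 t v - ∫ s in t..0, A.flow W α (t - s) (g s) := by
  have h1 : A.flow W 0 0 (∫ q in Ioi (0 : ℝ), A.flow (W : Set ℝ)ᶜ α q (g (t - q))) = 0 := by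
    rw [← ContinuousLinearMap.integral_comp_comm _ (h.integrableOn_flow hg hG t)]
    exact setIntegral_eq_zero_of_forall_eq_zero fun q hq =>
      flow_finset_compl (flowBdd_of_pos h.hα.1.le h.hα.2.le hq) _
  rw [lyapunovPerron, map_add, h1, add_zero, map_sub, flow_finset_flow, flow_finset_integral hg]
  simp only [zero_add]

theorem flow_compl_lyapunovPerron {v : X} {g : ℝ → X} (hg : Continuous g)
    {G : ℝ} (hG : ∀ s, ‖g s‖ ≤ G) (t : ℝ) :
    A.flow (W : Set ℝ)ᶜ 0 0 (A.lyapunovPerron α W v g t) =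
      ∫ q in Ioi (0 : ℝ), A.flow (W : Set ℝ)ᶜ α q (g (t - q)) := by
  have h1 := add_flow_compl (A := A) W (A.lyapunovPerron α W v g t)
  rw [h.flow_zero_lyapunovPerron hg hG] at h1
  exact add_left_cancel (h1.trans rfl)

/-- The integral over the past of `t` is cut at time `a`; by the semigroup law the older piece is
the same integral at time `a`, carried forward by `e^{-A(t-a)}`. -/
theorem fast_eq {g : ℝ → X} (hg : Continuous g) {G : ℝ} (hG : ∀ s, ‖g s‖ ≤ G) {a t : ℝ}
    (hat : a ≤ t) :
    ∫ q in Ioi (0 : ℝ), A.flow (W : Set ℝ)ᶜ α q (g (t - q)) =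
      A.flow (W : Set ℝ)ᶜ 0 (t - a) (∫ q in Ioi (0 : ℝ), A.flow (W : Set ℝ)ᶜ α q (g (a - q))) +
        ∫ s in a..t, A.flow (W : Set ℝ)ᶜ α (t - s) (g s) := by
  have h0 : 0 ≤ t - a := sub_nonneg.2 hat
  have hi := h.integrableOn_flow hg hG t
  rw [← Ioc_union_Ioi_eq_Ioi h0, setIntegral_union (Ioc_disjoint_Ioi le_rfl) measurableSet_Ioi
    (hi.mono_set Ioc_subset_Ioi_self) (hi.mono_set (Ioi_subset_Ioi h0)), add_comm]
  congr 1
  · have h1 := (measurePreserving_add_right volume (t - a)).setIntegral_preimage_emb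
      (MeasurableEquiv.addRight (t - a)).measurableEmbedding
      (fun q => A.flow (W : Set ℝ)ᶜ α q (g (t - q))) (Ioi (t - a))
    have h2 : (fun q => q + (t - a)) ⁻¹' Ioi (t - a) = Ioi 0 := by
      ext q; simp
    rw [h2] at h1
    rw [← h1, Ioc_union_Ioi_eq_Ioi h0,
      ← ContinuousLinearMap.integral_comp_comm _ (h.integrableOn_flow hg hG a)]
    refine setIntegral_congr_fun measurableSet_Ioi fun q hq => ?_
    have hq : 0 < q := hq
    rw [flow_flow_self (flowBdd_of_nonpos le_rfl h0) (flowBdd_of_pos h.hα.1.le h.hα.2.le hq)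
      (by rw [zero_add]; exact flowBdd_of_pos h.hα.1.le h.hα.2.le (by linarith)), zero_add,
      add_comm q, show t - (t - a + q) = a - q by ring]
  · rw [← intervalIntegral.integral_of_le h0]
    have := intervalIntegral.integral_comp_sub_left
      (fun q => A.flow (W : Set ℝ)ᶜ α q (g (t - q))) (a := a) (b := t) t
    simp only [sub_sub_cancel, sub_self] at this
    exact this.symm

/-- For given forcing `g` the Lyapunov–Perron expression solves `x' + A x = A^α g`. Hence a fixed
point, where `g = F(x)` on `(-∞, 0]`, solves the nonlinear equation there. -/
theorem lyapunovPerron_eq (v : X) {g : ℝ → X} (hg : Continuous g) {G : ℝ}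
    (hG : ∀ s, ‖g s‖ ≤ G) {a t : ℝ} (hat : a ≤ t) :
    A.lyapunovPerron α W v g t = A.flow univ 0 (t - a) (A.lyapunovPerron α W v g a) +
      ∫ s in a..t, A.flow univ α (t - s) (g s) := by
  have h0 : 0 ≤ t - a := sub_nonneg.2 hat
  have e1 : ∫ s in a..t, A.flow univ α (t - s) (g s) =
      (∫ s in a..t, A.flow W α (t - s) (g s)) +
        ∫ s in a..t, A.flow (W : Set ℝ)ᶜ α (t - s) (g s) := by
    rw [← intervalIntegral.integral_add (intervalIntegrable_flow_finset' hg _ _ _)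
      (intervalIntegrable_flow h.hα hat hg.continuousOn)]
    refine intervalIntegral.integral_congr_ae ?_
    filter_upwards [Measure.ae_ne volume t] with s hs hst
    rw [uIoc_of_le hat] at hst
    have h1 : 0 < t - s := sub_pos.2 (lt_of_le_of_ne hst.2 hs)
    exact flow_univ_eq_add (flowBdd_of_pos h.hα.1.le h.hα.2.le h1) flowBdd_finset
      (flowBdd_of_pos h.hα.1.le h.hα.2.le h1) _
  have e2 : A.flow univ 0 (t - a) (A.lyapunovPerron α W v g a) =
      A.flow W 0 (t - a) (A.flow W 0 0 (A.lyapunovPerron α W v g a)) +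
      A.flow (W : Set ℝ)ᶜ 0 (t - a) (A.flow (W : Set ℝ)ᶜ 0 0 (A.lyapunovPerron α W v g a)) := by
    have hb : ∀ (S : Set ℝ) (r : ℝ), 0 ≤ r → A.FlowBdd S 0 r := fun S r hr =>
      flowBdd_of_nonpos le_rfl hr
    rw [flow_flow_self (hb _ _ h0) (hb _ _ le_rfl) (by simpa using hb _ _ h0),
      flow_flow_self (hb _ _ h0) (hb _ _ le_rfl) (by simpa using hb _ _ h0), add_zero, add_zero,
      ← flow_univ_eq_add (hb _ _ h0) (hb _ _ h0) (hb _ _ h0)]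
  rw [e2, h.flow_zero_lyapunovPerron hg hG, h.flow_compl_lyapunovPerron hg hG, e1,
    lyapunovPerron, h.fast_eq hg hG hat, map_sub, flow_finset_flow, flow_finset_integral hg,
    ← intervalIntegral.integral_add_adjacent_intervals
      (intervalIntegrable_flow_finset' hg a t _) (intervalIntegrable_flow_finset' hg t 0 _)]
  simp only [zero_add, sub_add_cancel]
  abel

/-- The slow and the fast integral contribute a quarter each. As the difference of two images has
slow datum `v = 0`, this is the contraction estimate with constant `1/2`. -/
theorem norm_lyapunovPerron_zero_le {g : ℝ → X} {N t : ℝ} (hN : 0 ≤ N) (ht : t ≤ 0)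
    (hgN : ∀ s ≤ 0, ‖g s‖ ≤ C * (N * Real.exp (-(γ * s)))) :
    ‖A.lyapunovPerron α W 0 g t‖ ≤ N * Real.exp (-(γ * t)) / 2 := by
  have h1 := h.norm_integral_slow_le hN ht (fun s _ hs => hgN s hs.le)
  have h2 := h.norm_integral_fast_Ioi_le (G := C * N) (t := t) h.two_mul_le
    (fun s hs => (hgN s (hs.le.trans ht)).trans_eq (by ring))
  have h3 : C * N * gapConst α m * Real.exp (-(γ * t)) ≤ N * Real.exp (-(γ * t)) / 4 := by
    have : 0 ≤ N * Real.exp (-(γ * t)) := by positivity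
    nlinarith [h.small_fast]
  rw [lyapunovPerron, map_zero, zero_sub]
  refine (norm_add_le _ _).trans ?_
  rw [norm_neg]
  linarith

theorem lyapunovPerron_sub (v : X) {g₁ g₂ : ℝ → X} (hg₁ : Continuous g₁) (hg₂ : Continuous g₂)
    {G : ℝ} (hG₁ : ∀ s, ‖g₁ s‖ ≤ G) (hG₂ : ∀ s, ‖g₂ s‖ ≤ G) (t : ℝ) :
    A.lyapunovPerron α W v g₁ t - A.lyapunovPerron α W v g₂ t =
      A.lyapunovPerron α W 0 (fun s => g₁ s - g₂ s) t := by
  unfold lyapunovPerron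
  simp only [map_sub]
  rw [intervalIntegral.integral_sub (intervalIntegrable_flow_finset' hg₁ _ _ _)
    (intervalIntegrable_flow_finset' hg₂ _ _ _),
    integral_sub (h.integrableOn_flow hg₁ hG₁ t) (h.integrableOn_flow hg₂ hG₂ t), map_zero]
  abel

/-- Existence of solutions on `(-∞, 0]` with prescribed slow part at time `0` and bounded
fast part. -/
theorem exists_backward_solution {v : X} (hv : A.flow W 0 0 v = v) :
    ∃ p : ℝ → X, Continuous p ∧ (∀ a t, a ≤ t → t ≤ 0 → A.IsMild α F p a t) ∧
      A.flow W 0 0 (p 0) = v ∧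
      ∀ t, ‖A.flow (W : Set ℝ)ᶜ 0 0 (p t)‖ ≤ C * gapConst α m := by
  have hF := h.continuous_F
  have hγ := h.γ_pos
  -- The unknown is `φ(t) = e^{γt} p(t)`, so that the weighted norm of `p` is the sup norm of `φ`.
  let g : (ℝ →ᵇ X) → ℝ → X := fun φ s => F (Real.exp (-(γ * s)) • φ s)
  have hg : ∀ φ, Continuous (g φ) := fun φ => hF.comp (by fun_prop)
  have hG : ∀ φ s, ‖g φ s‖ ≤ C := fun φ s => h.bdd _
  -- Only `t ≤ 0` matters; `min t 0` continues the image by a constant, which keeps it bounded and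
  -- continuous on all of `ℝ`.
  have hbound : ∀ φ (t : ℝ), ‖Real.exp (γ * min t 0) •
      A.lyapunovPerron α W v (g φ) (min t 0)‖ ≤ ‖v‖ + 1 / 2 := fun φ t => by
    set r := min t 0
    have hr : r ≤ 0 := min_le_right _ _
    have e0 : A.lyapunovPerron α W v (g φ) r =
        A.flow W 0 r v + A.lyapunovPerron α W 0 (g φ) r := by
      unfold lyapunovPerron
      rw [map_zero]
      abel
    have e1 := h.norm_lyapunovPerron_zero_le (g := g φ) (N := 1) zero_le_one hr fun s hs => by
      refine (hG φ s).trans (le_mul_of_one_le_right h.C_nonneg ?_)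
      rw [one_mul]
      exact Real.one_le_exp (by nlinarith)
    have e2 : ‖A.flow W 0 r v‖ ≤ Real.exp (-(γ * r)) * ‖v‖ := by
      refine (ContinuousLinearMap.le_opNorm _ _).trans ?_
      gcongr
      refine (norm_flow_le_of_nonpos le_rfl h.b_pos.le
        (fun μ hμ he => h.le_b μ (Finset.mem_coe.1 hμ) he) hr).trans ?_
      rw [Real.rpow_zero, one_mul]
      exact Real.exp_le_exp.2 (by nlinarith [h.b_lt])
    have e3 : ‖A.lyapunovPerron α W v (g φ) r‖ ≤ (‖v‖ + 1 / 2) * Real.exp (-(γ * r)) := by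
      rw [e0]
      refine (norm_add_le _ _).trans ?_
      linarith
    rw [norm_smul, Real.norm_eq_abs, Real.abs_exp]
    rwa [Real.exp_neg, ← div_eq_mul_inv, le_div_iff₀ (Real.exp_pos _), mul_comm] at e3
  have hcont : ∀ φ, Continuous fun t : ℝ => Real.exp (γ * min t 0) •
      A.lyapunovPerron α W v (g φ) (min t 0) := fun φ => by
    have := h.continuous_lyapunovPerron v (hg φ) (hG φ)
    fun_prop
  let Ψ : (ℝ →ᵇ X) → (ℝ →ᵇ X) := fun φ =>
    BoundedContinuousFunction.ofNormedAddCommGroup _ (hcont φ) _ (hbound φ)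
  have hΨ : ContractingWith (1 / 2) Ψ := by
    refine ⟨by norm_num, LipschitzWith.of_dist_le_mul fun φ ψ => ?_⟩
    refine (BoundedContinuousFunction.dist_le (by positivity)).2 fun t => ?_
    set r := min t 0 with hr'
    have hr : r ≤ 0 := min_le_right _ _
    have e1 := h.norm_lyapunovPerron_zero_le (g := fun s => g φ s - g ψ s) (N := dist φ ψ)
      dist_nonneg hr fun s _ => by
        refine (h.lip _ _).trans ?_
        rw [← smul_sub, norm_smul, Real.norm_eq_abs, Real.abs_exp, mul_comm (dist φ ψ)]
        have := h.C_nonneg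
        gcongr
        rw [← dist_eq_norm]
        exact BoundedContinuousFunction.dist_coe_le_dist s
    rw [← h.lyapunovPerron_sub v (hg φ) (hg ψ) (hG φ) (hG ψ)] at e1
    rw [dist_eq_norm]
    show ‖Real.exp (γ * r) • A.lyapunovPerron α W v (g φ) r -
      Real.exp (γ * r) • A.lyapunovPerron α W v (g ψ) r‖ ≤ _
    rw [← smul_sub, norm_smul, Real.norm_eq_abs, Real.abs_exp, NNReal.coe_div, NNReal.coe_one,
      NNReal.coe_ofNat]
    rw [Real.exp_neg, ← div_eq_mul_inv, div_right_comm, le_div_iff₀ (Real.exp_pos _),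
      mul_comm] at e1
    linarith
  obtain ⟨φ, hφ, -⟩ := hΨ.exists_fixedPoint 0 (edist_ne_top _ _)
  have hp := h.continuous_lyapunovPerron v (hg φ) (hG φ)
  have hpg : ∀ t ≤ 0, g φ t = F (A.lyapunovPerron α W v (g φ) t) := fun t ht => by
    have e1 : φ t = Real.exp (γ * min t 0) • A.lyapunovPerron α W v (g φ) (min t 0) := by
      conv_lhs => rw [← hφ.eq]
      rfl
    rw [min_eq_left ht] at e1
    show F (Real.exp (-(γ * t)) • φ t) = _
    rw [e1, smul_smul, ← Real.exp_add, neg_add_cancel, Real.exp_zero, one_smul]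
  refine ⟨A.lyapunovPerron α W v (g φ), hp, fun a t hat ht => ?_, ?_, fun t => ?_⟩
  · rw [IsMild, h.lyapunovPerron_eq v (hg φ) (hG φ) hat]
    congr 1
    refine intervalIntegral.integral_congr fun s hs => ?_
    rw [uIcc_of_le hat] at hs
    simp only [hpg s (hs.2.trans ht)]
  · rw [h.flow_zero_lyapunovPerron (hg φ) (hG φ), intervalIntegral.integral_same, sub_zero, hv]
  · rw [h.flow_compl_lyapunovPerron (hg φ) (hG φ)]
    -- The fixed point argument alone allows growth like `e^{-γt}`. The bound on the fast part,
    -- uniform in time, comes from the boundedness of `F` with the trivial weight `η = 0`.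
    simpa using h.norm_integral_fast_Ioi_le (η := 0) (G := C) (t := t) (g := g φ)
      (by linarith [h.m_pos]) fun s _ => by simpa using hG φ s

end SpectralGap

end PosOperator

/-! ### The inertial manifold in the coordinate `x = A^α u` -/

/-- Used to send the start `-L` of a comparison to `-∞`, which removes the contribution of the
distant past. -/
theorem le_of_forall_le_add_exp {a b c γ : ℝ} (hγ : 0 < γ)
    (h : ∀ L, 0 ≤ L → a ≤ b + c * Real.exp (-(γ * L))) : a ≤ b := by
  have h1 : Tendsto (fun L : ℝ => b + c * Real.exp (-(γ * L))) atTop (𝓝 (b + c * 0)) :=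
    ((Real.tendsto_exp_neg_atTop_nhds_zero.comp
      (tendsto_id.const_mul_atTop hγ)).const_mul c).const_add b
  rw [mul_zero, add_zero] at h1
  exact ge_of_tendsto h1 ((eventually_ge_atTop 0).mono h)

namespace PosOperator

variable {X : Type*} [NormedAddCommGroup X] [InnerProductSpace ℝ X] [CompleteSpace X]

/-- A solution that is defined on all of `ℝ`. -/
structure IsEntire (A : PosOperator X) (α : ℝ) (F : X → X) (x : ℝ → X) : Prop where
  continuous : Continuous x
  mild : ∀ a t, a ≤ t → A.IsMild α F x a t

/-- `T` is the solution operator of `x' + A x = A^α F(x)`. -/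
structure IsSemiflow (A : PosOperator X) (α : ℝ) (F : X → X) (T : ℝ → X → X) : Prop where
  zero : ∀ x, T 0 x = x
  continuousOn : ∀ x, ContinuousOn (fun t => T t x) (Ici 0)
  mild : ∀ x t, 0 ≤ t → A.IsMild α F (fun t => T t x) 0 t

variable {A : PosOperator X} {α : ℝ} {F : X → X} {W : Finset ℝ} {C b γ m : ℝ}

theorem IsEntire.comp_add {x : ℝ → X} (hx : A.IsEntire α F x) (c : ℝ) :
    A.IsEntire α F fun t => x (t + c) :=
  ⟨hx.continuous.comp (by fun_prop), fun a t hat => (hx.mild (a + c) (t + c) (by linarith)).comp_add⟩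

theorem IsSemiflow.isEntire {T : ℝ → X → X} (hT : A.IsSemiflow α F T) {ξ : ℝ → X} (hξ : Continuous ξ)
    (hTξ : ∀ r t, 0 ≤ t → T t (ξ r) = ξ (t + r)) : A.IsEntire α F ξ := by
  refine ⟨hξ, fun a t hat => ?_⟩
  have h1 := hT.mild (ξ a) (t - a) (sub_nonneg.2 hat)
  have h2 := h1.congr (sub_nonneg.2 hat) (y := fun s => ξ (s + a)) fun s hs => hTξ a s hs.1
  have h3 : A.IsMild α F (fun s => (fun s => ξ (s + a)) (s + -a)) a t := by
    refine IsMild.comp_add (A := A) (x := fun s => ξ (s + a)) (-a) ?_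
    rwa [add_neg_cancel, ← sub_eq_add_neg]
  simpa using h3

namespace SpectralGap

variable (h : SpectralGap A α F W C b γ m) {T : ℝ → X → X}
include h

/-- The semigroup property is not part of the definition of the solution operator; it follows from
uniqueness after restarting at time `r`. -/
theorem semiflow_add (hT : A.IsSemiflow α F T) {r t : ℝ} (hr : 0 ≤ r) (ht : 0 ≤ t) (x : X) :
    T t (T r x) = T (t + r) x := by
  refine IsMild.unique (A := A) h.hα h.continuous_F h.lip (x := fun t => T t (T r x))
    (y := fun t => T (t + r) x) (a := 0) (t := t) ((hT.continuousOn _).mono Icc_subset_Ici_self)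
    ?_ (fun s hs => hT.mild _ s hs.1) (fun s hs => ?_) ?_ t ⟨ht, le_rfl⟩
  · exact (hT.continuousOn x).comp (by fun_prop) fun s hs => add_nonneg hs.1 hr
  · have h1 : A.IsMild α F (fun t => T t x) (0 + r) (s + r) :=
      (isMild_iff_of_le h.hα h.continuous_F (by linarith) (by linarith [hs.1])
        ((hT.continuousOn x).mono Icc_subset_Ici_self) (hT.mild x _ (by linarith))).1
        (hT.mild x _ (by linarith [hs.1]))
    exact h1.comp_add
  · simp [hT.zero]

theorem norm_flow_compl_le (u : X) : ‖A.flow (W : Set ℝ)ᶜ 0 0 u‖ ≤ ‖u‖ := by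
  refine (ContinuousLinearMap.le_opNorm _ _).trans (mul_le_of_le_one_left (norm_nonneg _) ?_)
  have := norm_flow_zero_le_of_gap (A := A) (γ := 0) (S := (W : Set ℝ)ᶜ) h.m_pos.le
    (fun μ hμ he => h.m_le μ he (mt Finset.mem_coe.2 hμ)) le_rfl
  simpa using this

/-- The solution on `(-∞, 0]` on the inertial manifold whose slow part at time `0` is that
of `v`. -/
noncomputable def backward (v : X) : ℝ → X :=
  (h.exists_backward_solution (v := A.flow W 0 0 v) (by rw [flow_finset_flow, add_zero])).choose

theorem backward_spec (v : X) : Continuous (h.backward v) ∧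
    (∀ a t, a ≤ t → t ≤ 0 → A.IsMild α F (h.backward v) a t) ∧
      A.flow W 0 0 (h.backward v 0) = A.flow W 0 0 v ∧
      ∀ t, ‖A.flow (W : Set ℝ)ᶜ 0 0 (h.backward v t)‖ ≤ C * gapConst α m :=
  (h.exists_backward_solution (v := A.flow W 0 0 v)
    (by rw [flow_finset_flow, add_zero])).choose_spec

/-- The function whose graph is the inertial manifold. -/
noncomputable def inertial (v : X) : X := A.flow (W : Set ℝ)ᶜ 0 0 (h.backward v 0)

theorem flow_add_inertial (v : X) : A.flow W 0 0 v + h.inertial v = h.backward v 0 := by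
  rw [← (h.backward_spec v).2.2.1]
  exact add_flow_compl W _

theorem norm_inertial_le (v : X) : ‖h.inertial v‖ ≤ C * gapConst α m :=
  (h.backward_spec v).2.2.2 0

theorem flow_inertial (v : X) : A.flow W 0 0 (h.inertial v) = 0 :=
  flow_finset_compl (flowBdd_of_nonpos le_rfl le_rfl) _

/-- The two backward solutions have fast parts bounded uniformly in time, so comparing them on `[-L,
0]` with `L → ∞` bounds their distance at time `0` by twice the slow difference. Subtracting the
slow difference gives `3`. In particular `inertial` depends only on the slow part of its argument.
-/
theorem norm_inertial_sub_le (v w : X) :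
    ‖h.inertial v - h.inertial w‖ ≤ 3 * ‖A.flow W 0 0 (v - w)‖ := by
  obtain ⟨c1, m1, q1, r1⟩ := h.backward_spec v
  obtain ⟨c2, m2, q2, r2⟩ := h.backward_spec w
  have key : ‖h.backward v 0 - h.backward w 0‖ ≤ 2 * ‖A.flow W 0 0 (v - w)‖ := by
    refine le_of_forall_le_add_exp (c := 4 * (C * gapConst α m)) h.γ_pos fun L hL => ?_
    have := h.norm_solution_sub_le (L := L) c1.continuousOn c2.continuousOn
      (fun a t _ hat ht => m1 a t hat ht) (fun a t _ hat ht => m2 a t hat ht) 0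
      ⟨by linarith, le_rfl⟩
    rw [map_sub _ (h.backward v 0), q1, q2, ← map_sub, mul_zero, neg_zero, Real.exp_zero,
      mul_one] at this
    have h1 : ‖A.flow (W : Set ℝ)ᶜ 0 0 (h.backward v (-L) - h.backward w (-L))‖ ≤
        2 * (C * gapConst α m) := by
      rw [map_sub]
      exact (norm_sub_le _ _).trans (by linarith [r1 (-L), r2 (-L)])
    have h2 := mul_le_mul_of_nonneg_left h1 (Real.exp_pos (-(γ * L))).le
    linarith
  have e : h.inertial v - h.inertial w =
      (h.backward v 0 - h.backward w 0) - A.flow W 0 0 (v - w) := by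
    rw [← h.flow_add_inertial, ← h.flow_add_inertial, map_sub]
    abel
  rw [e]
  exact (norm_sub_le _ _).trans (by linarith)

/-- Solutions approach the inertial manifold exponentially. -/
theorem norm_sub_inertial_le {x : ℝ → X} {a t : ℝ} (hat : a ≤ t) (hx : ContinuousOn x (Icc a t))
    (hm : ∀ r s, a ≤ r → r ≤ s → s ≤ t → A.IsMild α F x r s) :
    ‖x t - (A.flow W 0 0 (x t) + h.inertial (x t))‖ ≤
      2 * (‖A.flow (W : Set ℝ)ᶜ 0 0 (x a)‖ + C * gapConst α m) * Real.exp (-(γ * (t - a))) := by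
  -- The solution is compared with the one on the manifold that has the same slow part at the final
  -- time `t`. The slow term of the comparison vanishes and only the decaying fast term is left.
  obtain ⟨c1, m1, q1, r1⟩ := h.backward_spec (x t)
  have := h.norm_solution_sub_le (L := t - a) (x := fun s => x (s + t))
    (hx.comp (by fun_prop) fun s hs => ⟨by linarith [hs.1], by linarith [hs.2]⟩) c1.continuousOn
    (fun r s hr hrs hs => (hm (r + t) (s + t) (by linarith) (by linarith) (by linarith)).comp_add)
    (fun r s _ hrs hs => m1 r s hrs hs) 0 ⟨by linarith, le_rfl⟩
  rw [h.flow_add_inertial]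
  rw [zero_add, map_sub _ (x t), q1, sub_self, norm_zero, zero_add, mul_zero, neg_zero,
    Real.exp_zero, mul_one, neg_sub, sub_add_cancel] at this
  have h1 : ‖A.flow (W : Set ℝ)ᶜ 0 0 (x a - h.backward (x t) (a - t))‖ ≤
      ‖A.flow (W : Set ℝ)ᶜ 0 0 (x a)‖ + C * gapConst α m := by
    rw [map_sub]
    exact (norm_sub_le _ _).trans (by linarith [r1 (a - t)])
  have h2 := mul_le_mul_of_nonneg_left h1 (Real.exp_pos (-(γ * (t - a)))).le
  linarith

/-- The attraction estimate started at `t - L` leaves no distance to the graph as `L → ∞`.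
Boundedness of the fast part thus puts an entire solution on the manifold. -/
theorem eq_inertial_of_bdd {x : ℝ → X} (hx : A.IsEntire α F x) {D : ℝ}
    (hD : ∀ t, ‖A.flow (W : Set ℝ)ᶜ 0 0 (x t)‖ ≤ D) (t : ℝ) :
    x t = A.flow W 0 0 (x t) + h.inertial (x t) := by
  rw [← sub_eq_zero, ← norm_le_zero_iff]
  refine le_of_forall_le_add_exp (c := 2 * (D + C * gapConst α m)) h.γ_pos fun L hL => ?_
  have := h.norm_sub_inertial_le (a := t - L) (t := t) (by linarith) hx.continuous.continuousOn
    fun r s _ hrs _ => hx.mild r s hrs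
  rw [sub_sub_cancel] at this
  rw [zero_add]
  refine this.trans ?_
  gcongr
  exact hD _

/-- Backward uniqueness on the inertial manifold. -/
theorem eq_of_eq_zero {x y : ℝ → X} (hx : A.IsEntire α F x) (hy : A.IsEntire α F y) {D : ℝ}
    (hDx : ∀ t, ‖A.flow (W : Set ℝ)ᶜ 0 0 (x t)‖ ≤ D)
    (hDy : ∀ t, ‖A.flow (W : Set ℝ)ᶜ 0 0 (y t)‖ ≤ D) (h0 : x 0 = y 0) {t : ℝ} (ht : t ≤ 0) :
    x t = y t := by
  rw [← sub_eq_zero, ← norm_le_zero_iff]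
  refine le_of_forall_le_add_exp (c := 2 * Real.exp (-(γ * t)) * (2 * D) * Real.exp (γ * -t))
    h.γ_pos fun L hL => ?_
  -- The window starts at `t - L`, a time `L` before `t`, and ends at `0`, where the solutions
  -- coincide.
  have := h.norm_solution_sub_le (L := L + -t) hx.continuous.continuousOn hy.continuous.continuousOn
    (fun r s _ hrs _ => hx.mild r s hrs) (fun r s _ hrs _ => hy.mild r s hrs) t
    ⟨by linarith, ht⟩
  have h1 : ‖A.flow (W : Set ℝ)ᶜ 0 0 (x (-(L + -t)) - y (-(L + -t)))‖ ≤ 2 * D := by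
    rw [map_sub]
    exact (norm_sub_le _ _).trans (by linarith [hDx (-(L + -t)), hDy (-(L + -t))])
  have hD0 : 0 ≤ D := (norm_nonneg _).trans (hDx 0)
  have h2 : Real.exp (-(γ * (L + -t))) ≤ Real.exp (γ * -t) * Real.exp (-(γ * L)) := by
    rw [← Real.exp_add]
    exact Real.exp_le_exp.2 (by nlinarith [h.γ_pos])
  rw [h0, sub_self, map_zero, norm_zero, zero_add] at this
  refine this.trans ?_
  calc _ ≤ 2 * Real.exp (-(γ * t)) * ((Real.exp (γ * -t) * Real.exp (-(γ * L))) * (2 * D)) := by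
        gcongr
    _ = _ := by ring

/-- The backward solution is continued for positive times by the semiflow. Its fast part stays
bounded because `F` is, and `eq_inertial_of_bdd` then places the whole orbit on the graph;
invariance needs no separate argument. -/
theorem exists_entire (hT : A.IsSemiflow α F T) (v : X) :
    ∃ ξ : ℝ → X, Continuous ξ ∧ (∀ r t, 0 ≤ t → T t (ξ r) = ξ (t + r)) ∧
      ξ 0 = A.flow W 0 0 v + h.inertial v ∧
      ∀ t, ξ t = A.flow W 0 0 (ξ t) + h.inertial (ξ t) := by
  obtain ⟨c1, m1, q1, r1⟩ := h.backward_spec v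
  set p := h.backward v
  let ξ : ℝ → X := fun t => if t ≤ 0 then p t else T t (p 0)
  have hξ_neg : ∀ t ≤ 0, ξ t = p t := fun t ht => if_pos ht
  have hξ_pos : ∀ t, 0 ≤ t → ξ t = T t (p 0) := fun t ht => by
    rcases ht.eq_or_lt with rfl | ht
    · rw [hT.zero]; exact if_pos le_rfl
    · exact if_neg (not_le.2 ht)
  have hcont : Continuous ξ := by
    refine continuous_if_le continuous_id continuous_const c1.continuousOn ?_ ?_
    · exact (hT.continuousOn (p 0)).mono fun t ht => ht
    · intro t ht
      have ht : t = 0 := ht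
      rw [ht, hT.zero]
  have hneg : ∀ r t, 0 ≤ t → t + r ≤ 0 → T t (p r) = p (t + r) := fun r t ht htr => by
    refine IsMild.unique (A := A) h.hα h.continuous_F h.lip (x := fun t => T t (p r))
      (y := fun t => p (t + r)) (a := 0) (t := t)
      ((hT.continuousOn _).mono Icc_subset_Ici_self) (by fun_prop)
      (fun s hs => hT.mild _ s hs.1) (fun s hs => ?_) ?_ t ⟨ht, le_rfl⟩
    · exact (m1 (0 + r) (s + r) (by linarith [hs.1]) (by linarith [hs.2])).comp_add
    · simp only [hT.zero, zero_add]
  have hTξ : ∀ r t, 0 ≤ t → T t (ξ r) = ξ (t + r) := fun r t ht => by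
    rcases le_total 0 r with hr | hr
    · rw [hξ_pos r hr, hξ_pos _ (add_nonneg ht hr), h.semiflow_add hT hr ht]
    · rw [hξ_neg r hr]
      rcases le_total (t + r) 0 with htr | htr
      · rw [hξ_neg _ htr, hneg r t ht htr]
      · have e : p 0 = T (-r) (p r) := by
          rw [hneg r (-r) (by linarith) (by linarith), neg_add_cancel]
        rw [hξ_pos _ htr, e, h.semiflow_add hT (by linarith) htr, add_neg_cancel_right]
  have hE := hT.isEntire hcont hTξ
  -- For `t ≥ 0` one copy of the constant bounds the fast part inherited from time `0`, the other
  -- the Duhamel integral.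
  have hD : ∀ t, ‖A.flow (W : Set ℝ)ᶜ 0 0 (ξ t)‖ ≤ 2 * (C * gapConst α m) := fun t => by
    have h0 : 0 ≤ C * gapConst α m := (norm_nonneg _).trans (r1 0)
    rcases le_total t 0 with ht | ht
    · rw [hξ_neg t ht]; linarith [r1 t]
    · rw [(hE.mild 0 t ht).flow_eq h.hα ht (h.continuous_F.comp hcont).continuousOn, sub_zero,
        hξ_neg 0 le_rfl]
      refine (norm_add_le _ _).trans ?_
      have e1 : ‖A.flow (W : Set ℝ)ᶜ 0 t (A.flow (W : Set ℝ)ᶜ 0 0 (p 0))‖ ≤ C * gapConst α m := by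
        refine (ContinuousLinearMap.le_opNorm _ _).trans
          ((mul_le_of_le_one_left (norm_nonneg _) ?_).trans (r1 0))
        have := norm_flow_zero_le_of_gap (A := A) (γ := 0) (S := (W : Set ℝ)ᶜ) h.m_pos.le
          (fun μ hμ he => h.m_le μ he (mt Finset.mem_coe.2 hμ)) ht
        simpa using this
      have e2 := h.norm_integral_fast_le (η := 0) (G := C) (g := fun s => F (ξ s))
        (by linarith [h.m_pos]) h.C_nonneg ht fun s _ _ => by simpa using h.bdd (ξ s)
      rw [zero_mul, neg_zero, Real.exp_zero, mul_one] at e2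
      linarith
  refine ⟨ξ, hcont, hTξ, ?_, h.eq_inertial_of_bdd hE hD⟩
  rw [h.flow_add_inertial, hξ_neg 0 le_rfl]

/-- On the finitely many slow modes the equation is an ordinary one. Near `t` the slow part is the
group at time `r` applied to `w r`, in which `r` is only the upper limit of an integral, and the
product rule applies. -/
theorem hasDerivAt_slow {x : ℝ → X} (hx : A.IsEntire α F x) (t : ℝ) :
    HasDerivAt (fun r => A.flow W 0 0 (x r))
      (A.flow W α 0 (F (x t)) - A.flow W 1 0 (x t)) t := by
  have hg : Continuous fun s => F (x s) := h.continuous_F.comp hx.continuous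
  -- Any starting time before `t` would do.
  set a := t - 1
  set w : ℝ → X := fun r => A.flow W 0 (-a) (A.flow W 0 0 (x a)) +
    ∫ s in a..r, A.flow W α (0 - s) (F (x s)) with hw
  have hgc : Continuous fun s => A.flow W α (0 - s) (F (x s)) :=
    continuous_flow_finset W α hg (by fun_prop)
  have h1 : HasDerivAt w (A.flow W α (0 - t) (F (x t))) t :=
    (intervalIntegral.integral_hasDerivAt_right (hgc.intervalIntegrable _ _)
      (hgc.stronglyMeasurableAtFilter _ _) hgc.continuousAt).const_add _
  have h2 := hasDerivAt_flow (A := A) W 0 h1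
  have e : ∀ r, a ≤ r → A.flow W 0 0 (x r) = A.flow W 0 r (w r) := fun r hr => by
    rw [(hx.mild a r hr).flow_eq h.hα hr hg.continuousOn, hw]
    simp only [map_add]
    rw [flow_finset_integral hg, flow_finset_flow, flow_finset_flow, flow_finset_flow]
    simp only [add_zero, sub_eq_add_neg]
  have h3 : HasDerivAt (fun r => A.flow W 0 0 (x r)) _ t := h2.congr_of_eventuallyEq
    (Filter.eventually_of_mem (Ici_mem_nhds (show a < t by simp [a])) e)
  convert h3 using 1
  rw [flow_finset_flow, zero_add, zero_sub, add_neg_cancel, zero_add]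
  congr 1
  have h4 := congrArg (A.flow W 1 0) (e t (by simp [a]))
  rwa [flow_finset_flow, flow_finset_flow, add_zero, add_zero, zero_add] at h4

end SpectralGap

end PosOperator

/-! ### The isometry `A^α` and the spectral subspaces of `X^α` -/

namespace PosOperator

variable {X : Type*} [NormedAddCommGroup X] [InnerProductSpace ℝ X] [CompleteSpace X]
variable (A : PosOperator X) {α : ℝ}

theorem flow_neg_mem_fracDomain (hα : 0 ≤ α) (x : X) :
    A.flow univ (-α) 0 x ∈ A.fracDomain α := by
  rw [mem_fracDomain_iff]
  refine (A.hasSum_proj x).summable.congr fun μ => ?_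
  by_cases hμ : A.IsEig μ
  · rw [proj_flow (flowBdd_of_nonpos (neg_nonpos.2 hα) le_rfl), flowSymbol_of_mem (mem_univ μ),
      smul_smul, mul_zero, neg_zero, Real.exp_zero, mul_one, ← Real.rpow_add hμ.pos,
      add_neg_cancel, Real.rpow_zero, one_smul]
  · rw [A.proj_of_not_isEig hμ, A.proj_of_not_isEig hμ, smul_zero]

theorem proj_powMap (u : A.Frac α) (μ : ℝ) : A.proj μ (A.powMap u) = μ ^ α • A.proj μ (A.incl u) :=
  A.proj_fracPow α μ u

/-- `A^α` as an isometry of `X^α` onto `X`. -/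
noncomputable def powEquiv (hα : 0 ≤ α) : A.Frac α ≃ₗᵢ[ℝ] X where
  toLinearEquiv := LinearEquiv.ofBijective A.powMap ⟨A.fracPow_injective α, fun x => by
    obtain ⟨u, hu⟩ : ∃ u : A.Frac α, A.incl u = A.flow univ (-α) 0 x :=
      ⟨(⟨_, A.flow_neg_mem_fracDomain hα x⟩ : A.fracDomain α), rfl⟩
    refine ⟨u, A.ext_proj fun μ hμ => ?_⟩
    rw [proj_powMap, hu, proj_flow (flowBdd_of_nonpos (neg_nonpos.2 hα) le_rfl), flowSymbol_of_mem (mem_univ μ),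
      smul_smul, mul_zero, neg_zero, Real.exp_zero, mul_one, ← Real.rpow_add hμ.pos,
      add_neg_cancel, Real.rpow_zero, one_smul]⟩
  norm_map' _ := rfl

variable {A}

theorem flow_neg_powEquiv (hα : 0 ≤ α) (u : A.Frac α) :
    A.flow univ (-α) 0 (A.powEquiv hα u) = A.incl u := by
  refine A.ext_proj fun μ hμ => ?_
  rw [proj_flow (flowBdd_of_nonpos (neg_nonpos.2 hα) le_rfl), flowSymbol_of_mem (mem_univ μ)]
  show _ • A.proj μ (A.powMap u) = _
  rw [proj_powMap, smul_smul, mul_zero, neg_zero, Real.exp_zero, mul_one, ← Real.rpow_add hμ.pos,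
    neg_add_cancel, Real.rpow_zero, one_smul]

theorem incl_powEquiv_symm (hα : 0 ≤ α) (x : X) :
    A.incl ((A.powEquiv hα).symm x) = A.flow univ (-α) 0 x := by
  rw [← flow_neg_powEquiv hα, LinearIsometryEquiv.apply_symm_apply]

theorem incl_injective : Function.Injective (A.incl : A.Frac α → X) := Subtype.val_injective

/-- Identities in the coordinate `x = A^α u` may therefore be checked after applying `A^{-α}`, that
is, in terms of `u`. -/
theorem flow_neg_injective (hα : 0 ≤ α) : Function.Injective (A.flow univ (-α) 0) := by
  intro x y hxy
  rw [← incl_powEquiv_symm hα, ← incl_powEquiv_symm hα] at hxy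
  exact (A.powEquiv hα).symm.injective (incl_injective hxy)

theorem flow_neg_flow (hα : 0 ≤ α) {S : Set ℝ} {β t : ℝ} (h : A.FlowBdd S β t)
    (h' : A.FlowBdd S (-α + β) t) (u : X) :
    A.flow univ (-α) 0 (A.flow S β t u) = A.flow S (-α + β) t u := by
  rw [flow_flow (flowBdd_of_nonpos (neg_nonpos.2 hα) le_rfl) h, univ_inter, zero_add]
  rwa [univ_inter, zero_add]

theorem flow_flow_neg (hα : 0 ≤ α) {S : Set ℝ} {β t : ℝ} (h : A.FlowBdd S β t)
    (h' : A.FlowBdd S (-α + β) t) (u : X) :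
    A.flow S β t (A.flow univ (-α) 0 u) = A.flow S (-α + β) t u := by
  rw [flow_flow h (flowBdd_of_nonpos (neg_nonpos.2 hα) le_rfl), inter_univ, add_zero, add_comm]
  rwa [inter_univ, add_zero, add_comm]

theorem expNeg_eq_flow {t : ℝ} (ht : 0 ≤ t) (u : X) : A.expNeg t u = A.flow univ 0 t u := by
  rw [flow, mult_apply (flowBdd_of_nonpos le_rfl ht)]
  refine tsum_congr fun μ => ?_
  rw [flowSymbol_of_mem (mem_univ μ), Real.rpow_zero, one_mul]

/-- Applying `A^{-α}` to the formula for `x = A^α u` cancels the `A^α` in the kernel and gives back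
the variation of constants formula for `u`. -/
theorem IsSolutionOperator.isSemiflow (hα0 : 0 ≤ α) (hα : α ∈ Ioo (0 : ℝ) 1) {f : A.Frac α → X}
    (hf : Continuous f) {T : ℝ → A.Frac α → A.Frac α} (hT : A.IsSolutionOperator f T) :
    A.IsSemiflow α (fun x => f ((A.powEquiv hα0).symm x))
      (fun t x => A.powEquiv hα0 (T t ((A.powEquiv hα0).symm x))) := by
  set J := A.powEquiv hα0
  have hc : ∀ x, ContinuousOn (fun t => J (T t (J.symm x))) (Ici 0) := fun x =>
    J.continuous.comp_continuousOn (hT (J.symm x)).2.1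
  have h0 : ∀ x, J (T 0 (J.symm x)) = x := fun x => by
    rw [show T 0 (J.symm x) = _ from (hT (J.symm x)).1, LinearIsometryEquiv.apply_symm_apply]
  refine ⟨h0, hc, fun x t ht => ?_⟩
  unfold IsMild
  simp only [LinearIsometryEquiv.symm_apply_apply, sub_zero, h0]
  rcases ht.eq_or_lt with rfl | ht
  -- The definition of a mild solution imposes the formula for `t > 0` only; at `t = 0` it is
  -- trivial.
  · rw [intervalIntegral.integral_same, add_zero, h0, flow_univ_zero_zero]
  refine flow_neg_injective (A := A) hα0 ?_
  have hg : ContinuousOn (fun s => f (T s (J.symm x))) (Icc 0 t) :=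
    hf.comp_continuousOn ((hT (J.symm x)).2.1.mono Icc_subset_Ici_self)
  rw [map_add, flow_neg_powEquiv, (hT (J.symm x)).2.2 t ht,
    ← ContinuousLinearMap.intervalIntegral_comp_comm _ (intervalIntegrable_flow hα ht.le hg)]
  have hb : ∀ r : ℝ, 0 ≤ r → A.FlowBdd univ 0 r := fun r hr => flowBdd_of_nonpos le_rfl hr
  have hb' : ∀ r : ℝ, 0 ≤ r → A.FlowBdd univ (-α + 0) r := fun r hr =>
    flowBdd_of_nonpos (by linarith [hα.1]) hr
  congr 1
  · rw [expNeg_eq_flow ht.le, incl_powEquiv_symm, flow_neg_flow hα.1.le (hb t ht.le) (hb' t ht.le),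
      flow_flow_neg hα.1.le (hb t ht.le) (hb' t ht.le)]
  · refine intervalIntegral.integral_congr_ae ?_
    filter_upwards [Measure.ae_ne volume t] with s hs hst
    rw [uIoc_of_le ht.le] at hst
    have h1 : 0 < t - s := sub_pos.2 (lt_of_le_of_ne hst.2 hs)
    rw [expNeg_eq_flow h1.le, flow_neg_flow hα.1.le (flowBdd_of_pos hα.1.le hα.2.le h1)
      (by rw [neg_add_cancel]; exact hb _ h1.le), neg_add_cancel]

theorem proj_specProj_of_mem {S : Set ℝ} {μ : ℝ} (hμ : μ ∈ S) (u : X) :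
    A.proj μ (A.specProj S u) = A.proj μ u := by
  have : CompleteSpace (A.specSpace S) :=
    (Submodule.isClosed_topologicalClosure _).completeSpace_coe
  have h1 : u - A.specProj S u ∈ (A.specSpace S)ᗮ :=
    Submodule.sub_starProjection_mem_orthogonal (K := A.specSpace S) u
  have h2 : A.eigenspace μ ≤ A.specSpace S :=
    (le_biSup A.eigenspace hμ).trans (Submodule.le_topologicalClosure _)
  have h3 : A.proj μ (u - A.specProj S u) = 0 :=
    (Submodule.starProjection_apply_eq_zero_iff _).2 (Submodule.orthogonal_le h2 h1)
  rw [map_sub, sub_eq_zero] at h3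
  exact h3.symm

theorem proj_specSpace_of_notMem {S : Set ℝ} {μ : ℝ} (hμ : μ ∉ S) {u : X}
    (hu : u ∈ A.specSpace S) : A.proj μ u = 0 := by
  have h1 : (⨆ ν ∈ S, A.eigenspace ν) ≤ LinearMap.ker (A.proj μ).toLinearMap :=
    iSup₂_le fun ν hν x hx => A.proj_of_mem_ne (ne_of_mem_of_not_mem hν hμ) hx
  exact Submodule.topologicalClosure_minimal _ h1 (A.proj μ).isClosed_ker hu

theorem proj_specProj_of_notMem {S : Set ℝ} {μ : ℝ} (hμ : μ ∉ S) (u : X) :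
    A.proj μ (A.specProj S u) = 0 := by
  have : CompleteSpace (A.specSpace S) :=
    (Submodule.isClosed_topologicalClosure _).completeSpace_coe
  exact proj_specSpace_of_notMem hμ (Submodule.starProjection_apply_mem (A.specSpace S) u)

section
variable {S : Set ℝ} {W : Finset ℝ} (hSW : ∀ μ, A.IsEig μ → (μ ∈ S ↔ μ ∈ W))
include hSW

/-- A spectral projection sees only the eigenvalues in its set, so the interval `S` may be replaced
by a finite `W` containing the same eigenvalues. -/
theorem specProj_eq_flow (u : X) : A.specProj S u = A.flow W 0 0 u := by
  refine A.ext_proj fun μ hμ => ?_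
  rw [proj_flow (flowBdd_of_nonpos le_rfl le_rfl)]
  by_cases h : μ ∈ S
  · rw [proj_specProj_of_mem h, flowSymbol_of_mem (Finset.mem_coe.2 ((hSW μ hμ).1 h))]
    simp
  · rw [proj_specProj_of_notMem h,
      flowSymbol_of_notMem (mt Finset.mem_coe.1 (mt (hSW μ hμ).2 h)), zero_smul]

/-- `Q` commutes with the injective operator `A^{-α}`. -/
theorem mem_specY_iff (hα : 0 ≤ α) (v : A.Frac α) :
    v ∈ A.specY α S ↔ A.flow W 0 0 (A.powEquiv hα v) = A.powEquiv hα v := by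
  have h1 : v ∈ A.specY α S ↔ A.incl v - A.specProj S (A.incl v) = 0 := Iff.rfl
  rw [h1, specProj_eq_flow hSW, ← flow_neg_powEquiv hα,
    flow_flow_neg hα flowBdd_finset flowBdd_finset, ← flow_neg_flow hα flowBdd_finset flowBdd_finset,
    sub_eq_zero, eq_comm]
  exact (flow_neg_injective hα).eq_iff

theorem mem_specZ_iff (hα : 0 ≤ α) (v : A.Frac α) :
    v ∈ A.specZ α S ↔ A.flow W 0 0 (A.powEquiv hα v) = 0 := by
  have h1 : v ∈ A.specZ α S ↔ A.specProj S (A.incl v) = 0 := Iff.rfl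
  rw [h1, specProj_eq_flow hSW, ← flow_neg_powEquiv hα,
    flow_flow_neg hα flowBdd_finset flowBdd_finset, ← flow_neg_flow hα flowBdd_finset flowBdd_finset]
  exact (flow_neg_injective hα).eq_iff' (map_zero _)

end

/-- Writing a combination of slow modes as a value of `A⁻¹` shows that it lies in `D(A)` and tells
what `A` does to it. -/
theorem inv_flow (W : Finset ℝ) (β : ℝ) (u : X) :
    A.inv (A.flow W (1 + β) 0 u) = A.flow W β 0 u := by
  refine A.ext_proj fun μ hμ => ?_
  have h1 := A.proj_inv μ (A.flow W (1 + β) 0 u)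
  rw [proj_flow flowBdd_finset] at h1 ⊢
  have h2 : A.proj μ (A.inv (A.flow W (1 + β) 0 u)) =
      μ⁻¹ • flowSymbol W (1 + β) 0 μ • A.proj μ u := by
    rw [← h1, smul_smul, inv_mul_cancel₀ hμ.pos.ne', one_smul]
  rw [h2, smul_smul]
  congr 1
  by_cases h : μ ∈ (W : Set ℝ)
  · rw [flowSymbol_of_mem h, flowSymbol_of_mem h, Real.rpow_add hμ.pos, Real.rpow_one,
      mul_assoc, inv_mul_cancel_left₀ hμ.pos.ne']
  · rw [flowSymbol_of_notMem h, flowSymbol_of_notMem h, mul_zero]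

/-! ### The inertial manifold and the attractor in `X^α` -/

namespace SpectralGap

variable {F : X → X} {W : Finset ℝ} {C b γ m : ℝ}

theorem exists_inertialManifold (hα0 : 0 ≤ α) (hα : α ∈ Ioo (0 : ℝ) 1) {f : A.Frac α → X}
    {T : ℝ → A.Frac α → A.Frac α} (hT : A.IsSolutionOperator f T) {S : Set ℝ}
    (hSW : ∀ μ, A.IsEig μ → (μ ∈ S ↔ μ ∈ W)) (hf : Continuous f)
    (h : SpectralGap A α (fun x => f ((A.powEquiv hα0).symm x)) W C b γ m) :
    ∃ s : A.specY α S → A.specZ α S,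
      (∃ K : ℝ≥0, LipschitzWith K s) ∧ (∀ v, ‖s v‖ ≤ C * gapConst α m) ∧
      IsInvariantManifold T (graphSet s) ∧ IsExponentiallyAttracting T (graphSet s) ∧
      ∀ 𝒜 : Set (A.Frac α), IsGlobalAttractor T 𝒜 →
        𝒜 ⊆ graphSet s ∧
        (∀ u₀ ∈ 𝒜, ∃ ξ, IsGlobalSolution T ξ ∧ ξ 0 = u₀ ∧ ∀ t, ξ t ∈ 𝒜) ∧
        ∀ ξ, IsGlobalSolution T ξ → (∀ t, ξ t ∈ 𝒜) →
          ∃ v : ℝ → A.specY α S, (∀ t, ξ t = (v t : A.Frac α) + (s (v t) : A.Frac α)) ∧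
            A.IsReducedSolution f S s v := by
  set J := A.powEquiv hα0 with hJ
  have hY : ∀ v : A.Frac α, v ∈ A.specY α S ↔ A.flow W 0 0 (J v) = J v :=
    mem_specY_iff hSW hα0
  have hZ : ∀ v : A.Frac α, v ∈ A.specZ α S ↔ A.flow W 0 0 (J v) = 0 :=
    mem_specZ_iff hSW hα0
  have hsf := hT.isSemiflow hα0 hα hf
  have hγ := h.γ_pos
  have hk0 : 0 ≤ C * gapConst α m := mul_nonneg h.C_nonneg h.gapConst_pos.le
  -- `v` and its slow part have zero slow difference, so the Lipschitz bound forces equality.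
  have hinert : ∀ v, h.inertial (A.flow W 0 0 v) = h.inertial v := fun v => by
    have := h.norm_inertial_sub_le (A.flow W 0 0 v) v
    rw [map_sub, flow_finset_flow, add_zero, sub_self, norm_zero, mul_zero] at this
    exact sub_eq_zero.1 (norm_le_zero_iff.1 this)
  let s : A.specY α S → A.specZ α S := fun v =>
    ⟨J.symm (h.inertial (J v)), (hZ _).2 (by
      rw [LinearIsometryEquiv.apply_symm_apply, h.flow_inertial])⟩
  have hs : ∀ v, ((s v : A.specZ α S) : A.Frac α) = J.symm (h.inertial (J v)) := fun v => rfl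
  -- the slow part of a point of `X^α`
  let π : A.Frac α → A.specY α S := fun u => ⟨J.symm (A.flow W 0 0 (J u)), (hY _).2 (by
    rw [LinearIsometryEquiv.apply_symm_apply, flow_finset_flow, add_zero])⟩
  have hπ : ∀ u, ((π u : A.specY α S) : A.Frac α) + (s (π u) : A.Frac α) =
      J.symm (A.flow W 0 0 (J u) + h.inertial (J u)) := fun u => by
    rw [hs, map_add]
    congr 2
    show h.inertial (J (J.symm _)) = _
    rw [LinearIsometryEquiv.apply_symm_apply, hinert]
  have hmem : ∀ u, u ∈ graphSet s ↔ J u = A.flow W 0 0 (J u) + h.inertial (J u) := fun u => by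
    constructor
    · rintro ⟨v, rfl⟩
      have hv := (hY v).1 v.2
      have e1 : A.flow W 0 0 (J ((v : A.Frac α) + (s v : A.Frac α))) = J v := by
        rw [map_add, map_add, hv, (hZ _).1 (s v).2, add_zero]
      rw [e1, ← hinert, e1, map_add, hs, LinearIsometryEquiv.apply_symm_apply]
    · intro hu
      refine ⟨π u, ?_⟩
      rw [hπ, ← hu, LinearIsometryEquiv.symm_apply_apply]
  have hbdd : ∀ u ∈ graphSet s, ‖A.flow (W : Set ℝ)ᶜ 0 0 (J u)‖ ≤ C * gapConst α m := fun u hu => by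
    have e1 := (hmem u).1 hu
    have e2 : A.flow (W : Set ℝ)ᶜ 0 0 (J u) = h.inertial (J u) :=
      add_left_cancel ((add_flow_compl (A := A) W (J u)).trans e1)
    rw [e2]
    exact h.norm_inertial_le _
  have hentire : ∀ ξ, IsGlobalSolution T ξ →
      A.IsEntire α (fun x => f (J.symm x)) fun t => J (ξ t) := fun ξ hξ =>
    hsf.isEntire (J.continuous.comp hξ.1) fun r t ht => by
      show J (T t (J.symm (J (ξ r)))) = J (ξ (t + r))
      rw [LinearIsometryEquiv.symm_apply_apply, hξ.2 r t ht]
  have hinv : IsInvariantManifold T (graphSet s) := by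
    intro u₀ hu₀
    obtain ⟨ξ, hξ, hTξ, h0, hgr⟩ := h.exists_entire hsf (J u₀)
    refine ⟨fun t => J.symm (ξ t), ⟨J.symm.continuous.comp hξ, fun r t ht => ?_⟩, ?_, fun t => ?_⟩
    · show T t (J.symm (ξ r)) = J.symm (ξ (t + r))
      rw [← hTξ r t ht, LinearIsometryEquiv.symm_apply_apply]
    · show J.symm (ξ 0) = u₀
      rw [h0, ← (hmem u₀).1 hu₀, LinearIsometryEquiv.symm_apply_apply]
    · rw [hmem, LinearIsometryEquiv.apply_symm_apply]
      exact hgr t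
  -- The distance to the manifold is estimated by the distance to the point of the graph with the
  -- same slow part.
  have htrack : ∀ u t, 0 ≤ t → ‖J (T t u) - (A.flow W 0 0 (J (T t u)) + h.inertial (J (T t u)))‖ ≤
      2 * (‖u‖ + C * gapConst α m) * Real.exp (-(γ * t)) := fun u t ht => by
    have e1 := hsf.continuousOn (J u)
    have e2 := hsf.mild (J u)
    have e3 := hsf.zero (J u)
    simp only [← hJ, LinearIsometryEquiv.symm_apply_apply] at e1 e2 e3
    have := h.norm_sub_inertial_le (x := fun t => J (T t u)) ht (e1.mono Icc_subset_Ici_self)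
      fun r s hr hrs hst =>
        (isMild_iff_of_le hα h.continuous_F hr hrs (e1.mono Icc_subset_Ici_self) (e2 r hr)).1
          (e2 s (hr.trans hrs))
    rw [sub_zero] at this
    refine this.trans ?_
    simp only [e3]
    gcongr
    exact (h.norm_flow_compl_le _).trans_eq (J.norm_map u)
  refine ⟨s, ⟨3, LipschitzWith.of_dist_le_mul fun v w => ?_⟩, fun v => ?_, hinv,
    ⟨γ, hγ, fun B hB => ?_⟩, fun 𝒜 h𝒜 => ?_⟩
  · rw [Subtype.dist_eq, dist_eq_norm, hs, hs, ← map_sub, J.symm.norm_map]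
    refine (h.norm_inertial_sub_le _ _).trans_eq ?_
    rw [map_sub, (hY v).1 v.2, (hY w).1 w.2, ← map_sub, J.norm_map, Subtype.dist_eq, dist_eq_norm]
    rfl
  · show ‖((s v : A.specZ α S) : A.Frac α)‖ ≤ _
    rw [hs, J.symm.norm_map]
    exact h.norm_inertial_le _
  · obtain ⟨R, hR⟩ := isBounded_iff_forall_norm_le.1 hB
    -- The `1` makes the constant strictly positive; `R` may be negative if `B` is empty.
    refine ⟨2 * (|R| + C * gapConst α m) + 1, by positivity, fun t ht => ?_⟩
    refine iSup₂_le ?_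
    rintro _ ⟨u, hu, rfl⟩
    have hg : J.symm (A.flow W 0 0 (J (T t u)) + h.inertial (J (T t u))) ∈ graphSet s := by
      rw [← hπ]; exact ⟨_, rfl⟩
    refine (Metric.infEDist_le_edist_of_mem hg).trans ?_
    rw [edist_dist]
    refine ENNReal.ofReal_le_ofReal ?_
    rw [dist_eq_norm, ← J.norm_map, map_sub, LinearIsometryEquiv.apply_symm_apply]
    refine (htrack u t ht).trans ?_
    rw [neg_mul]
    gcongr
    linarith [hR u hu, le_abs_self R]
  · obtain ⟨R, hR⟩ := isBounded_iff_forall_norm_le.1 h𝒜.compact.isBounded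
    -- By invariance `u₀` is the state after time `L` of an orbit started in the bounded set `𝒜`,
    -- for every `L`; the tracking estimate then makes its distance to the graph zero.
    have hsub : 𝒜 ⊆ graphSet s := fun u₀ hu₀ => by
      rw [hmem, ← sub_eq_zero, ← norm_le_zero_iff]
      refine le_of_forall_le_add_exp (c := 2 * (R + C * gapConst α m)) hγ fun L hL => ?_
      obtain ⟨a, ha, rfl⟩ : u₀ ∈ T L '' 𝒜 := by rwa [h𝒜.invariant L hL]
      rw [zero_add]
      refine (htrack a L hL).trans ?_
      gcongr
      exact hR a ha
    refine ⟨hsub, fun u₀ hu₀ => ?_, fun ξ hξ hξ𝒜 => ⟨fun t => π (ξ t), fun t => ?_, fun t => ?_⟩⟩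
    · obtain ⟨ξ, hξ, h0, hgr⟩ := hinv u₀ (hsub hu₀)
      refine ⟨ξ, hξ, h0, fun t => ?_⟩
      rcases le_total 0 t with ht | ht
      · rw [← add_zero t, ← hξ.2 0 t ht, h0, ← h𝒜.invariant t ht]
        exact mem_image_of_mem _ hu₀
      -- Backward times: some `a ∈ 𝒜` reaches `u₀` after time `-t`. The orbit on the manifold
      -- through `a`, shifted by `-t`, agrees with `ξ` at time `0`, so backward uniqueness gives `ξ
      -- t = a`.
      · have ht' : 0 ≤ -t := neg_nonneg.2 ht
        obtain ⟨a, ha, hau⟩ : u₀ ∈ T (-t) '' 𝒜 := by rwa [h𝒜.invariant _ ht']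
        obtain ⟨η, hη, h0', hgr'⟩ := hinv a (hsub ha)
        have := h.eq_of_eq_zero (hentire ξ hξ) ((hentire η hη).comp_add (-t))
          (fun r => hbdd _ (hgr r)) (fun r => hbdd _ (hgr' _)) (by
            show J (ξ 0) = J (η (0 + -t))
            rw [h0, zero_add, ← hau, ← add_zero (-t), ← hη.2 0 (-t) ht', h0', add_zero]) ht
        have this : J (ξ t) = J (η (t + -t)) := this
        rw [J.injective this, add_neg_cancel, h0']
        exact ha
    · rw [hπ, ← (hmem _).1 (hsub (hξ𝒜 t)), LinearIsometryEquiv.symm_apply_apply]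
    · have hd := h.hasDerivAt_slow (hentire ξ hξ) t
      have hv : (((π (ξ t) : A.specY α S) : A.Frac α) + (s (π (ξ t)) : A.Frac α)) = ξ t := by
        rw [hπ, ← (hmem _).1 (hsub (hξ𝒜 t)), LinearIsometryEquiv.symm_apply_apply]
      -- The slow part of `ξ t` is `A^{-α} Q J(ξ t)`, so it lies in `D(A)` and `A` maps it to
      -- `A^{1-α} Q J(ξ t)`, the term that appears in the derivative.
      have hop := (A.inv_eq_iff (A.flow W (1 + -α) 0 (J (ξ t)))
        (A.incl ((π (ξ t) : A.specY α S) : A.Frac α))).1 (by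
          rw [inv_flow]
          show _ = A.incl (J.symm (A.flow W 0 0 (J (ξ t))))
          rw [incl_powEquiv_symm, flow_neg_flow hα.1.le flowBdd_finset flowBdd_finset, add_zero])
      obtain ⟨hdom, hop⟩ := hop
      refine ⟨_, J.symm.toContinuousLinearEquiv.hasFDerivAt.comp_hasDerivAt t hd, hdom, ?_⟩
      rw [hop, hv, specProj_eq_flow hSW]
      show A.incl (J.symm _) + _ = _
      rw [incl_powEquiv_symm, map_sub, flow_neg_flow hα.1.le flowBdd_finset flowBdd_finset,
        flow_neg_flow hα.1.le flowBdd_finset flowBdd_finset, neg_add_cancel, add_comm (-α) 1,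
        sub_add_cancel, LinearIsometryEquiv.symm_apply_apply]

end SpectralGap

end PosOperator

/-! ### Eigenvalue bounds and counting for a single operator -/

namespace PosOperator

variable {X : Type*} [NormedAddCommGroup X] [InnerProductSpace ℝ X] [CompleteSpace X]
variable {A : PosOperator X} {α : ℝ}

theorem isEig_of_mem {μ : ℝ} {x : X} (hx : x ∈ A.eigenspace μ) (h0 : x ≠ 0) : A.IsEig μ :=
  (Submodule.ne_bot_iff _).2 ⟨x, hx, h0⟩

theorem flow_of_mem_eigenspace {S : Set ℝ} {β t μ : ℝ} (hμ : μ ∈ S) (h : A.FlowBdd S β t) {x : X}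
    (hx : x ∈ A.eigenspace μ) : A.flow S β t x = (μ ^ β * Real.exp (-(μ * t))) • x := by
  refine A.ext_proj fun ν _ => ?_
  rw [proj_flow h, map_smul]
  by_cases hν : μ = ν
  · rw [← hν, flowSymbol_of_mem hμ]
  · rw [A.proj_of_mem_ne hν hx, smul_zero, smul_zero]

theorem inv_of_mem_eigenspace {μ : ℝ} (hμ : μ ≠ 0) {x : X} (hx : x ∈ A.eigenspace μ) :
    A.inv x = μ⁻¹ • x := by
  have := (A.mem_eigenspace_iff μ x).1 hx
  rw [map_smul] at this
  rw [eq_inv_smul_iff₀ hμ, this]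

theorem incl_invFrac (hα : α ∈ Ioo (0 : ℝ) 1) (u : X) :
    A.incl (A.invFrac hα u) = A.inv u := rfl

theorem powMap_invFrac (hα : α ∈ Ioo (0 : ℝ) 1) (u : X) :
    A.powMap (A.invFrac hα u) = A.flow univ (α - 1) 0 u := by
  refine A.ext_proj fun μ hμ => ?_
  rw [proj_powMap, incl_invFrac, proj_flow (flowBdd_of_nonpos (by linarith [hα.2]) le_rfl),
    flowSymbol_of_mem (mem_univ μ), ← A.proj_inv μ u, smul_smul, mul_zero, neg_zero, Real.exp_zero,
    mul_one, Real.rpow_sub_one hμ.pos.ne', div_mul_cancel₀ _ hμ.pos.ne']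

theorem norm_invFrac (hα : α ∈ Ioo (0 : ℝ) 1) (u : X) :
    ‖A.invFrac hα u‖ = ‖A.flow univ (α - 1) 0 u‖ := by
  rw [← powMap_invFrac hα]; rfl

/-- A bound for `A⁻¹ : X → X^α` bounds the eigenvalues from below. -/
theorem IsEig.rpow_le (hα : α ∈ Ioo (0 : ℝ) 1) {K : ℝ} (hK : ∀ u, ‖A.invFrac hα u‖ ≤ K * ‖u‖)
    {μ : ℝ} (hμ : A.IsEig μ) : μ ^ (α - 1) ≤ K := by
  obtain ⟨x, hx, hx0⟩ := (Submodule.ne_bot_iff _).1 hμ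
  have h1 := hK x
  rw [norm_invFrac, flow_of_mem_eigenspace (mem_univ μ)
    (flowBdd_of_nonpos (by linarith [hα.2]) le_rfl) hx, mul_zero, neg_zero, Real.exp_zero, mul_one,
    norm_smul, Real.norm_eq_abs, abs_of_pos (Real.rpow_pos_of_pos hμ.pos _)] at h1
  exact le_of_mul_le_mul_right h1 (norm_pos_iff.2 hx0)

/-- A bound for `A⁻¹ : X → X^α` bounds the inclusion `X^α ⊂ X`. -/
theorem norm_incl_le (hα : α ∈ Ioo (0 : ℝ) 1) {K : ℝ} (hK0 : 0 ≤ K)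
    (hK : ∀ u, ‖A.invFrac hα u‖ ≤ K * ‖u‖) (u : A.Frac α) :
    ‖A.incl u‖ ≤ K ^ (α / (1 - α)) * ‖u‖ := by
  have h1 : 0 < 1 - α := by linarith [hα.2]
  rw [← flow_neg_powEquiv hα.1.le, ← (A.powEquiv hα.1.le).norm_map u]
  refine (ContinuousLinearMap.le_opNorm _ _).trans ?_
  gcongr
  refine norm_mult_le (by positivity) fun μ hμ => abs_flowSymbol_le hμ.pos (by positivity)
    fun _ => ?_
  -- Raising `μ^{α-1} ≤ K` to the power `α/(1-α)` gives `μ^{-α} ≤ K^{α/(1-α)}`.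
  have h2 := Real.rpow_le_rpow (Real.rpow_nonneg hμ.pos.le _) (hμ.rpow_le hα hK)
    (show 0 ≤ α / (1 - α) from div_nonneg hα.1.le h1.le)
  rw [← Real.rpow_mul hμ.pos.le, show (α - 1) * (α / (1 - α)) = -α by field_simp; ring] at h2
  simpa using h2

/-- There are `N` orthonormal eigenvectors with eigenvalues at most `Λ`. -/
def HasLowModes (A : PosOperator X) (N : ℕ) (Λ : ℝ) : Prop :=
  ∃ e : Fin N → X, Orthonormal ℝ e ∧ ∀ j, ∃ μ ≤ Λ, e j ∈ A.eigenspace μ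

/-- An operator of rank `n` does not approximate `A⁻¹` better than the inverse of the `n+1`st
eigenvalue. -/
theorem HasLowModes.rpow_le (hα : α ∈ Ioo (0 : ℝ) 1) {X₀ : Type*} [NormedAddCommGroup X₀]
    [NormedSpace ℝ X₀] [FiniteDimensional ℝ X₀] {N : ℕ} (hN : Module.finrank ℝ X₀ < N) {Λ : ℝ}
    (hΛ : 0 < Λ) (h : A.HasLowModes N Λ) (M : X →L[ℝ] X₀) (L : X₀ → A.Frac α) (hL : L 0 = 0)
    {τ : ℝ} (hτ : ∀ u, ‖A.invFrac hα u - L (M u)‖ ≤ τ * ‖u‖) : Λ ^ (α - 1) ≤ τ := by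
  obtain ⟨e, he, hμ⟩ := h
  choose μ hμΛ hmem using hμ
  -- More vectors than the dimension of `X₀`: some nonzero combination `u` of the modes is killed by
  -- `M`, so on `u` the error is all of `A⁻¹ u`. As `u` has only components with eigenvalues at most
  -- `Λ`, its norm there is at least `Λ^{α-1} ‖u‖`.
  have hdep : ¬ LinearIndependent ℝ fun j => M (e j) := fun hli => by
    have := hli.fintype_card_le_finrank
    rw [Fintype.card_fin] at this
    omega
  obtain ⟨g, hg, i, hi⟩ := Fintype.not_linearIndependent_iff.1 hdep
  set u := ∑ j, g j • e j with hu
  have hu0 : u ≠ 0 := fun h0 => hi (Fintype.linearIndependent_iff.1 he.linearIndependent g h0 i)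
  have hMu : M u = 0 := by rw [hu, map_sum]; simpa using hg
  have h1 := hτ u
  rw [hMu, hL, sub_zero, norm_invFrac] at h1
  have h2 : Λ ^ (α - 1) * ‖u‖ ≤ ‖A.flow univ (α - 1) 0 u‖ := by
    refine norm_mult_ge (by positivity) (flowBdd_of_nonpos (by linarith [hα.2]) le_rfl) u
      fun ν hν => ?_
    have hνE : A.IsEig ν := isEig_of_mem (A.proj_mem ν u) hν
    have hνΛ : ν ≤ Λ := by
      by_contra hlt
      refine hν ?_
      rw [hu, map_sum]
      refine Finset.sum_eq_zero fun j _ => ?_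
      rw [map_smul, A.proj_of_mem_ne (fun h => hlt (h.symm.trans_le (hμΛ j))) (hmem j), smul_zero]
    rw [flowSymbol_of_mem (mem_univ ν), mul_zero, neg_zero, Real.exp_zero, mul_one,
      abs_of_pos (Real.rpow_pos_of_pos hνE.pos _)]
    exact Real.rpow_le_rpow_of_nonpos hνE.pos hνΛ (by linarith [hα.2])
  exact le_of_mul_le_mul_right (h2.trans h1) (norm_pos_iff.2 hu0)

/-- The bottom of the spectrum consists of the simple eigenvalues `ν 0, …, ν (n - 1)` with unit
eigenvectors `e 0, …, e (n - 1)`. -/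
structure IsLowSpectrum (A : PosOperator X) {n : ℕ} (ν : Fin n → ℝ) (e : Fin n → X) : Prop where
  inj : Function.Injective ν
  mem : ∀ i, e i ∈ A.eigenspace (ν i)
  norm_eq : ∀ i, ‖e i‖ = 1

namespace IsLowSpectrum

variable {n : ℕ} {ν : Fin n → ℝ} {e : Fin n → X} (h : A.IsLowSpectrum ν e)
include h

theorem orthonormal : Orthonormal ℝ e :=
  ⟨h.norm_eq, fun i j hij => A.inner_eq_zero (h.inj.ne hij) (h.mem i) (h.mem j)⟩

theorem isEig (i : Fin n) : A.IsEig (ν i) :=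
  isEig_of_mem (h.mem i) fun h0 => by simpa [h0] using h.norm_eq i

theorem hasLowModes_succ {Λ μ : ℝ} (hν : ∀ i, ν i ≤ Λ) (hμ : μ ≤ Λ) {x : X}
    (hx : x ∈ A.eigenspace μ) (hx0 : x ≠ 0) (horth : ∀ i, ⟪e i, x⟫ = 0) :
    A.HasLowModes (n + 1) Λ := by
  have hxn : ‖x‖ ≠ 0 := norm_ne_zero_iff.2 hx0
  refine ⟨Fin.cons (‖x‖⁻¹ • x) e, ⟨fun i => ?_, fun i j hij => ?_⟩, fun i => ?_⟩
  · refine Fin.cases ?_ (fun i => ?_) i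
    · rw [Fin.cons_zero, norm_smul, norm_inv, norm_norm, inv_mul_cancel₀ hxn]
    · rw [Fin.cons_succ]; exact h.norm_eq i
  · induction i using Fin.cases with
    | zero =>
      induction j using Fin.cases with
      | zero => exact absurd rfl hij
      | succ j =>
        rw [Fin.cons_zero, Fin.cons_succ, real_inner_smul_left, real_inner_comm, horth, mul_zero]
    | succ i =>
      induction j using Fin.cases with
      | zero => rw [Fin.cons_zero, Fin.cons_succ, real_inner_smul_right, horth, mul_zero]
      | succ j =>
        rw [Fin.cons_succ, Fin.cons_succ]
        exact h.orthonormal.2 fun h' => hij (congrArg Fin.succ h')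
  · refine Fin.cases ?_ (fun i => ?_) i
    · exact ⟨μ, hμ, (A.eigenspace μ).smul_mem _ hx⟩
    · exact ⟨ν i, hν i, h.mem i⟩

/-- Any further eigenvalue gives rise to an additional low mode. -/
theorem hasLowModes_of_notMem {Λ μ : ℝ} (hν : ∀ i, ν i ≤ Λ) (hμ : μ ≤ Λ) (hμE : A.IsEig μ)
    (hne : ∀ i, ν i ≠ μ) : A.HasLowModes (n + 1) Λ := by
  obtain ⟨x, hx, hx0⟩ := (Submodule.ne_bot_iff _).1 hμE
  exact h.hasLowModes_succ hν hμ hx hx0 fun i => A.inner_eq_zero (hne i) (h.mem i) hx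

/-- Simplicity by counting: the part of `x` orthogonal to `e i` is orthogonal to every `e j`, and if
nonzero it would be an additional low mode. -/
theorem mem_span {Λ : ℝ} (hν : ∀ i, ν i ≤ Λ) (hΛ : ¬ A.HasLowModes (n + 1) Λ) {i : Fin n} {x : X}
    (hx : x ∈ A.eigenspace (ν i)) : x ∈ Submodule.span ℝ (range e) := by
  have hy : x - ⟪e i, x⟫ • e i ∈ A.eigenspace (ν i) :=
    (A.eigenspace _).sub_mem hx ((A.eigenspace _).smul_mem _ (h.mem i))
  have h0 : x - ⟪e i, x⟫ • e i = 0 := by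
    by_contra hne
    refine hΛ (h.hasLowModes_succ hν (hν i) hy hne fun j => ?_)
    by_cases hij : j = i
    · rw [hij, inner_sub_right, real_inner_smul_right, real_inner_self_eq_norm_sq, h.norm_eq]
      ring
    · exact A.inner_eq_zero (h.inj.ne hij) (h.mem j) hy
  rw [sub_eq_zero.1 h0]
  exact Submodule.smul_mem _ _ (Submodule.subset_span ⟨i, rfl⟩)

theorem finrank_specY (hα : 0 ≤ α) {Λ : ℝ} (hν : ∀ i, ν i ≤ Λ) (hΛ : ¬ A.HasLowModes (n + 1) Λ)
    {S : Set ℝ} (hS : ∀ μ, A.IsEig μ → (μ ∈ S ↔ μ ∈ Finset.univ.image ν)) :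
    Module.finrank ℝ (A.specY α S) = n := by
  have hmap : (A.specY α S).map A.incl = Submodule.span ℝ (range e) := by
    refine le_antisymm ?_ (Submodule.span_le.2 ?_)
    · rintro _ ⟨v, hv, rfl⟩
      have h1 : A.incl v - A.specProj S (A.incl v) = 0 := hv
      rw [specProj_eq_flow hS, flow_finset, sub_eq_zero] at h1
      rw [h1]
      refine Submodule.sum_mem _ fun μ hμ => Submodule.smul_mem _ _ ?_
      obtain ⟨i, -, rfl⟩ := Finset.mem_image.1 hμ
      exact h.mem_span hν hΛ (A.proj_mem _ _)
    · rintro _ ⟨i, rfl⟩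
      have hpos := (h.isEig i).pos
      have hi : A.incl ((A.powEquiv hα).symm (ν i ^ α • e i)) = e i := by
        rw [incl_powEquiv_symm, map_smul, flow_of_mem_eigenspace (mem_univ (ν i))
          (flowBdd_of_nonpos (neg_nonpos.2 hα) le_rfl) (h.mem i), smul_smul, mul_zero, neg_zero,
          Real.exp_zero, mul_one, ← Real.rpow_add hpos, add_neg_cancel, Real.rpow_zero, one_smul]
      refine ⟨_, ?_, hi⟩
      show A.incl _ - A.specProj S (A.incl _) = 0
      rw [hi, specProj_eq_flow hS, flow_of_mem_eigenspace
        (Finset.mem_coe.2 (Finset.mem_image_of_mem ν (Finset.mem_univ i)))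
        (flowBdd_of_nonpos le_rfl le_rfl) (h.mem i)]
      simp
  rw [(Submodule.equivMapOfInjective A.incl incl_injective (A.specY α S)).finrank_eq, hmap,
    finrank_span_eq_card h.orthonormal.linearIndependent, Fintype.card_fin]

end IsLowSpectrum

/-- An approximate eigenvector yields an eigenvalue. -/
theorem exists_isEig_of_norm_sub_le (hα : α ∈ Ioo (0 : ℝ) 1) {lam η : ℝ} (hlam : 0 < lam)
    (hη : 0 < η) {w : A.Frac α}
    (hw : ‖A.invFrac hα (A.incl w) - lam⁻¹ • w‖ < η / (lam * (lam + η)) * ‖w‖) :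
    ∃ μ, A.IsEig μ ∧ |μ - lam| < η := by
  by_contra! hcon
  have hc : A.MBdd fun μ => μ⁻¹ - lam⁻¹ := by
    refine MBdd.sub ⟨‖A.inv‖, fun μ hμ => ?_⟩ ⟨|lam⁻¹|, fun _ _ => le_rfl⟩
    rw [abs_of_pos (inv_pos.2 hμ.pos), inv_le_iff_one_le_mul₀ hμ.pos]
    exact hμ.one_le
  have h1 : A.powMap (A.invFrac hα (A.incl w) - lam⁻¹ • w) =
      A.mult (fun μ => μ⁻¹ - lam⁻¹) (A.powMap w) := by
    refine A.ext_proj fun μ hμ => ?_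
    have e1 := A.proj_inv μ (A.incl w)
    rw [proj_mult hc, proj_powMap, proj_powMap, map_sub, map_sub, map_smul, map_smul,
      incl_invFrac, ← e1]
    have := hμ.pos
    match_scalars
    field_simp
  -- The constant is `lam⁻¹ - (lam + η)⁻¹`, the least value of `|μ⁻¹ - lam⁻¹|` over `μ > 0` with `|μ
  -- - lam| ≥ η`.
  have h2 : η / (lam * (lam + η)) * ‖A.powMap w‖ ≤
      ‖A.mult (fun μ => μ⁻¹ - lam⁻¹) (A.powMap w)‖ := by
    refine norm_mult_ge (by positivity) hc _ fun μ hμ => ?_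
    have hμE : A.IsEig μ := isEig_of_mem (A.proj_mem μ _) hμ
    have hμ0 := hμE.pos
    have h3 : |μ⁻¹ - lam⁻¹| = |μ - lam| / (μ * lam) := by
      rw [inv_sub_inv hμ0.ne' hlam.ne', abs_div, abs_sub_comm, abs_of_pos (mul_pos hμ0 hlam)]
    rw [h3, div_le_div_iff₀ (by positivity) (by positivity)]
    have h4 := hcon μ hμE
    have h5 : η * μ ≤ |μ - lam| * (lam + η) := by
      nlinarith [mul_le_mul_of_nonneg_left (le_abs_self (μ - lam)) hη.le]
    nlinarith
  rw [← h1] at h2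
  exact absurd hw (not_lt.2 h2)

end PosOperator

/-! ### Spectral convergence as `ε → 0` -/

theorem exists_pos_of_eventually_toZero {ε₀ : ℝ} {p : Ioc (0 : ℝ) ε₀ → Prop}
    (h : ∀ᶠ ε in toZero ε₀, p ε) : ∃ ε₁ : ℝ, 0 < ε₁ ∧ ∀ ε : Ioc (0 : ℝ) ε₀, (ε : ℝ) ≤ ε₁ → p ε := by
  obtain ⟨t, ht, hp⟩ := mem_comap.1 h
  obtain ⟨r, hr, hrt⟩ := Metric.mem_nhds_iff.1 ht
  refine ⟨r / 2, half_pos hr, fun ε hε => hp (hrt ?_)⟩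
  rw [Metric.mem_ball, Real.dist_eq, sub_zero, abs_of_pos ε.2.1]
  linarith

theorem exists_subseq_of_relativelyCompact {ε₀ : ℝ} {X₀ : Type*} [NormedAddCommGroup X₀]
    [NormedSpace ℝ X₀] {V : Ioc (0 : ℝ) ε₀ → Type*} [∀ ε, NormedAddCommGroup (V ε)]
    [∀ ε, NormedSpace ℝ (V ε)] {E : ∀ ε, X₀ →L[ℝ] V ε} {ι : Type*} {w : ι → ∀ ε, V ε}
    (hw : ∀ i, ERelativelyCompact E (w i)) {e : ℕ → Ioc (0 : ℝ) ε₀}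
    (he : Tendsto e atTop (toZero ε₀)) (s : Finset ι) :
    ∃ φ : ℕ → ℕ, StrictMono φ ∧ ∀ i ∈ s, ∃ y : X₀,
      Tendsto (fun k => ‖w i (e (φ k)) - E (e (φ k)) y‖) atTop (𝓝 0) := by
  classical
  induction s using Finset.induction_on with
  | empty => exact ⟨id, strictMono_id, by simp⟩
  | insert i s _ ih =>
    obtain ⟨φ, hφ, h⟩ := ih
    obtain ⟨ψ, hψ, y, hy⟩ := hw i (e ∘ φ) (he.comp hφ.tendsto_atTop)
    refine ⟨φ ∘ ψ, hφ.comp hψ, fun j hj => ?_⟩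
    rcases Finset.mem_insert.1 hj with rfl | hj
    · exact ⟨y, hy⟩
    · obtain ⟨z, hz⟩ := h j hj
      exact ⟨z, hz.comp hψ.tendsto_atTop⟩

/-- In finite dimension every operator is compact, and the Fredholm alternative applies to nonzero
spectral values. -/
theorem exists_eigenvector_of_mem_spectrum {X₀ : Type*} [NormedAddCommGroup X₀]
    [NormedSpace ℝ X₀] [FiniteDimensional ℝ X₀] {A : X₀ →L[ℝ] X₀} {l : ℝ} (hl : l ≠ 0)
    (h : l ∈ spectrum ℝ A) : ∃ x, x ≠ 0 ∧ A x = l • x := by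
  have : ProperSpace X₀ := FiniteDimensional.proper ℝ X₀
  have hc : IsCompactOperator A := ⟨Metric.closedBall 0 1, isCompact_closedBall 0 1,
    A.continuous.continuousAt.preimage_mem_nhds
      (by rw [map_zero]; exact Metric.closedBall_mem_nhds 0 one_pos)⟩
  obtain ⟨x, hx, hx0⟩ := ((hc.hasEigenvalue_iff_mem_spectrum hl).2 h).exists_hasEigenvector
  exact ⟨x, hx0, Module.End.mem_eigenspace_iff.1 hx⟩

namespace PosOperator

section Convergence

variable {ε₀ α : ℝ} {X₀ : Type*} [NormedAddCommGroup X₀] [InnerProductSpace ℝ X₀]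
  {X : Ioc (0 : ℝ) ε₀ → Type*} [∀ ε, NormedAddCommGroup (X ε)]
  [∀ ε, InnerProductSpace ℝ (X ε)] [∀ ε, CompleteSpace (X ε)]
  {A : ∀ ε, PosOperator (X ε)} {E : ∀ ε, X₀ →L[ℝ] (A ε).Frac α}

/-- E-convergence is measured in `X^α`, while orthogonality of eigenvectors is used in `X`; the
uniform embedding constant `B` carries limits of norms over. -/
theorem tendsto_norm_incl {B : ℝ} (hB : ∀ ε (u : (A ε).Frac α), ‖(A ε).incl u‖ ≤ B * ‖u‖)
    (hE_norm : ∀ x, Tendsto (fun ε => ‖(A ε).incl (E ε x)‖) (toZero ε₀) (𝓝 ‖x‖))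
    {e : ℕ → Ioc (0 : ℝ) ε₀} (he : Tendsto e atTop (toZero ε₀)) {w : ∀ k, (A (e k)).Frac α} {y : X₀}
    (hw : Tendsto (fun k => ‖w k - E (e k) y‖) atTop (𝓝 0)) :
    Tendsto (fun k => ‖(A (e k)).incl (w k)‖) atTop (𝓝 ‖y‖) := by
  have h1 := (hE_norm y).comp he
  have h2 : Tendsto (fun k => ‖(A (e k)).incl (w k)‖ - ‖(A (e k)).incl (E (e k) y)‖) atTop
      (𝓝 0) := by
    refine squeeze_zero_norm (fun k => ?_) (by simpa using hw.const_mul B)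
    rw [Real.norm_eq_abs]
    refine (abs_norm_sub_norm_le _ _).trans ?_
    rw [← map_sub]
    exact hB _ _
  have := h2.add h1
  simpa using this

/-- The operators `A ε` have at most `dim X₀` eigenvalues in a bounded set, as `ε → 0`. -/
theorem eventually_not_hasLowModes [FiniteDimensional ℝ X₀] (hα : α ∈ Ioo (0 : ℝ) 1) {B : ℝ}
    (hB : ∀ ε (u : (A ε).Frac α), ‖(A ε).incl u‖ ≤ B * ‖u‖)
    (hE_norm : ∀ x, Tendsto (fun ε => ‖(A ε).incl (E ε x)‖) (toZero ε₀) (𝓝 ‖x‖))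
    (hne : ∀ ε, ∃ u : (A ε).Frac α, ‖u‖ = 1)
    (hK : ∀ u : ∀ ε, (A ε).Frac α, (∀ ε, ‖u ε‖ = 1) →
      ERelativelyCompact E fun ε => (A ε).invFrac hα ((A ε).incl (u ε)))
    {N : ℕ} (hN : Module.finrank ℝ X₀ < N) (Λ : ℝ) :
    ∀ᶠ ε in toZero ε₀, ¬ (A ε).HasLowModes N Λ := by
  by_contra hcon
  have hfreq : ∃ᶠ ε in toZero ε₀, (A ε).HasLowModes N Λ := hcon
  have : (toZero ε₀).IsCountablyGenerated := by unfold toZero; infer_instance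
  obtain ⟨e, he, hlow⟩ := exists_seq_forall_of_frequently hfreq
  have hα0 : 0 ≤ α := hα.1.le
  -- Compactness is assumed for families of unit vectors over all `ε`. The vectors are `A^{-α} v_j`
  -- where low modes `v_j` exist, and an arbitrary unit vector elsewhere.
  have hu : ∀ ε, ∃ u : Fin N → (A ε).Frac α, (∀ j, ‖u j‖ = 1) ∧ ((A ε).HasLowModes N Λ →
      ∃ v : Fin N → X ε, Orthonormal ℝ v ∧ (∀ j, ∃ μ ≤ Λ, v j ∈ (A ε).eigenspace μ) ∧
        ∀ j, u j = ((A ε).powEquiv hα0).symm (v j)) := fun ε => by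
    by_cases h : (A ε).HasLowModes N Λ
    · obtain ⟨v, hv, hμ⟩ := h
      exact ⟨fun j => ((A ε).powEquiv hα0).symm (v j),
        fun j => by rw [LinearIsometryEquiv.norm_map, hv.1], fun _ => ⟨v, hv, hμ, fun j => rfl⟩⟩
    · obtain ⟨u, hu⟩ := hne ε
      exact ⟨fun _ => u, fun _ => hu, fun h' => absurd h' h⟩
  choose u hu1 hu2 using hu
  obtain ⟨φ, hφ, hlim⟩ := exists_subseq_of_relativelyCompact
    (w := fun j ε => (A ε).invFrac hα ((A ε).incl (u ε j)))
    (fun j => hK (fun ε => u ε j) fun ε => hu1 ε j) he Finset.univ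
  have heφ := he.comp hφ.tendsto_atTop
  choose y hy using fun j => hlim j (Finset.mem_univ j)
  -- The images are `A⁻¹ A^{-α} v_j = μ_j^{-1-α} v_j`: still orthogonal, and of length at least
  -- `Λ^{-1-α}`, so they cannot vanish in the limit.
  have hrep : ∀ k, ∃ (v : Fin N → X (e (φ k))) (c : Fin N → ℝ), Orthonormal ℝ v ∧
      ∀ j, Λ ^ (-1 - α) ≤ c j ∧ 0 < Λ ∧
        (A (e (φ k))).incl ((A (e (φ k))).invFrac hα ((A (e (φ k))).incl (u (e (φ k)) j))) =
          c j • v j := fun k => by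
    obtain ⟨v, hv, hμ, huv⟩ := hu2 _ (hlow (φ k))
    choose μ hμΛ hmem using hμ
    refine ⟨v, fun j => μ j ^ (-1 - α), hv, fun j => ?_⟩
    have hpos : 0 < μ j := (isEig_of_mem (hmem j) fun h0 => by simpa [h0] using hv.1 j).pos
    refine ⟨Real.rpow_le_rpow_of_nonpos hpos (hμΛ j) (by linarith), hpos.trans_le (hμΛ j), ?_⟩
    show _ = μ j ^ (-1 - α) • v j
    rw [incl_invFrac, huv, incl_powEquiv_symm, flow_of_mem_eigenspace (mem_univ (μ j))
      (flowBdd_of_nonpos (neg_nonpos.2 hα0) le_rfl) (hmem j), map_smul,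
      inv_of_mem_eigenspace hpos.ne' (hmem j), smul_smul, mul_zero, neg_zero, Real.exp_zero,
      mul_one, sub_eq_add_neg, Real.rpow_add hpos, Real.rpow_neg_one, mul_comm]
  choose v c hv hc using hrep
  have hnorm : ∀ j, Tendsto (fun k => ‖c k j • v k j‖) atTop (𝓝 ‖y j‖) := fun j => by
    have := tendsto_norm_incl hB hE_norm heφ (hy j)
    refine this.congr fun k => ?_
    simp only [Function.comp_apply]
    rw [(hc k j).2.2]
  -- Only norms are known to converge; the norms of sums recover inner products, so the limits `y j`
  -- are orthogonal by Pythagoras.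
  have hnorm2 : ∀ i j, Tendsto (fun k => ‖c k i • v k i + c k j • v k j‖) atTop
      (𝓝 ‖y i + y j‖) := fun i j => by
    have h1 : Tendsto (fun k =>
        ‖((A (e (φ k))).invFrac hα ((A (e (φ k))).incl (u (e (φ k)) i)) +
          (A (e (φ k))).invFrac hα ((A (e (φ k))).incl (u (e (φ k)) j))) -
          E (e (φ k)) (y i + y j)‖) atTop (𝓝 0) := by
      refine squeeze_zero (fun _ => norm_nonneg _) (fun k => ?_) (by simpa using (hy i).add (hy j))
      rw [map_add, add_sub_add_comm]
      exact norm_add_le _ _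
    have := tendsto_norm_incl hB hE_norm heφ h1
    refine this.congr fun k => ?_
    simp only [Function.comp_apply]
    rw [map_add, (hc k i).2.2, (hc k j).2.2]
  have hy0 : ∀ j, y j ≠ 0 := fun j h0 => by
    have hΛ : 0 < Λ := (hc 0 j).2.1
    have h1 : Λ ^ (-1 - α) ≤ ‖y j‖ := by
      refine ge_of_tendsto' (hnorm j) fun k => ?_
      rw [norm_smul, (hv k).1, mul_one]
      exact (hc k j).1.trans (le_abs_self _)
    rw [h0, norm_zero] at h1
    exact absurd (Real.rpow_pos_of_pos hΛ (-1 - α)) (not_lt.2 h1)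
  have horth : Pairwise fun i j => ⟪y i, y j⟫ = 0 := fun i j hij => by
    have h1 : Tendsto (fun k => ‖c k i • v k i + c k j • v k j‖ ^ 2) atTop
        (𝓝 (‖y i‖ ^ 2 + ‖y j‖ ^ 2)) := by
      refine (((hnorm i).pow 2).add ((hnorm j).pow 2)).congr fun k => ?_
      rw [norm_add_sq_real, real_inner_smul_left, real_inner_smul_right, (hv k).2 hij]
      ring
    have h2 := tendsto_nhds_unique h1 ((hnorm2 i j).pow 2)
    rw [norm_add_sq_real] at h2
    linarith
  have := (linearIndependent_of_ne_zero_of_inner_eq_zero (𝕜 := ℝ) hy0 horth).fintype_card_le_finrank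
  rw [Fintype.card_fin] at this
  omega

/-- Every eigenvalue of the limit operator is a limit of eigenvalues of `A ε`. -/
theorem eventually_exists_isEig (hα : α ∈ Ioo (0 : ℝ) 1) {A₀ : X₀ ≃L[ℝ] X₀} {C : ℝ}
    (hK : ∀ (u : ∀ ε, (A ε).Frac α) (u₀ : X₀), EConverges E u u₀ →
      EConverges E (fun ε => (A ε).invFrac hα ((A ε).incl (u ε))) (A₀.symm u₀))
    (hE : ∀ ε x, ‖x‖ ≤ C * ‖E ε x‖) {lam η : ℝ} (hlam : 0 < lam) (hη : 0 < η) {x : X₀}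
    (hx0 : x ≠ 0) (hx : A₀ x = lam • x) :
    ∀ᶠ ε in toZero ε₀, ∃ μ, (A ε).IsEig μ ∧ |μ - lam| < η := by
  have h1 : EConverges E (fun ε => E ε x) x := by
    unfold EConverges
    simp only [sub_self, norm_zero]
    exact tendsto_const_nhds
  have h2 := hK _ _ h1
  have h3 : A₀.symm x = lam⁻¹ • x := by
    rw [ContinuousLinearEquiv.symm_apply_eq, map_smul, hx, smul_smul, inv_mul_cancel₀ hlam.ne',
      one_smul]
  have hxn : 0 < ‖x‖ := norm_pos_iff.2 hx0
  unfold EConverges at h2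
  rw [h3] at h2
  -- Since `‖x‖ ≤ C ‖E ε x‖`, the last factor is a lower bound for `‖E ε x‖` independent of `ε`;
  -- `|C| + 1` is certainly positive.
  have h4 : 0 < η / (lam * (lam + η)) * (‖x‖ / (|C| + 1)) := by positivity
  filter_upwards [h2.eventually_lt_const h4] with ε hε
  refine exists_isEig_of_norm_sub_le hα hlam hη (w := E ε x) ?_
  rw [map_smul] at hε
  refine hε.trans_le ?_
  gcongr
  rw [div_le_iff₀ (by positivity)]
  have := hE ε x
  nlinarith [le_abs_self C, norm_nonneg (E ε x)]

end Convergence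

end PosOperator

/-! ### Choice of the constants and the theorem -/

/-- With windows of radius `η` that are disjoint, the eigenvalues of `A_ε` found near different `lam
i` are different. -/
theorem exists_pos_separation (lam : ℕ → ℝ) (n : ℕ) (hlam : StrictMonoOn lam (Icc 1 n)) {δ : ℝ}
    (hδ : 0 < δ) : ∃ η : ℝ, 0 < η ∧ η ≤ δ ∧ ∀ i ∈ Finset.Icc 1 n, ∀ j ∈ Finset.Icc 1 n, i ≠ j →
      2 * η < |lam i - lam j| := by
  have h1 : ∀ᶠ η : ℝ in 𝓝[>] 0, ∀ i ∈ Finset.Icc 1 n, ∀ j ∈ Finset.Icc 1 n, i ≠ j →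
      2 * η < |lam i - lam j| := by
    refine (eventually_all_finset _).2 fun i hi => (eventually_all_finset _).2 fun j hj => ?_
    by_cases hij : i = j
    · exact Eventually.of_forall fun η h => absurd hij h
    · have h2 : 0 < |lam i - lam j| := abs_pos.2 (sub_ne_zero.2
        fun h => hij (hlam.injOn (Finset.mem_Icc.1 hi) (Finset.mem_Icc.1 hj) h))
      have h3 : Tendsto (fun η : ℝ => 2 * η) (𝓝[>] 0) (𝓝 (2 * 0)) :=
        tendsto_nhdsWithin_of_tendsto_nhds (tendsto_id.const_mul 2)
      rw [mul_zero] at h3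
      exact (h3.eventually_lt_const h2).mono fun η h _ => h
  obtain ⟨η, h, hη, hηδ⟩ := (h1.and (Ioc_mem_nhdsGT hδ)).exists
  exact ⟨η, hη, hηδ, h⟩

theorem exists_gapConst_le {α C : ℝ} (hα : α ∈ Ioo (0 : ℝ) 1) (R : ℝ) :
    ∃ m : ℝ, 0 < m ∧ R ≤ m ∧ C * PosOperator.gapConst α m ≤ 1 / 4 := by
  have h1 : Tendsto (fun m : ℝ => C * (4 * Real.Gamma (1 - α) * m ^ (-(1 - α)))) atTop
      (𝓝 (C * (4 * Real.Gamma (1 - α) * 0))) :=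
    ((tendsto_rpow_neg_atTop (by linarith [hα.2])).const_mul _).const_mul _
  rw [mul_zero, mul_zero] at h1
  obtain ⟨m, h2, h3, h4⟩ := ((h1.eventually_le_const (show (0 : ℝ) < 1 / 4 by norm_num)).and
    ((eventually_gt_atTop 0).and (eventually_ge_atTop R))).exists
  rw [neg_sub] at h2
  exact ⟨m, h3, h4, h2⟩

theorem mainTheorem2
    {ε₀ : ℝ} (hε₀ : 0 < ε₀) {α : ℝ} (hα : α ∈ Ioo (0 : ℝ) 1)
    -- the limit problem `u' + A₀ u = f₀(u)` in `X₀`, `dim X₀ = n`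
    {X₀ : Type*} [NormedAddCommGroup X₀] [InnerProductSpace ℝ X₀] [FiniteDimensional ℝ X₀]
    (n : ℕ) (hn : 1 ≤ n) (hdim : Module.finrank ℝ X₀ = n)
    (A₀ : X₀ ≃L[ℝ] X₀) (lam : ℕ → ℝ)
    (hspec : spectrum ℝ (A₀ : X₀ →L[ℝ] X₀) = lam '' Icc 1 n)
    (hlam : StrictMonoOn lam (Icc 1 n)) (hlam_pos : 0 < lam 1)
    (f₀ : X₀ → X₀) (hf₀ : ContDiff ℝ 1 f₀)
    -- the perturbed problems `u' + A_ε u = f_ε(u)` in `X_ε^α`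
    {X : Ioc (0 : ℝ) ε₀ → Type*} [∀ ε, NormedAddCommGroup (X ε)]
    [∀ ε, InnerProductSpace ℝ (X ε)] [∀ ε, CompleteSpace (X ε)]
    (A : ∀ ε, PosOperator (X ε))
    (f : ∀ ε, (A ε).Frac α → X ε) (hf : ∀ ε, ContDiff ℝ 1 (f ε))
    (C : ℝ)
    (hf_bdd : ∀ ε u, ‖f ε u‖ ≤ C)
    (hf_lip : ∀ ε u v, ‖f ε u - f ε v‖ ≤ C * ‖u - v‖)
    (T : ∀ ε, ℝ → (A ε).Frac α → (A ε).Frac α)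
    (hT : ∀ ε, (A ε).IsSolutionOperator (f ε) (T ε))
    -- the operators connecting `X₀` with `X_ε` and `X_ε^α`
    (E : ∀ ε, X₀ →L[ℝ] (A ε).Frac α) (M : ∀ ε, X ε →L[ℝ] X₀)
    (hME : ∀ ε x, M ε ((A ε).incl (E ε x)) = x)
    (hE_norm : ∀ x, Tendsto (fun ε => ‖(A ε).incl (E ε x)‖) (toZero ε₀) (𝓝 ‖x‖))
    (hE : ∀ ε x, ‖(A ε).incl (E ε x)‖ ≤ C * ‖x‖)
    (hE_frac : ∀ ε x, ‖E ε x‖ ≤ C * ‖x‖)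
    (hM : ∀ ε u, ‖M ε u‖ ≤ C * ‖u‖)
    (hM_frac : ∀ ε (u : (A ε).Frac α), ‖M ε ((A ε).incl u)‖ ≤ C * ‖u‖)
    -- compact convergence of `A_ε⁻¹` to `A₀⁻¹`, and the rates `τ` and `ρ`
    (hCC : CompactlyConverges E (fun ε u => (A ε).invFrac hα ((A ε).incl u)) A₀.symm)
    (τ ρ : ℝ → ℝ) (hτ_zero : τ 0 = 0) (hρ_zero : ρ 0 = 0)
    (hτ_mono : MonotoneOn τ (Icc 0 ε₀)) (hρ_mono : MonotoneOn ρ (Icc 0 ε₀))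
    (hτ_pos : ∀ ε ∈ Ioc 0 ε₀, 0 < τ ε) (hρ_pos : ∀ ε ∈ Ioc 0 ε₀, 0 < ρ ε)
    (hτ : ∀ ε (u : X ε), ‖(A ε).invFrac hα u - E ε (A₀.symm (M ε u))‖ ≤ τ ε * ‖u‖)
    (hρ : ∀ ε (u : (A ε).Frac α) (x : X₀),
      ‖f ε u - (A ε).incl (E ε (f₀ x))‖ ≤ C * ‖u - E ε x‖ + ρ ε)
    -- the width of the spectral window around the spectrum of `A₀`
    (δ : ℝ) (hδ : 0 < δ) :
    ∃ C' : ℝ, 0 < C' ∧ ∃ ε₁ : ℝ, 0 < ε₁ ∧ ∀ ε : Ioc (0 : ℝ) ε₀, (ε : ℝ) ≤ ε₁ →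
      -- `Y_ε` is spanned by the eigenvectors of the `n` lowest eigenvalues
      Module.finrank ℝ ((A ε).specY α (Ioo (lam 1 - δ) (lam n + δ))) = n ∧
      (∀ μ : ℝ, (A ε).eigenspace μ ≠ ⊥ →
        μ ∈ Ioo (lam 1 - δ) (lam n + δ) ∨ lam n + δ < μ) ∧
      ∃ s : (A ε).specY α (Ioo (lam 1 - δ) (lam n + δ)) →
          (A ε).specZ α (Ioo (lam 1 - δ) (lam n + δ)),
        (∃ K : ℝ≥0, LipschitzWith K s) ∧
        (∀ v, ‖s v‖ ≤ C' * (τ ε + ρ ε)) ∧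
        IsInvariantManifold (T ε) (graphSet s) ∧
        IsExponentiallyAttracting (T ε) (graphSet s) ∧
        ∀ 𝒜 : Set ((A ε).Frac α), IsGlobalAttractor (T ε) 𝒜 →
          𝒜 ⊆ graphSet s ∧
          (∀ u₀ ∈ 𝒜, ∃ ξ, IsGlobalSolution (T ε) ξ ∧ ξ 0 = u₀ ∧ ∀ t, ξ t ∈ 𝒜) ∧
          ∀ ξ, IsGlobalSolution (T ε) ξ → (∀ t, ξ t ∈ 𝒜) →
            ∃ v : ℝ → (A ε).specY α (Ioo (lam 1 - δ) (lam n + δ)),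
              (∀ t, ξ t = (v t : (A ε).Frac α) + (s (v t) : (A ε).Frac α)) ∧
              (A ε).IsReducedSolution (f ε) (Ioo (lam 1 - δ) (lam n + δ)) s v := by
  classical
  have hα0 : 0 ≤ α := hα.1.le
  have hα1 : 0 < 1 - α := by linarith [hα.2]
  have hC0 : 0 ≤ C := (norm_nonneg _).trans (hf_bdd ⟨ε₀, hε₀, le_rfl⟩ 0)
  have hΓ : 0 < Real.Gamma (1 - α) := Real.Gamma_pos_of_pos hα1
  have hEC : ∀ ε x, ‖x‖ ≤ C * ‖E ε x‖ := fun ε x => by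
    have := hM_frac ε (E ε x)
    rwa [hME] at this
  -- As `E ε` is injective, a nonzero vector of `X₀` provides a unit vector in every `X_ε^α`.
  have : Nontrivial X₀ := Module.nontrivial_of_finrank_pos (R := ℝ) (by omega)
  have hne : ∀ ε, ∃ u : (A ε).Frac α, ‖u‖ = 1 := fun ε => by
    obtain ⟨x, hx⟩ := exists_ne (0 : X₀)
    have hx0 : E ε x ≠ 0 := fun h0 => by
      have := hEC ε x
      rw [h0, norm_zero, mul_zero] at this
      exact hx (norm_le_zero_iff.1 this)
    exact ⟨‖E ε x‖⁻¹ • E ε x, by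
      rw [norm_smul, norm_inv, norm_norm, inv_mul_cancel₀ (norm_ne_zero_iff.2 hx0)]⟩
  -- `A_ε⁻¹ : X_ε → X_ε^α` is bounded uniformly in `ε`
  have hτ0 : ∀ ε : Ioc (0 : ℝ) ε₀, τ ε ≤ τ ε₀ := fun ε =>
    hτ_mono ⟨ε.2.1.le, ε.2.2⟩ ⟨hε₀.le, le_rfl⟩ ε.2.2
  set K := τ ε₀ + C * (‖(A₀.symm : X₀ →L[ℝ] X₀)‖ * C) with hKdef
  have hK0 : 0 ≤ K := add_nonneg (hτ_pos ε₀ ⟨hε₀, le_rfl⟩).le (by positivity)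
  have hK : ∀ ε (u : X ε), ‖(A ε).invFrac hα u‖ ≤ K * ‖u‖ := fun ε u => by
    have h1 : ‖E ε (A₀.symm (M ε u))‖ ≤ C * (‖(A₀.symm : X₀ →L[ℝ] X₀)‖ * (C * ‖u‖)) := by
      refine (hE_frac ε _).trans (mul_le_mul_of_nonneg_left ?_ hC0)
      refine ((A₀.symm : X₀ →L[ℝ] X₀).le_opNorm _).trans ?_
      gcongr
      exact hM ε u
    have h2 : ‖(A ε).invFrac hα u - E ε (A₀.symm (M ε u))‖ ≤ τ ε₀ * ‖u‖ :=
      (hτ ε u).trans (mul_le_mul_of_nonneg_right (hτ0 ε) (norm_nonneg _))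
    have h3 := norm_add_le ((A ε).invFrac hα u - E ε (A₀.symm (M ε u))) (E ε (A₀.symm (M ε u)))
    rw [sub_add_cancel] at h3
    rw [hKdef]
    nlinarith
  -- the spectrum of `A₀`
  have hlam1 : ∀ i ∈ Finset.Icc 1 n, lam 1 ≤ lam i ∧ lam i ≤ lam n := fun i hi => by
    have hi := Finset.mem_Icc.1 hi
    exact ⟨hlam.monotoneOn ⟨le_rfl, hn⟩ hi hi.1, hlam.monotoneOn hi ⟨hn, le_rfl⟩ hi.2⟩
  obtain ⟨η, hη, hηδ, hsep⟩ := exists_pos_separation lam n hlam hδ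
  -- the constants of the spectral gap
  set b := lam n + δ
  have hb0 : 0 < b := by
    have := (hlam1 n (Finset.mem_Icc.2 ⟨hn, le_rfl⟩)).1
    linarith
  have hCb : 0 ≤ C * b ^ α := by positivity
  -- This makes `C b^α ≤ (γ - b)/4`; the `1` ensures `b < γ` even when `C = 0`. The level `m₀` is
  -- then taken so high that `2γ ≤ m₀` and the fast integral is small, all independently of `ε`.
  set γ := b + 4 * (C * b ^ α) + 1 with hγ
  obtain ⟨m₀, hm₀, hγm₀, hgap⟩ := exists_gapConst_le (C := C) hα (2 * γ)
  have hbm₀ : b ≤ m₀ := by linarith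
  have hev := (PosOperator.eventually_not_hasLowModes hα
    (fun ε => PosOperator.norm_incl_le hα hK0 (hK ε)) hE_norm hne hCC.2
    (show Module.finrank ℝ X₀ < n + 1 by omega) m₀).and
    ((eventually_all_finset (Finset.Icc 1 n)).2 fun i hi => by
      have hli : 0 < lam i := hlam_pos.trans_le (hlam1 i hi).1
      have hsp : lam i ∈ spectrum ℝ (A₀ : X₀ →L[ℝ] X₀) := by
        rw [hspec]; exact ⟨i, Finset.mem_Icc.1 hi, rfl⟩
      obtain ⟨x, hx0, hx⟩ := exists_eigenvector_of_mem_spectrum hli.ne' hsp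
      exact PosOperator.eventually_exists_isEig hα hCC.1 hEC hli hη hx0 hx)
  obtain ⟨ε₁, hε₁, hε⟩ := exists_pos_of_eventually_toZero hev
  refine ⟨C * (4 * Real.Gamma (1 - α)) + 1, by positivity, ε₁, hε₁, fun ε hεε => ?_⟩
  obtain ⟨hnot, heig⟩ := hε ε hεε
  have hidx : ∀ i : Fin n, (i : ℕ) + 1 ∈ Finset.Icc 1 n := fun i =>
    Finset.mem_Icc.2 ⟨by omega, by omega⟩
  choose ν hνE hνlam using fun i : Fin n => heig (i + 1) (hidx i)
  have hex : ∀ i, ∃ x ∈ (A ε).eigenspace (ν i), ‖x‖ = 1 := fun i => by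
    obtain ⟨x, hx, hx0⟩ := (Submodule.ne_bot_iff _).1 (hνE i)
    exact ⟨‖x‖⁻¹ • x, Submodule.smul_mem _ _ hx, by
      rw [norm_smul, norm_inv, norm_norm, inv_mul_cancel₀ (norm_ne_zero_iff.2 hx0)]⟩
  choose e he he1 using hex
  have hlow : (A ε).IsLowSpectrum ν e := by
    refine ⟨fun i j hij => ?_, he, he1⟩
    by_contra hne'
    have h1 := hsep _ (hidx i) _ (hidx j) fun h => hne' (Fin.ext (by omega))
    have h2 := hνlam i
    have h3 := hνlam j
    rw [← hij] at h3
    have h4 := abs_sub_le (lam (i + 1)) (ν i) (lam (j + 1))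
    rw [abs_sub_comm (lam (i + 1)) (ν i)] at h4
    linarith
  have hνS : ∀ i, ν i ∈ Ioo (lam 1 - δ) b := fun i => by
    have h1 := abs_lt.1 (hνlam i)
    have h2 := hlam1 _ (hidx i)
    exact ⟨by linarith, by linarith⟩
  have hνm : ∀ i, ν i ≤ m₀ := fun i => (hνS i).2.le.trans hbm₀
  set W := Finset.univ.image ν with hW
  have hνW : ∀ μ, μ ∉ W → ∀ i, ν i ≠ μ := fun μ hμ i h =>
    hμ (Finset.mem_image.2 ⟨i, Finset.mem_univ i, h⟩)
  have hout : ∀ μ, (A ε).IsEig μ → μ ∉ W → m₀ < μ := fun μ hμ hμW => by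
    by_contra hle
    exact hnot (hlow.hasLowModes_of_notMem hνm (not_lt.1 hle) hμ (hνW μ hμW))
  have hWS : ∀ μ ∈ W, μ ∈ Ioo (lam 1 - δ) b := fun μ hμ => by
    obtain ⟨i, -, rfl⟩ := Finset.mem_image.1 hμ
    exact hνS i
  have hSW : ∀ μ, (A ε).IsEig μ → (μ ∈ Ioo (lam 1 - δ) b ↔ μ ∈ W) := fun μ hμ => by
    refine ⟨fun h => ?_, hWS μ⟩
    by_contra hμW
    linarith [hout μ hμ hμW, h.2]
  have hτε : 0 < τ ε := hτ_pos ε ε.2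
  -- Together with the `n` modes `e i`, an eigenvector for `μ` gives `n + 1` modes up to level `μ`.
  -- The rank argument yields `μ^{α-1} ≤ τ ε`, and the negative power `1/(α-1)` reverses the
  -- inequality.
  have hout' : ∀ μ, (A ε).IsEig μ → μ ∉ W → τ ε ^ (1 / (α - 1)) ≤ μ := fun μ hμ hμW => by
    have h1 := (hlow.hasLowModes_of_notMem (fun i => (hνm i).trans (hout μ hμ hμW).le) le_rfl hμ
      (hνW μ hμW)).rpow_le hα (show Module.finrank ℝ X₀ < n + 1 by omega) hμ.pos (M ε)
      (fun x => E ε (A₀.symm x)) (by simp) (hτ ε)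
    have h2 := Real.rpow_le_rpow_of_nonpos (Real.rpow_pos_of_pos hμ.pos _) h1
      (show 1 / (α - 1) ≤ 0 from one_div_nonpos.2 (by linarith))
    rwa [← Real.rpow_mul hμ.pos.le, mul_one_div_cancel (by linarith), Real.rpow_one] at h2
  -- Both lower bounds for the fast eigenvalues are kept: `m₀` guarantees the gap condition, as a
  -- monotone `τ` with `τ 0 = 0` need not tend to `0`; the other one makes the gap constant, and
  -- with it the manifold's distance from `Y_ε`, of order `τ ε`.
  set m := max m₀ (τ ε ^ (1 / (α - 1))) with hm
  have hgap1 : PosOperator.gapConst α m ≤ PosOperator.gapConst α m₀ := by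
    unfold PosOperator.gapConst
    gcongr 4 * Real.Gamma (1 - α) * ?_
    exact Real.rpow_le_rpow_of_nonpos hm₀ (le_max_left _ _) (by linarith)
  have hgap2 : PosOperator.gapConst α m ≤ 4 * Real.Gamma (1 - α) * τ ε := by
    unfold PosOperator.gapConst
    gcongr 4 * Real.Gamma (1 - α) * ?_
    have h1 := Real.rpow_le_rpow_of_nonpos (Real.rpow_pos_of_pos hτε (1 / (α - 1)))
      (le_max_right m₀ (τ ε ^ (1 / (α - 1)))) (show α - 1 ≤ 0 by linarith)
    rwa [← Real.rpow_mul hτε.le, one_div_mul_cancel (by linarith), Real.rpow_one] at h1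
  have hSG : (A ε).SpectralGap α (fun x => f ε (((A ε).powEquiv hα0).symm x)) W C b γ m :=
    { hα := hα
      b_pos := hb0
      le_b := fun μ hμ _ => (hWS μ hμ).2.le
      m_le := fun μ hμ hμW => max_le (hout μ hμ hμW).le (hout' μ hμ hμW)
      b_lt := by linarith
      two_mul_le := hγm₀.trans (le_max_left _ _)
      bdd := fun u => hf_bdd ε _
      lip := fun u v => (hf_lip ε _ _).trans_eq (by rw [← map_sub, LinearIsometryEquiv.norm_map])
      small_fast := (mul_le_mul_of_nonneg_left hgap1 hC0).trans hgap
      small_slow := by rw [hγ]; linarith }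
  refine ⟨hlow.finrank_specY hα0 hνm hnot hSW, fun μ hμ => ?_, ?_⟩
  · by_cases hμW : μ ∈ W
    · exact Or.inl (hWS μ hμW)
    · exact Or.inr (hbm₀.trans_lt (hout μ hμ hμW))
  obtain ⟨s, hs1, hs2, hs3⟩ := PosOperator.SpectralGap.exists_inertialManifold hα0 hα (hT ε) hSW
    (hf ε).continuous hSG
  refine ⟨s, hs1, fun v => (hs2 v).trans ?_, hs3⟩
  have h1 := mul_le_mul_of_nonneg_left hgap2 hC0
  have h2 : 0 < ρ ε := hρ_pos ε ε.2
  have h3 : 0 ≤ C * (4 * Real.Gamma (1 - α)) * ρ ε := by positivity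
  nlinarith
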